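/- **Setting.** Let $A\in\mathbb R^{d\times d}$, $B\in\mathbb R^{d\times k}$ (with $d\ge 1$) and $W\succeq 0$, and consider $x_{t+1}=Ax_t+Bu_t+w_t$ with initial state $0$ and $w_t$ i.i.d. $\mathcal N(0,W)$. Positive semidefinite cost matrices $Q_t\in\mathbb R^{d\times d}$, $R_t\in\mathbb R^{k\times k}$ with $\operatorname{tr}Q_t,\operatorname{tr}R_t\le C$ (where $C>0$) are fixed in advance; in round $t$ the learner sees $x_t$, plays $u_t$, pays $x_t^{\top}Q_tx_t+u_t^{\top}R_tu_t$ and then learns $(Q_t,R_t)$. There are $T\ge1$ rounds. $J_T(\cdot)$ is the expected total cost of these $T$ rounds, for the algorithm $\mathcal A$ below or for a policy $u_t=Kx_t$. A matrix $K\in\mathbb R^{k\times d}$ is *$(\kappa,\gamma)$-strongly stable* ($\kappa>0$, $0<\gamma\le1$) if $\|K\|\le\kappa$ and $A+BK=HLH^{-1}$ for some real $L,H$ with $\|L\|\le1-\gamma$ and $\|H\|\,\|H^{-1}\|\le\kappa$ (spectral norms). It is *stable* if $\rho(A+BK)<1$; then its steady-state covariance is the unique $X$ with $X=(A+BK)X(A+BK)^{\top}+W$,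 and its steady-state cost for $(Q,R)$ is $\operatorname{tr}((Q+K^{\top}RK)X)$. **Oracle.** For symmetric $(Q,R)$ (not necessarily positive semidefinite), $\textsc{Oracle}(Q,R,\nu)$ returns, as a measurable function of $(Q,R)$, *either* a stable $K$ of minimum steady-state cost subject to $\operatorname{tr}X+\operatorname{tr}(KXK^{\top})\le\nu$, *or* (SDP implementation) a $K$ with $K\Sigma_{xx}=\Sigma_{ux}$, that is $K=\Sigma_{ux}\Sigma_{xx}^{-1}$ when $\Sigma_{xx}$ is invertible, where $\Sigma$ minimizes $\operatorname{tr}\left(\begin{pmatrix}Q&0\\0&R\end{pmatrix}\Sigma\right)$ subject to $\Sigma\succeq0$, $\operatorname{tr}\Sigma\le\nu$, $\Sigma_{xx}=(A\;B)\Sigma(A\;B)^{\top}+W$. The result holds for each of the two types of oracle (one type being used throughout the run). **Reset.** A reset plan of length $m$ consists of measurable controls $v_0(x),\dots,v_{m-1}(x)$ that drive the noiseless system from every state $x$ to $0$ in $m$ rounds, through states $z_0(x)=x,z_1(x),\dots,z_m(x)=0$. A reset begun in round $s$, with the current control matrix $K$, plays $u_{s+j}=v_j(x_s)+K(x_{s+j}-z_j(x_s))$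 for $0\le j<m$. (If $B$ has rank $d$, one may take $m=1$ and $v_0(x)=-B^{\dagger}Ax$.) **Algorithm $\mathcal A$ (Follow the Lazy Leader).** Let $\mu$ be the law of a pair of symmetric matrices whose upper-triangular entries are i.i.d. Laplace with scale $1/\eta$, and $d\mu$ its density. Sample $(Q^p_1,R^p_1)\sim\mu$. In round $t$, let $K_t=\textsc{Oracle}\left(\sum_{s<t}Q_s+Q^p_t,\ \sum_{s<t}R_s+R^p_t,\ \nu\right)$, and play $u_t=K_tx_t$, or, if a reset is in progress, its control with $K=K_t$. At the end of round $t$, with probability $\min\left\{1,\frac{d\mu(Q^p_t-Q_t,R^p_t-R_t)}{d\mu(Q^p_t,R^p_t)}\right\}$ set $(Q^p_{t+1},R^p_{t+1})=(Q^p_t-Q_t,R^p_t-R_t)$; otherwise set $(Q^p_{t+1},R^p_{t+1})=(-Q^p_t,-R^p_t)$ and begin a new reset in round $t+1$ (abandoning one in progress). The initial perturbation, the coin flips and the noise are independent. **Theorem.** There is a universal constant $c>0$ such that the following holds. Let $\operatorname{tr}W\le\lambda^2$ with $\lambda>0$, let $\nu=2\kappa^4\lambda^2/\gamma$ and $C_r\ge0$,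 and run $\mathcal A$ with this $\nu$ and with $$\eta=\sqrt{\frac{16\,\nu\,(d+k)}{T\,C\,\sqrt{d+k}\,(C_r+8C\nu)}}.$$ Suppose that the cost of a reset is at most $C_r$: for each round $s$, conditionally on a reset being triggered at the end of round $s$, the expected cost of the rounds (up to round $T$) spent on that reset is at most $C_r$. Then the total cost of $\mathcal A$ is integrable, and for every $(\kappa,\gamma)$-strongly stable $K^\star$ $$J_T(\mathcal A)-J_T(K^\star)\le c\left((d+k)^{3/4}\sqrt{C\nu(C_r+C\nu)T}+\frac{C\kappa^4\nu}{\gamma}\right).$$ In particular, if $T\ge\kappa^8/\gamma^2$, then (with the same $c$) $$J_T(\mathcal A)-J_T(K^\star)\le c\,(d+k)^{3/4}\sqrt{C\nu(C_r+C\nu)T}.$$ -/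

import Mathlib

open MeasureTheory ProbabilityTheory Matrix

namespace OnlineLQ

/-! ### Linear-quadratic systems, strong stability, steady states -/

/-- The system `x_{t+1} = A x_t + B u_t + w_t`, with noise `w_t ~ N(0, W)`,
`x_t ∈ ℝ^d`, `u_t ∈ ℝ^k`. -/
structure LQSystem (d k : ℕ) where
  A : Matrix (Fin d) (Fin d) ℝ
  B : Matrix (Fin d) (Fin k) ℝ
  W : Matrix (Fin d) (Fin d) ℝ

/-- Element-wise inner product `M • N = tr(Mᵀ N)`. -/
def frob {m n : Type*} [Fintype m] [Fintype n] (M N : Matrix m n ℝ) : ℝ :=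
  trace (Mᵀ * N)

variable {d k : ℕ}

/-- The closed loop matrix `A + B K`. -/
def LQSystem.closedLoop (S : LQSystem d k) (K : Matrix (Fin k) (Fin d) ℝ) :
    Matrix (Fin d) (Fin d) ℝ :=
  S.A + S.B * K

/-- `K` is stable: the spectral radius of `A + B K` (over all complex eigenvalues) is `< 1`. -/
def LQSystem.Stable (S : LQSystem d k) (K : Matrix (Fin k) (Fin d) ℝ) : Prop :=
  spectralRadius ℂ ((S.closedLoop K).map (fun a : ℝ => (a : ℂ))) < 1

open scoped Matrix.Norms.L2Operator in
/-- `(κ, γ)`-strong stability; the norms are spectral (operator `ℓ²`) norms. -/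
def LQSystem.StronglyStable (S : LQSystem d k) (κ γ : ℝ) (K : Matrix (Fin k) (Fin d) ℝ) : Prop :=
  0 < κ ∧ 0 < γ ∧ γ ≤ 1 ∧ ‖K‖ ≤ κ ∧
    ∃ L H : Matrix (Fin d) (Fin d) ℝ, IsUnit H ∧ S.closedLoop K = H * L * H⁻¹ ∧
      ‖L‖ ≤ 1 - γ ∧ ‖H‖ * ‖H⁻¹‖ ≤ κ

/-- `K` is stable and `X` is the covariance of its steady-state distribution, i.e. the (unique)
solution of `X = (A + B K) X (A + B K)ᵀ + W`. -/
def LQSystem.IsSteadyState (S : LQSystem d k) (K : Matrix (Fin k) (Fin d) ℝ)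
    (X : Matrix (Fin d) (Fin d) ℝ) : Prop :=
  S.Stable K ∧ X.PosSemidef ∧ X = S.closedLoop K * X * (S.closedLoop K)ᵀ + S.W

/-- The steady-state cost `(Q + Kᵀ R K) • X` of `K` with steady-state covariance `X`. -/
def steadyCost (Q : Matrix (Fin d) (Fin d) ℝ) (R : Matrix (Fin k) (Fin k) ℝ)
    (K : Matrix (Fin k) (Fin d) ℝ) (X : Matrix (Fin d) (Fin d) ℝ) : ℝ :=
  frob (Q + Kᵀ * R * K) X

/-! ### The oracle -/

/-- `K` minimizes the steady-state cost for `(Q, R)` among the stable `K'` with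
`tr(X') + tr(K' X' K'ᵀ) ≤ ν`. -/
def LQSystem.IsOptimalControl (S : LQSystem d k) (ν : ℝ) (Q : Matrix (Fin d) (Fin d) ℝ)
    (R : Matrix (Fin k) (Fin k) ℝ) (K : Matrix (Fin k) (Fin d) ℝ) : Prop :=
  ∃ X, S.IsSteadyState K X ∧ trace X + trace (K * X * Kᵀ) ≤ ν ∧
    ∀ K' X', S.IsSteadyState K' X' → trace X' + trace (K' * X' * K'ᵀ) ≤ ν →
      steadyCost Q R K X ≤ steadyCost Q R K' X'

/-- Feasibility for the SDP relaxation: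
`Σ ⪰ 0`, `tr Σ ≤ ν` and `Σ_xx = (A B) Σ (A B)ᵀ + W`. -/
def LQSystem.SDPFeasible (S : LQSystem d k) (ν : ℝ)
    (Sig : Matrix (Fin d ⊕ Fin k) (Fin d ⊕ Fin k) ℝ) : Prop :=
  Sig.PosSemidef ∧ trace Sig ≤ ν ∧
    Sig.toBlocks₁₁ = fromCols S.A S.B * Sig * (fromCols S.A S.B)ᵀ + S.W

/-- The SDP objective `diag(Q, R) • Σ`. -/
def sdpCost (Q : Matrix (Fin d) (Fin d) ℝ) (R : Matrix (Fin k) (Fin k) ℝ)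
    (Sig : Matrix (Fin d ⊕ Fin k) (Fin d ⊕ Fin k) ℝ) : ℝ :=
  frob (fromBlocks Q 0 0 R) Sig

/-- `Σ` is an optimal solution of the SDP with costs `(Q, R)`. -/
def LQSystem.IsSDPSolution (S : LQSystem d k) (ν : ℝ) (Q : Matrix (Fin d) (Fin d) ℝ)
    (R : Matrix (Fin k) (Fin k) ℝ) (Sig : Matrix (Fin d ⊕ Fin k) (Fin d ⊕ Fin k) ℝ) : Prop :=
  S.SDPFeasible ν Sig ∧ ∀ Sig', S.SDPFeasible ν Sig' → sdpCost Q R Sig ≤ sdpCost Q R Sig'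

/-- A (Borel measurable) map from pairs of cost matrices to matrices. -/
def MeasurableOracle {m n : Type*}
    (f : Matrix (Fin d) (Fin d) ℝ → Matrix (Fin k) (Fin k) ℝ → Matrix m n ℝ) : Prop :=
  ∀ i j, Measurable fun p : (Fin d → Fin d → ℝ) × (Fin k → Fin k → ℝ) =>
    f (Matrix.of p.1) (Matrix.of p.2) i j

/-- The oracle in its defining form: it returns an optimal control matrix. -/
def LQSystem.IsControlOracle (S : LQSystem d k) (ν : ℝ)
    (oracle : Matrix (Fin d) (Fin d) ℝ → Matrix (Fin k) (Fin k) ℝ → Matrix (Fin k) (Fin d) ℝ) :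
    Prop :=
  MeasurableOracle oracle ∧ ∀ Q R, Q.IsSymm → R.IsSymm → S.IsOptimalControl ν Q R (oracle Q R)

/-- The oracle implemented through the SDP: it solves the SDP and extracts from the
solution `Σ` the matrix `K = Σ_ux Σ_xx⁻¹` (if `Σ_xx` is singular, some `K` with
`K Σ_xx = Σ_ux`; there always is one, because `Σ ⪰ 0`). -/
def LQSystem.IsSDPOracle (S : LQSystem d k) (ν : ℝ)
    (oracle : Matrix (Fin d) (Fin d) ℝ → Matrix (Fin k) (Fin k) ℝ → Matrix (Fin k) (Fin d) ℝ) :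
    Prop :=
  MeasurableOracle oracle ∧
    ∃ sol : Matrix (Fin d) (Fin d) ℝ → Matrix (Fin k) (Fin k) ℝ →
        Matrix (Fin d ⊕ Fin k) (Fin d ⊕ Fin k) ℝ,
      MeasurableOracle sol ∧ ∀ Q R, Q.IsSymm → R.IsSymm →
        S.IsSDPSolution ν Q R (sol Q R) ∧
          oracle Q R * (sol Q R).toBlocks₁₁ = (sol Q R).toBlocks₂₁

/-! ### Laplace perturbations -/

/-- Density of the Laplace distribution with scale `1/η`. -/
noncomputable def laplaceDensity (η x : ℝ) : ℝ := η / 2 * Real.exp (-(η * |x|))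

/-- The Laplace distribution with scale `1/η`. -/
noncomputable def laplace (η : ℝ) : Measure ℝ :=
  volume.withDensity fun x => ENNReal.ofReal (laplaceDensity η x)

/-- Positions in the upper triangle (with diagonal) of an `n × n` matrix. -/
abbrev UpperIdx (n : ℕ) : Type := {p : Fin n × Fin n // p.1 ≤ p.2}

/-- The symmetric matrix with a given upper triangle. -/
def symOf {n : ℕ} (q : UpperIdx n → ℝ) : Matrix (Fin n) (Fin n) ℝ :=
  Matrix.of fun i j => if h : i ≤ j then q ⟨(i, j), h⟩ else q ⟨(j, i), le_of_not_ge h⟩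

/-- Density `dμ(Q, R)` of a pair of symmetric matrices whose upper triangles have i.i.d.
Laplace entries of scale `1/η`. -/
noncomputable def pertDensity (η : ℝ) (Q : Matrix (Fin d) (Fin d) ℝ)
    (R : Matrix (Fin k) (Fin k) ℝ) : ℝ :=
  (∏ p : UpperIdx d, laplaceDensity η (Q p.1.1 p.1.2)) *
    ∏ p : UpperIdx k, laplaceDensity η (R p.1.1 p.1.2)

/-! ### The probability space -/

/-- Law of the noise sequence `w_0, w_1, …`: i.i.d. `N(0, W)`. -/
noncomputable def LQSystem.noiseLaw (S : LQSystem d k) :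
    Measure (ℕ → EuclideanSpace ℝ (Fin d)) :=
  Measure.infinitePi fun _ : ℕ => multivariateGaussian 0 S.W

/-- All the randomness of a run of the algorithm: the upper triangles of the initial
perturbation, the coins (uniform on `[0,1]`) of the rounds, and the noise. -/
abbrev Sample (d k : ℕ) : Type :=
  ((UpperIdx d → ℝ) × (UpperIdx k → ℝ)) × (ℕ → unitInterval) × (ℕ → EuclideanSpace ℝ (Fin d))

/-- The law of the randomness: all components are independent. -/
noncomputable def LQSystem.sampleLaw (S : LQSystem d k) (η : ℝ) : Measure (Sample d k) :=
  ((Measure.pi fun _ : UpperIdx d => laplace η).prod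
      (Measure.pi fun _ : UpperIdx k => laplace η)).prod
    ((Measure.infinitePi fun _ : ℕ => (volume : Measure unitInterval)).prod S.noiseLaw)

/-! ### Costs, and the cost of a fixed linear policy -/

/-- `xᵀ Q x + uᵀ R u`. -/
def stageCost (Q : Matrix (Fin d) (Fin d) ℝ) (R : Matrix (Fin k) (Fin k) ℝ)
    (x : Fin d → ℝ) (u : Fin k → ℝ) : ℝ :=
  x ⬝ᵥ (Q *ᵥ x) + u ⬝ᵥ (R *ᵥ u)

/-- One transition of the system. -/
def LQSystem.next (S : LQSystem d k) (x : Fin d → ℝ) (u : Fin k → ℝ)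
    (w : EuclideanSpace ℝ (Fin d)) : Fin d → ℝ :=
  S.A *ᵥ x + S.B *ᵥ u + w.ofLp

/-- States visited under `u_t = K x_t`, from the initial state `0`. -/
def LQSystem.policyState (S : LQSystem d k) (K : Matrix (Fin k) (Fin d) ℝ)
    (w : ℕ → EuclideanSpace ℝ (Fin d)) : ℕ → Fin d → ℝ
  | 0 => 0
  | t + 1 => S.next (S.policyState K w t) (K *ᵥ S.policyState K w t) (w t)

/-- `J_T(K)`: the expected cost of the policy `u_t = K x_t` in the rounds `0, …, T-1`. -/
noncomputable def LQSystem.policyCost (S : LQSystem d k) (Q : ℕ → Matrix (Fin d) (Fin d) ℝ)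
    (R : ℕ → Matrix (Fin k) (Fin k) ℝ) (K : Matrix (Fin k) (Fin d) ℝ) (T : ℕ) : ℝ :=
  ∫ w, ∑ t ∈ Finset.range T,
    stageCost (Q t) (R t) (S.policyState K w t) (K *ᵥ S.policyState K w t) ∂S.noiseLaw

/-! ### Resets -/

/-- The noiseless trajectory from `x` under the open-loop controls `v 0 x, v 1 x, …`. -/
def LQSystem.driven (S : LQSystem d k) (v : ℕ → (Fin d → ℝ) → Fin k → ℝ) :
    ℕ → (Fin d → ℝ) → Fin d → ℝ
  | 0, x => x
  | j + 1, x => S.A *ᵥ S.driven v j x + S.B *ᵥ v j x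

/-- A reset plan: open-loop controls that drive the noiseless system from any
state to zero in `len` rounds. The one-step reset `u = -B† A x` for `B` of full rank `d` is the
case `len = 1`, `v 0 x = -B† A x`. -/
structure ResetPlan (S : LQSystem d k) where
  len : ℕ
  v : ℕ → (Fin d → ℝ) → Fin k → ℝ
  measurable_v : ∀ j, Measurable (v j)
  drives_to_zero : ∀ x, S.driven v len x = 0

/-! ### Follow the Lazy Leader -/

/-- The data of a run: system, cost sequences (fixed in advance), parameter `η`, oracle and
reset plan. -/
structure FLL (d k : ℕ) where
  S : LQSystem d k
  Q : ℕ → Matrix (Fin d) (Fin d) ℝ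
  R : ℕ → Matrix (Fin k) (Fin k) ℝ
  η : ℝ
  oracle : Matrix (Fin d) (Fin d) ℝ → Matrix (Fin k) (Fin k) ℝ → Matrix (Fin k) (Fin d) ℝ
  plan : ResetPlan S

namespace FLL

open scoped Classical in
/-- The perturbations `(Q^p_t, R^p_t)`. With probability
`min {1, dμ(Q^p_t - Q_t, R^p_t - R_t) / dμ(Q^p_t, R^p_t)}` the next pair is
`(Q^p_t - Q_t, R^p_t - R_t)`, and otherwise it is `(-Q^p_t, -R^p_t)`. -/
noncomputable def pert (F : FLL d k) (ω : Sample d k) :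
    ℕ → Matrix (Fin d) (Fin d) ℝ × Matrix (Fin k) (Fin k) ℝ
  | 0 => (symOf ω.1.1, symOf ω.1.2)
  | t + 1 =>
    let p := F.pert ω t
    if (ω.2.1 t : ℝ) ≤
        min 1 (pertDensity F.η (p.1 - F.Q t) (p.2 - F.R t) / pertDensity F.η p.1 p.2)
    then (p.1 - F.Q t, p.2 - F.R t)
    else (-p.1, -p.2)

/-- At the end of round `t` the algorithm does not keep its perturbed leader: it switches and
performs a reset. -/
def Switch (F : FLL d k) (t : ℕ) (ω : Sample d k) : Prop :=
  ¬ ((ω.2.1 t : ℝ) ≤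
    min 1 (pertDensity F.η ((F.pert ω t).1 - F.Q t) ((F.pert ω t).2 - F.R t) /
      pertDensity F.η (F.pert ω t).1 (F.pert ω t).2))

/-- `K_t`: the oracle's answer on the perturbed sum of the costs of the earlier rounds. -/
noncomputable def gain (F : FLL d k) (ω : Sample d k) (t : ℕ) : Matrix (Fin k) (Fin d) ℝ :=
  F.oracle (∑ s ∈ Finset.range t, F.Q s + (F.pert ω t).1)
    (∑ s ∈ Finset.range t, F.R s + (F.pert ω t).2)

/-- What the learner has in memory at the start of a round: the system's state `x`, the state
`anchor` in which the latest reset began, and the number `age` of rounds since then. -/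
structure Memory (d : ℕ) where
  x : Fin d → ℝ
  anchor : Fin d → ℝ
  age : ℕ

/-- The control. In round `j < len` of a reset begun in state `a`, the learner plays the
noiseless control `v j a` plus `K y`, where `y` is the deviation of the state from the noiseless
trajectory. After the reset (and before the first one) it plays `K x`. -/
def control (F : FLL d k) (K : Matrix (Fin k) (Fin d) ℝ) (s : Memory d) : Fin k → ℝ :=
  if s.age < F.plan.len then
    F.plan.v s.age s.anchor + K *ᵥ (s.x - F.S.driven F.plan.v s.age s.anchor)
  else K *ᵥ s.x

open scoped Classical in
/-- The run of the algorithm from the initial state `0`, with no reset in progress. A switch at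
the end of round `t` makes a (new) reset begin in round `t + 1`. -/
noncomputable def mem (F : FLL d k) (ω : Sample d k) : ℕ → Memory d
  | 0 => ⟨0, 0, F.plan.len⟩
  | t + 1 =>
    let s := F.mem ω t
    let x' := F.S.next s.x (F.control (F.gain ω t) s) (ω.2.2 t)
    if F.Switch t ω then ⟨x', x', 0⟩ else ⟨x', s.anchor, s.age + 1⟩

/-- Cost suffered in round `t`. -/
noncomputable def roundCost (F : FLL d k) (t : ℕ) (ω : Sample d k) : ℝ :=
  stageCost (F.Q t) (F.R t) (F.mem ω t).x (F.control (F.gain ω t) (F.mem ω t))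

/-- Total cost of the rounds `0, …, T-1`, including the rounds spent on resets. -/
noncomputable def totalCost (F : FLL d k) (T : ℕ) (ω : Sample d k) : ℝ :=
  ∑ t ∈ Finset.range T, F.roundCost t ω

/-- Cost of the reset that is triggered by a switch at the end of round `s`: the sum of the costs
of the rounds before `T` that are spent on this reset (at most `len` rounds, fewer if another
switch makes the reset start anew). -/
noncomputable def resetCost (F : FLL d k) (T s : ℕ) (ω : Sample d k) : ℝ :=
  ∑ t ∈ Finset.Ico (s + 1) T,
    if (F.mem ω t).age = t - (s + 1) ∧ (F.mem ω t).age < F.plan.len then F.roundCost t ω else 0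

/-- The law of the randomness of the run. -/
noncomputable def law (F : FLL d k) : Measure (Sample d k) := F.S.sampleLaw F.η

/-- The (expected) cost of a reset is at most `Cr`: for each round `s`, the conditional expectation
of the cost of the reset triggered at the end of round `s`, given that one is triggered,
is at most `Cr`. -/
def ResetCostAtMost (F : FLL d k) (T : ℕ) (Cr : ℝ) : Prop :=
  ∀ s, ∫⁻ ω in {ω | F.Switch s ω}, ENNReal.ofReal (F.resetCost T s ω) ∂F.law ≤
    ENNReal.ofReal Cr * F.law {ω | F.Switch s ω}

end FLL

/-- The choice of `η`:
`η = √(16 ν n / (T C √n (C_r + 8 C ν)))`, where `n = d + k`. -/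
noncomputable def tunedEta (n : ℕ) (C ν Cr : ℝ) (T : ℕ) : ℝ :=
  Real.sqrt (16 * ν * n / (T * C * Real.sqrt n * (Cr + 8 * C * ν)))

end OnlineLQ

namespace OnlineLQ

/-! ### The element-wise inner product and positive semidefinite matrices -/

section Frob

variable {m n : Type*} [Fintype m] [Fintype n]

/-! Steady-state costs are linear in the joint second moment `Σ` of state and input, so each round
poses a linear problem over semidefinite matrices of trace at most `ν`. Follow the perturbed leader
solves it, and laziness keeps gain changes rare enough for steady-state costs to describe the actual
system. Both oracles are used only through `IsCertificate`: a matrix `sol Q R` that minimizes the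
linear cost among its own values and the comparator's `Z`, and whose state block `X` satisfies the
Lyapunov inequality `X ⪰ (A+BK) X (A+BK)ᵀ + W` for the returned gain `K`.

System. When the leader is kept, the revealed cost enters the cumulative sum and leaves the
perturbation, so the oracle's argument and `K` do not change (`leaderVec_succ_of_keep`). The
deviation from the reset trajectory follows the closed loop and restarts at zero at each switch. For
fixed perturbation and coins its covariance therefore stays below `X` (`exists_deviation`), and a
round outside resets costs on average at most the linear cost of the current `sol`
(`lintegral_regularCost_le`).

Probability. Keeping or reflecting preserves the Laplace law (`lintegral_lazy`,
`lintegral_pertVec`), so in every round the perturbation is distributed as the initial one. A cost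
of Frobenius norm at most `C` causes a switch with probability at most `3ηC` (`law_switch_le`), with
no dimension factor: the shifts of the single entries have mean of second order, and their
fluctuations add in the Euclidean norm.

Regret. A kept leader of round `t` is also the leader of round `t+1`, so its cost is at most the
growth of the minimal value (`le_gap`); a switch is charged `Cν` for the round and `C_r` for the
reset. Under the common law the growths telescope, leaving the comparator's cost plus `2ν` times the
mean Frobenius norm of a perturbation, at most `3ν(d+k)/η` (`sum_integral_gap_le`). Starting the
comparator at zero rather than in steady state changes its cost by at most `2Cκ⁴ν/γ`
(`sum_sdpCost_le_policyCost`). The choice of `η` then gives the rate. -/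

theorem frob_eq_sum (M N : Matrix m n ℝ) : frob M N = ∑ i, ∑ j, M i j * N i j := by
  rw [frob, trace, Finset.sum_comm]
  simp [mul_apply]

theorem frob_add_left (M M' N : Matrix m n ℝ) : frob (M + M') N = frob M N + frob M' N := by
  simp [frob, Matrix.add_mul]

theorem frob_sub_right (M N N' : Matrix m n ℝ) : frob M (N - N') = frob M N - frob M N' := by
  simp [frob, Matrix.mul_sub]

theorem PosSemidef.exists_factor {X : Matrix n n ℝ} (hX : X.PosSemidef) :
    ∃ G : Matrix n n ℝ, X = Gᵀ * G := by
  classical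
  open scoped MatrixOrder in
  obtain ⟨G, hG⟩ := CStarAlgebra.nonneg_iff_eq_star_mul_self.mp hX.nonneg
  exact ⟨G, by simpa [star_eq_conjTranspose, conjTranspose_eq_transpose_of_trivial] using hG⟩

theorem PosSemidef.isSymm {ι : Type*} {X : Matrix ι ι ℝ} (hX : X.PosSemidef) : X.IsSymm := by
  have h := hX.isHermitian
  rwa [IsHermitian, conjTranspose_eq_transpose_of_trivial] at h

theorem PosSemidef.conj {X : Matrix n n ℝ} (hX : X.PosSemidef) (G : Matrix m n ℝ) :
    (G * X * Gᵀ).PosSemidef := by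
  simpa [conjTranspose_eq_transpose_of_trivial] using hX.mul_mul_conjTranspose_same G

theorem PosSemidef.conj' {X : Matrix n n ℝ} (hX : X.PosSemidef) (G : Matrix n m ℝ) :
    (Gᵀ * X * G).PosSemidef := by
  simpa using PosSemidef.conj hX Gᵀ

theorem frob_conj_left {P : Matrix m m ℝ} {X : Matrix n n ℝ} (K : Matrix m n ℝ) :
    frob (Kᵀ * P * K) X = frob P (K * X * Kᵀ) := by
  rw [frob, frob, transpose_mul, transpose_mul, transpose_transpose, Matrix.mul_assoc,
    trace_mul_comm]
  simp only [Matrix.mul_assoc]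

theorem frob_nonneg {P X : Matrix n n ℝ} (hP : P.PosSemidef) (hX : X.PosSemidef) :
    0 ≤ frob P X := by
  obtain ⟨G, rfl⟩ := PosSemidef.exists_factor hX
  rw [frob, PosSemidef.isSymm hP, ← Matrix.mul_assoc, trace_mul_comm, ← Matrix.mul_assoc]
  exact (PosSemidef.conj hP G).trace_nonneg

theorem PosSemidef.sq_apply_le {X : Matrix n n ℝ} (hX : X.PosSemidef) (i j : n) :
    X i j ^ 2 ≤ X i i * X j j := by
  obtain ⟨G, rfl⟩ := PosSemidef.exists_factor hX
  simp only [mul_apply, transpose_apply, ← sq]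
  exact Finset.sum_mul_sq_le_sq_mul_sq _ _ _

theorem PosSemidef.sum_sq_le {X : Matrix n n ℝ} (hX : X.PosSemidef) :
    ∑ i, ∑ j, X i j ^ 2 ≤ trace X ^ 2 := by
  rw [sq, trace, Finset.sum_mul_sum]
  exact Finset.sum_le_sum fun i _ => Finset.sum_le_sum fun j _ => PosSemidef.sq_apply_le hX i j

theorem frob_sq_le (M N : Matrix m n ℝ) :
    frob M N ^ 2 ≤ (∑ i, ∑ j, M i j ^ 2) * ∑ i, ∑ j, N i j ^ 2 := by
  simp only [frob_eq_sum, ← Fintype.sum_prod_type']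
  exact Finset.sum_mul_sq_le_sq_mul_sq _ _ _

/-- Cauchy–Schwarz, since the Frobenius norm of a semidefinite matrix is at most its trace. No sign
of `P` is needed, so this applies to the perturbations. -/
theorem abs_frob_le {P X : Matrix n n ℝ} (hX : X.PosSemidef) :
    |frob P X| ≤ √(∑ i, ∑ j, P i j ^ 2) * trace X := by
  refine abs_le_of_sq_le_sq ?_ (mul_nonneg (Real.sqrt_nonneg _) hX.trace_nonneg)
  rw [mul_pow, Real.sq_sqrt (by positivity)]
  exact (frob_sq_le P X).trans (mul_le_mul_of_nonneg_left (PosSemidef.sum_sq_le hX) (by positivity))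

theorem frob_le_trace_mul_trace {P X : Matrix n n ℝ} (hP : P.PosSemidef) (hX : X.PosSemidef) :
    frob P X ≤ trace P * trace X := by
  refine (le_abs_self _).trans ((abs_frob_le hX).trans ?_)
  refine mul_le_mul_of_nonneg_right ?_ hX.trace_nonneg
  exact Real.sqrt_le_iff.mpr ⟨hP.trace_nonneg, PosSemidef.sum_sq_le hP⟩

theorem frob_mono_right {P X Y : Matrix n n ℝ} (hP : P.PosSemidef) (hXY : (Y - X).PosSemidef) :
    frob P X ≤ frob P Y := by
  have := frob_nonneg hP hXY
  rw [frob_sub_right] at this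
  linarith

theorem frob_mulVec (P : Matrix n n ℝ) (x y : n → ℝ) :
    x ⬝ᵥ (P *ᵥ y) = frob P (vecMulVec x y) := by
  simp only [frob_eq_sum, dotProduct, mulVec, vecMulVec_apply, Finset.mul_sum]
  exact Finset.sum_congr rfl fun i _ => Finset.sum_congr rfl fun j _ => by ring

end Frob

/-! ### Linear costs of joint state-input second moments. -/

section SdpCost

variable {d k : ℕ}

theorem sdpCost_eq (Q : Matrix (Fin d) (Fin d) ℝ) (R : Matrix (Fin k) (Fin k) ℝ)
    (Z : Matrix (Fin d ⊕ Fin k) (Fin d ⊕ Fin k) ℝ) :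
    sdpCost Q R Z = frob Q Z.toBlocks₁₁ + frob R Z.toBlocks₂₂ := by
  simp [sdpCost, frob_eq_sum, Fintype.sum_sum_type, toBlocks₁₁, toBlocks₂₂]

theorem trace_eq_blocks (Z : Matrix (Fin d ⊕ Fin k) (Fin d ⊕ Fin k) ℝ) :
    trace Z = trace Z.toBlocks₁₁ + trace Z.toBlocks₂₂ := by
  simp [trace, toBlocks₁₁, toBlocks₂₂]

theorem sdpCost_add (Q Q' : Matrix (Fin d) (Fin d) ℝ) (R R' : Matrix (Fin k) (Fin k) ℝ)
    (Z : Matrix (Fin d ⊕ Fin k) (Fin d ⊕ Fin k) ℝ) :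
    sdpCost (Q + Q') (R + R') Z = sdpCost Q R Z + sdpCost Q' R' Z := by
  simp only [sdpCost_eq, frob_add_left]
  ring

theorem abs_sdpCost_le (Q : Matrix (Fin d) (Fin d) ℝ) (R : Matrix (Fin k) (Fin k) ℝ)
    {Z : Matrix (Fin d ⊕ Fin k) (Fin d ⊕ Fin k) ℝ} (hZ : Z.PosSemidef) :
    |sdpCost Q R Z| ≤ √(∑ i, ∑ j, Q i j ^ 2 + ∑ i, ∑ j, R i j ^ 2) * trace Z := by
  refine (abs_frob_le hZ).trans_eq ?_
  simp [Fintype.sum_sum_type]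

theorem PosSemidef.toBlocks₁₁ {Z : Matrix (Fin d ⊕ Fin k) (Fin d ⊕ Fin k) ℝ}
    (hZ : Z.PosSemidef) : Z.toBlocks₁₁.PosSemidef :=
  hZ.submatrix Sum.inl

theorem PosSemidef.toBlocks₂₂ {Z : Matrix (Fin d ⊕ Fin k) (Fin d ⊕ Fin k) ℝ}
    (hZ : Z.PosSemidef) : Z.toBlocks₂₂.PosSemidef :=
  hZ.submatrix Sum.inr

theorem sdpCost_nonneg {Q : Matrix (Fin d) (Fin d) ℝ} {R : Matrix (Fin k) (Fin k) ℝ}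
    {Z : Matrix (Fin d ⊕ Fin k) (Fin d ⊕ Fin k) ℝ} (hQ : Q.PosSemidef) (hR : R.PosSemidef)
    (hZ : Z.PosSemidef) : 0 ≤ sdpCost Q R Z := by
  rw [sdpCost_eq]
  exact add_nonneg (frob_nonneg hQ (PosSemidef.toBlocks₁₁ hZ))
    (frob_nonneg hR (PosSemidef.toBlocks₂₂ hZ))

theorem sdpCost_le {Q : Matrix (Fin d) (Fin d) ℝ} {R : Matrix (Fin k) (Fin k) ℝ}
    {Z : Matrix (Fin d ⊕ Fin k) (Fin d ⊕ Fin k) ℝ} (hQ : Q.PosSemidef) (hR : R.PosSemidef)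
    (hZ : Z.PosSemidef) {C ν : ℝ} (hC : 0 ≤ C) (hQC : trace Q ≤ C) (hRC : trace R ≤ C)
    (hν : trace Z ≤ ν) :
    sdpCost Q R Z ≤ C * ν := by
  have h1 := frob_le_trace_mul_trace hQ (PosSemidef.toBlocks₁₁ hZ)
  have h2 := frob_le_trace_mul_trace hR (PosSemidef.toBlocks₂₂ hZ)
  have h3 := mul_le_mul_of_nonneg_right hQC (PosSemidef.toBlocks₁₁ hZ).trace_nonneg
  have h4 := mul_le_mul_of_nonneg_right hRC (PosSemidef.toBlocks₂₂ hZ).trace_nonneg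
  have h5 := mul_le_mul_of_nonneg_left hν hC
  rw [trace_eq_blocks] at h5
  rw [sdpCost_eq]
  linarith

/-- The joint second moment matrix of `(x, K x)` when `x` has second moment matrix `X`. -/
def gainCov (K : Matrix (Fin k) (Fin d) ℝ) (X : Matrix (Fin d) (Fin d) ℝ) :
    Matrix (Fin d ⊕ Fin k) (Fin d ⊕ Fin k) ℝ :=
  fromBlocks X (X * Kᵀ) (K * X) (K * X * Kᵀ)

theorem gainCov_eq (K : Matrix (Fin k) (Fin d) ℝ) (X : Matrix (Fin d) (Fin d) ℝ) :
    gainCov K X = fromRows (1 : Matrix (Fin d) (Fin d) ℝ) K * X *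
      (fromRows (1 : Matrix (Fin d) (Fin d) ℝ) K)ᵀ := by
  rw [gainCov, transpose_fromRows, fromRows_mul, fromRows_mul_fromCols]
  simp

theorem gainCov_posSemidef (K : Matrix (Fin k) (Fin d) ℝ) {X : Matrix (Fin d) (Fin d) ℝ}
    (hX : X.PosSemidef) : (gainCov K X).PosSemidef := by
  rw [gainCov_eq]
  exact PosSemidef.conj hX _

theorem trace_gainCov (K : Matrix (Fin k) (Fin d) ℝ) (X : Matrix (Fin d) (Fin d) ℝ) :
    trace (gainCov K X) = trace X + trace (K * X * Kᵀ) := by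
  simp [trace_eq_blocks, gainCov]

theorem sdpCost_gainCov (Q : Matrix (Fin d) (Fin d) ℝ) (R : Matrix (Fin k) (Fin k) ℝ)
    (K : Matrix (Fin k) (Fin d) ℝ) (X : Matrix (Fin d) (Fin d) ℝ) :
    sdpCost Q R (gainCov K X) = frob (Q + Kᵀ * R * K) X := by
  simp [sdpCost_eq, gainCov, frob_add_left, frob_conj_left]

/-- For a linear feedback the SDP's stationarity constraint is the closed-loop Lyapunov equation. -/
theorem fromCols_mul_gainCov (A : Matrix (Fin d) (Fin d) ℝ) (B : Matrix (Fin d) (Fin k) ℝ)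
    (K : Matrix (Fin k) (Fin d) ℝ) (X : Matrix (Fin d) (Fin d) ℝ) :
    fromCols A B * gainCov K X * (fromCols A B)ᵀ = (A + B * K) * X * (A + B * K)ᵀ := by
  have h : fromCols A B * fromRows (1 : Matrix (Fin d) (Fin d) ℝ) K = A + B * K := by
    rw [fromCols_mul_fromRows, Matrix.mul_one]
  rw [gainCov_eq, ← h, transpose_mul]
  simp only [Matrix.mul_assoc]

theorem stageCost_gain (Q : Matrix (Fin d) (Fin d) ℝ) (R : Matrix (Fin k) (Fin k) ℝ)
    (K : Matrix (Fin k) (Fin d) ℝ) (x : Fin d → ℝ) :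
    stageCost Q R x (K *ᵥ x) = x ⬝ᵥ ((Q + Kᵀ * R * K) *ᵥ x) := by
  rw [stageCost, add_mulVec, dotProduct_add, ← mulVec_mulVec, ← mulVec_mulVec,
    dotProduct_mulVec x Kᵀ, vecMul_transpose]

theorem stageCost_nonneg {Q : Matrix (Fin d) (Fin d) ℝ} {R : Matrix (Fin k) (Fin k) ℝ}
    (hQ : Q.PosSemidef) (hR : R.PosSemidef) (x : Fin d → ℝ) (u : Fin k → ℝ) :
    0 ≤ stageCost Q R x u := by
  have h1 := hQ.dotProduct_mulVec_nonneg x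
  have h2 := hR.dotProduct_mulVec_nonneg u
  simp only [star_trivial] at h1 h2
  exact add_nonneg h1 h2

end SdpCost

end OnlineLQ

namespace OnlineLQ

/-! ### Strongly stable policies -/

section StronglyStable

open scoped Matrix.Norms.L2Operator

theorem sum_sq_mulVec_le {m n : Type*} [Fintype m] [Fintype n] [DecidableEq n]
    (N : Matrix m n ℝ) (v : n → ℝ) :
    ∑ i, (N *ᵥ v) i ^ 2 ≤ ‖N‖ ^ 2 * ∑ i, v i ^ 2 := by
  have h := pow_le_pow_left₀ (norm_nonneg _) (l2_opNorm_mulVec N (WithLp.toLp 2 v)) 2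
  rw [mul_pow, EuclideanSpace.real_norm_sq_eq, EuclideanSpace.real_norm_sq_eq] at h
  simpa using h

/-- After factoring `X = Gᵀ G`, both traces are sums of squared norms over the rows of `G`, and the
operator norm bound applies row by row. -/
theorem trace_conj_le {m n : Type*} [Fintype m] [Fintype n] [DecidableEq n]
    (N : Matrix m n ℝ) {X : Matrix n n ℝ} (hX : X.PosSemidef) :
    trace (N * X * Nᵀ) ≤ ‖N‖ ^ 2 * trace X := by
  obtain ⟨G, rfl⟩ := PosSemidef.exists_factor hX
  have h1 : trace (N * (Gᵀ * G) * Nᵀ) = ∑ j, ∑ i, (N *ᵥ G j) i ^ 2 := by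
    have : N * (Gᵀ * G) * Nᵀ = (N * Gᵀ) * (N * Gᵀ)ᵀ := by
      rw [transpose_mul, transpose_transpose]
      simp only [Matrix.mul_assoc]
    rw [this, trace, Finset.sum_comm]
    refine Finset.sum_congr rfl fun i _ => ?_
    simp only [diag_apply, mul_apply, transpose_apply, mulVec, dotProduct, sq]
  have h2 : trace (Gᵀ * G) = ∑ j, ∑ i, G j i ^ 2 := by
    rw [trace, Finset.sum_comm]
    refine Finset.sum_congr rfl fun i _ => ?_
    simp only [diag_apply, mul_apply, transpose_apply, sq]
  rw [h1, h2, Finset.mul_sum]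
  exact Finset.sum_le_sum fun j _ => sum_sq_mulVec_le N (G j)

variable {d k : ℕ} {S : LQSystem d k} {κ γ : ℝ} {K : Matrix (Fin k) (Fin d) ℝ}

theorem LQSystem.StronglyStable.one_le (h : S.StronglyStable κ γ K) (hd : 0 < d) : 1 ≤ κ := by
  obtain ⟨-, -, -, -, L, H, hH, -, -, hκ⟩ := h
  have : Nonempty (Fin d) := ⟨⟨0, hd⟩⟩
  have h1 : H * H⁻¹ = 1 := mul_nonsing_inv H ((isUnit_iff_isUnit_det H).mp hH)
  have h2 := norm_mul_le H H⁻¹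
  rw [h1, norm_one] at h2
  exact h2.trans hκ

theorem LQSystem.StronglyStable.norm_pow_le (h : S.StronglyStable κ γ K) (hd : 0 < d) (i : ℕ) :
    ‖S.closedLoop K ^ i‖ ≤ κ * (1 - γ) ^ i := by
  obtain ⟨-, -, hγ, -, L, H, hH, hM, hL, hκ⟩ := h
  have : Nonempty (Fin d) := ⟨⟨0, hd⟩⟩
  have h1 : H⁻¹ * H = 1 := nonsing_inv_mul H ((isUnit_iff_isUnit_det H).mp hH)
  have h0 : H * H⁻¹ = 1 := mul_nonsing_inv H ((isUnit_iff_isUnit_det H).mp hH)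
  have h2 : S.closedLoop K ^ i = H * L ^ i * H⁻¹ := by
    induction i with
    | zero => simp [h0]
    | succ i ih =>
      rw [pow_succ, ih, hM, pow_succ]
      calc H * L ^ i * H⁻¹ * (H * L * H⁻¹) = H * L ^ i * (H⁻¹ * H) * L * H⁻¹ := by
            simp only [Matrix.mul_assoc]
        _ = _ := by rw [h1, Matrix.mul_one, Matrix.mul_assoc H]
  calc ‖S.closedLoop K ^ i‖ ≤ ‖H‖ * ‖L ^ i‖ * ‖H⁻¹‖ := by
        rw [h2]
        exact (norm_mul_le _ _).trans (mul_le_mul_of_nonneg_right (norm_mul_le _ _) (norm_nonneg _))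
    _ = (‖H‖ * ‖H⁻¹‖) * ‖L ^ i‖ := by ring
    _ ≤ κ * (1 - γ) ^ i := by
        refine mul_le_mul hκ ?_ (norm_nonneg _) ((by positivity : 0 ≤ ‖H‖ * ‖H⁻¹‖).trans hκ)
        exact (_root_.norm_pow_le _ _).trans (pow_le_pow_left₀ (norm_nonneg _) hL i)

theorem LQSystem.StronglyStable.trace_pow_conj_le (h : S.StronglyStable κ γ K) (hd : 0 < d) (i : ℕ)
    {X : Matrix (Fin d) (Fin d) ℝ} (hX : X.PosSemidef) :
    trace (S.closedLoop K ^ i * X * (S.closedLoop K ^ i)ᵀ) ≤ κ ^ 2 * (1 - γ) ^ i * trace X := by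
  have h0 : 0 ≤ 1 - γ := by linarith [h.2.2.1]
  refine (trace_conj_le _ hX).trans (mul_le_mul_of_nonneg_right ?_ hX.trace_nonneg)
  have h1 := pow_le_pow_left₀ (norm_nonneg _) (h.norm_pow_le hd i) 2
  refine h1.trans ?_
  -- One of the two geometric factors is given up, so that the sum over `i` is bounded by `1/γ`.
  have h2 : (1 - γ) ^ i ≤ 1 := pow_le_one₀ h0 (by linarith [h.2.1])
  rw [mul_pow, sq ((1 - γ) ^ i)]
  have h3 : 0 ≤ (1 - γ) ^ i := pow_nonneg h0 i
  exact mul_le_mul_of_nonneg_left (by nlinarith) (sq_nonneg κ)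

theorem sum_one_sub_pow_le (hγ : 0 < γ) (hγ1 : γ ≤ 1) (T : ℕ) :
    ∑ t ∈ Finset.range T, (1 - γ) ^ t ≤ 1 / γ := by
  have h0 : 0 ≤ 1 - γ := by linarith
  have h := (summable_geometric_of_lt_one h0 (by linarith)).sum_le_tsum (Finset.range T)
    (fun i _ => pow_nonneg h0 i)
  rwa [tsum_geometric_of_lt_one h0 (by linarith), sub_sub_cancel, ← one_div] at h

/-- The covariance of the state after `t` rounds of the policy `K` from the initial state `0`. -/
def LQSystem.transientCov (S : LQSystem d k) (K : Matrix (Fin k) (Fin d) ℝ) (t : ℕ) :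
    Matrix (Fin d) (Fin d) ℝ :=
  ∑ i ∈ Finset.range t, S.closedLoop K ^ i * S.W * (S.closedLoop K ^ i)ᵀ

theorem LQSystem.transientCov_succ (S : LQSystem d k) (K : Matrix (Fin k) (Fin d) ℝ) (t : ℕ) :
    S.transientCov K (t + 1) =
      S.closedLoop K * S.transientCov K t * (S.closedLoop K)ᵀ + S.W := by
  rw [transientCov, Finset.sum_range_succ', transientCov, Matrix.mul_sum, Matrix.sum_mul]
  simp [pow_succ', transpose_mul, Matrix.mul_assoc]

theorem LQSystem.transientCov_posSemidef (hW : S.W.PosSemidef) (t : ℕ) :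
    (S.transientCov K t).PosSemidef :=
  posSemidef_sum _ fun _ _ => PosSemidef.conj hW _

theorem LQSystem.StronglyStable.trace_transientCov_le (h : S.StronglyStable κ γ K) (hd : 0 < d)
    (hW : S.W.PosSemidef) (t : ℕ) :
    trace (S.transientCov K t) ≤ κ ^ 2 * trace S.W / γ := by
  rw [LQSystem.transientCov, trace_sum]
  calc _ ≤ ∑ i ∈ Finset.range t, κ ^ 2 * (1 - γ) ^ i * trace S.W :=
        Finset.sum_le_sum fun i _ => h.trace_pow_conj_le hd i hW
    _ = κ ^ 2 * trace S.W * ∑ i ∈ Finset.range t, (1 - γ) ^ i := by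
        rw [Finset.mul_sum]
        exact Finset.sum_congr rfl fun _ _ => by ring
    _ ≤ κ ^ 2 * trace S.W * (1 / γ) :=
        mul_le_mul_of_nonneg_left (sum_one_sub_pow_le h.2.1 h.2.2.1 t)
          (mul_nonneg (sq_nonneg _) hW.trace_nonneg)
    _ = _ := by ring

theorem PosSemidef.of_tendsto {n : Type*} [Fintype n] {Y : ℕ → Matrix n n ℝ} {X : Matrix n n ℝ}
    (hY : ∀ t, (Y t).PosSemidef) (h : Filter.Tendsto Y Filter.atTop (nhds X)) :
    X.PosSemidef := by
  refine PosSemidef.of_dotProduct_mulVec_nonneg ?_ fun x => ?_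
  · rw [IsHermitian, conjTranspose_eq_transpose_of_trivial]
    have h1 : Filter.Tendsto (fun t => (Y t)ᵀ) Filter.atTop (nhds Xᵀ) :=
      ((continuous_id.matrix_transpose).tendsto X).comp h
    have h2 : (fun t => (Y t)ᵀ) = Y := funext fun t => PosSemidef.isSymm (hY t)
    rw [h2] at h1
    exact tendsto_nhds_unique h1 h
  · have hc : Continuous fun Z : Matrix n n ℝ => star x ⬝ᵥ Z *ᵥ x := by fun_prop
    exact ge_of_tendsto' ((hc.tendsto X).comp h) fun t => (hY t).dotProduct_mulVec_nonneg x

/-- The covariance is the series `∑ Mⁱ W (Mⁱ)ᵀ`, which strong stability makes summable. The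
fixed-point equation and the trace bound are limits of those for the partial sums `transientCov`. -/
theorem LQSystem.StronglyStable.exists_steadyCov (h : S.StronglyStable κ γ K) (hd : 0 < d)
    (hW : S.W.PosSemidef) :
    ∃ X : Matrix (Fin d) (Fin d) ℝ, X.PosSemidef ∧
      X = S.closedLoop K * X * (S.closedLoop K)ᵀ + S.W ∧ trace X ≤ κ ^ 2 * trace S.W / γ := by
  have h0 : 0 ≤ 1 - γ := by linarith [h.2.2.1]
  have hs : Summable fun i : ℕ => S.closedLoop K ^ i * S.W * (S.closedLoop K ^ i)ᵀ := by
    refine Summable.of_norm_bounded (g := fun i : ℕ => κ ^ 2 * ‖S.W‖ * (1 - γ) ^ i)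
      ((summable_geometric_of_lt_one h0 (by linarith [h.2.1])).mul_left _) fun i => ?_
    have h1 := h.norm_pow_le hd i
    have h2 : ‖(S.closedLoop K ^ i)ᵀ‖ = ‖S.closedLoop K ^ i‖ := by
      rw [← conjTranspose_eq_transpose_of_trivial, l2_opNorm_conjTranspose]
    have h3 : (1 - γ) ^ i ≤ 1 := pow_le_one₀ h0 (by linarith [h.2.1])
    have h4 : 0 ≤ (1 - γ) ^ i := pow_nonneg h0 i
    have hκ := h.1
    calc _ ≤ ‖S.closedLoop K ^ i‖ * ‖S.W‖ * ‖(S.closedLoop K ^ i)ᵀ‖ :=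
          (norm_mul_le _ _).trans (mul_le_mul_of_nonneg_right (norm_mul_le _ _) (norm_nonneg _))
      _ ≤ (κ * (1 - γ) ^ i) * ‖S.W‖ * (κ * (1 - γ) ^ i) := by
          rw [h2]; gcongr
      _ = κ ^ 2 * ‖S.W‖ * ((1 - γ) ^ i * (1 - γ) ^ i) := by ring
      _ ≤ κ ^ 2 * ‖S.W‖ * ((1 - γ) ^ i * 1) := by gcongr
      _ = _ := by ring
  obtain ⟨X, hX⟩ := hs
  have ht : Filter.Tendsto (S.transientCov K) Filter.atTop (nhds X) := hX.tendsto_sum_nat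
  refine ⟨X, PosSemidef.of_tendsto (LQSystem.transientCov_posSemidef hW) ht, ?_, ?_⟩
  · have hc : Continuous fun Z : Matrix (Fin d) (Fin d) ℝ =>
        S.closedLoop K * Z * (S.closedLoop K)ᵀ + S.W := by fun_prop
    have h1 := (hc.tendsto X).comp ht
    have h2 := ht.comp (Filter.tendsto_add_atTop_nat 1)
    refine tendsto_nhds_unique h2 (h1.congr fun t => ?_)
    simp [LQSystem.transientCov_succ]
  · have hc : Continuous fun Z : Matrix (Fin d) (Fin d) ℝ => trace Z := by fun_prop
    exact le_of_tendsto' ((hc.tendsto X).comp ht) fun t => h.trace_transientCov_le hd hW t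

/-- This is the origin of `ν`: one `κ²` comes from the steady covariance, another from `‖K‖²`, and
`κ ≥ 1` lets the state part be bounded like the input part, whence the 2. -/
theorem LQSystem.StronglyStable.trace_gainCov_le (h : S.StronglyStable κ γ K) (hd : 0 < d)
    {lam : ℝ} (hWt : trace S.W ≤ lam ^ 2)
    {X : Matrix (Fin d) (Fin d) ℝ} (hX : X.PosSemidef) (hXt : trace X ≤ κ ^ 2 * trace S.W / γ) :
    trace X + trace (K * X * Kᵀ) ≤ 2 * κ ^ 4 * lam ^ 2 / γ := by
  have hκ := h.one_le hd
  have hγ := h.2.1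
  have h1 : trace (K * X * Kᵀ) ≤ κ ^ 2 * trace X := (trace_conj_le K hX).trans
    (mul_le_mul_of_nonneg_right (pow_le_pow_left₀ (norm_nonneg _) h.2.2.2.1 2) hX.trace_nonneg)
  have h2 : trace X ≤ κ ^ 2 * lam ^ 2 / γ := hXt.trans (by gcongr)
  have h3 : (1 : ℝ) ≤ κ ^ 2 := one_le_pow₀ hκ
  have h4 : 0 ≤ κ ^ 2 * lam ^ 2 / γ := by positivity
  calc _ ≤ κ ^ 2 * trace X + κ ^ 2 * trace X := by nlinarith [hX.trace_nonneg]
    _ ≤ κ ^ 2 * (κ ^ 2 * lam ^ 2 / γ) + κ ^ 2 * (κ ^ 2 * lam ^ 2 / γ) := by gcongr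
    _ = _ := by ring

/-- A real matrix acts separately on real and imaginary parts. Complex vectors are needed because
eigenvalues of the closed loop may be complex. -/
theorem sum_normSq_map_mulVec_le {n : Type*} [Fintype n] [DecidableEq n] (L : Matrix n n ℝ)
    (v : n → ℂ) :
    ∑ i, Complex.normSq ((L.map (fun a : ℝ => (a : ℂ)) *ᵥ v) i) ≤
      ‖L‖ ^ 2 * ∑ i, Complex.normSq (v i) := by
  have h1 : ∀ i, Complex.normSq ((L.map (fun a : ℝ => (a : ℂ)) *ᵥ v) i) =
      (L *ᵥ fun j => (v j).re) i ^ 2 + (L *ᵥ fun j => (v j).im) i ^ 2 := by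
    intro i
    simp [Complex.normSq_apply, mulVec, dotProduct, sq, Complex.re_sum, Complex.im_sum]
  simp only [h1, Finset.sum_add_distrib]
  refine (add_le_add (sum_sq_mulVec_le L _) (sum_sq_mulVec_le L _)).trans_eq ?_
  rw [← mul_add, ← Finset.sum_add_distrib]
  simp [Complex.normSq_apply, sq]

/-- If `v` is an eigenvector of the closed loop, then `H⁻¹ v` is one of `L` with the same
eigenvalue, whose modulus is at most `‖L‖ ≤ 1 - γ`. -/
theorem LQSystem.StronglyStable.stable (h : S.StronglyStable κ γ K) : S.Stable K := by
  obtain ⟨-, hγ0, hγ, -, L, H, hH, hM, hL, -⟩ := h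
  have h1 : H⁻¹ * H = 1 := nonsing_inv_mul H ((isUnit_iff_isUnit_det H).mp hH)
  refine lt_of_le_of_lt (b := ENNReal.ofReal (1 - γ)) ?_ (by
    rw [ENNReal.ofReal_lt_one]; linarith)
  refine iSup₂_le fun z hz => ?_
  rw [spectrum.mem_iff, isUnit_iff_isUnit_det, isUnit_iff_ne_zero, not_not,
    ← exists_mulVec_eq_zero_iff] at hz
  obtain ⟨v, hv0, hv⟩ := hz
  set M : Matrix (Fin d) (Fin d) ℂ := (S.closedLoop K).map (fun a : ℝ => (a : ℂ)) with hMdef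
  set LC : Matrix (Fin d) (Fin d) ℂ := L.map (fun a : ℝ => (a : ℂ)) with hLC
  set HC : Matrix (Fin d) (Fin d) ℂ := H.map (fun a : ℝ => (a : ℂ)) with hHC
  set IC : Matrix (Fin d) (Fin d) ℂ := H⁻¹.map (fun a : ℝ => (a : ℂ)) with hIC
  have hI : IC * HC = 1 := by
    have := congrArg (fun Z : Matrix (Fin d) (Fin d) ℝ => Z.map Complex.ofRealHom) h1
    simp only [Matrix.map_mul] at this
    rw [Matrix.map_one _ (map_zero _) (map_one _)] at this
    exact this
  have hMC : M = HC * LC * IC := by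
    have := congrArg (fun Z : Matrix (Fin d) (Fin d) ℝ => Z.map Complex.ofRealHom) hM
    simp only [Matrix.map_mul] at this
    exact this
  have hMv : M *ᵥ v = z • v := by
    rw [sub_mulVec, algebraMap_eq_diagonal, sub_eq_zero] at hv
    rw [← hv]
    ext i
    simp [mulVec_diagonal]
  have hHI : HC * IC = 1 := mul_eq_one_comm.mp hI
  set y := IC *ᵥ v with hy
  have hLy : LC *ᵥ y = z • y := by
    have h2 : IC *ᵥ (M *ᵥ v) = LC *ᵥ y := by
      rw [hMC, mulVec_mulVec, ← Matrix.mul_assoc, ← Matrix.mul_assoc, hI, Matrix.one_mul,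
        ← mulVec_mulVec]
    rw [← h2, hMv, mulVec_smul]
  have hy0 : y ≠ 0 := by
    intro h0
    apply hv0
    have : HC *ᵥ y = v := by rw [hy, mulVec_mulVec, hHI, one_mulVec]
    rw [← this, h0, mulVec_zero]
  have hpos : 0 < ∑ i, Complex.normSq (y i) := by
    obtain ⟨i, hi⟩ := Function.ne_iff.mp hy0
    exact Finset.sum_pos' (fun _ _ => Complex.normSq_nonneg _)
      ⟨i, Finset.mem_univ _, Complex.normSq_pos.mpr hi⟩
  have h3 := sum_normSq_map_mulVec_le L y
  rw [← hLC, hLy] at h3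
  simp only [Pi.smul_apply, smul_eq_mul, Complex.normSq_mul, ← Finset.mul_sum] at h3
  have h4 : Complex.normSq z ≤ ‖L‖ ^ 2 := le_of_mul_le_mul_right h3 hpos
  have h5 : ‖z‖ ≤ 1 - γ := by
    rw [Complex.normSq_eq_norm_sq] at h4
    exact ((sq_le_sq₀ (norm_nonneg _) (norm_nonneg _)).mp h4).trans hL
  exact ENNReal.coe_le_coe.mpr (NNReal.le_toNNReal_of_coe_le h5)

end StronglyStable

/-! ### What both kinds of oracle provide -/

section Oracle

variable {d k : ℕ}

/-- `sol` certifies the gains returned by `oracle`: it bounds the steady-state covariances of the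
gains, and it is optimal among its own values and the matrix `Z`. -/
structure LQSystem.IsCertificate (S : LQSystem d k) (ν : ℝ)
    (oracle : Matrix (Fin d) (Fin d) ℝ → Matrix (Fin k) (Fin k) ℝ → Matrix (Fin k) (Fin d) ℝ)
    (sol : Matrix (Fin d) (Fin d) ℝ → Matrix (Fin k) (Fin k) ℝ →
      Matrix (Fin d ⊕ Fin k) (Fin d ⊕ Fin k) ℝ)
    (Z : Matrix (Fin d ⊕ Fin k) (Fin d ⊕ Fin k) ℝ) : Prop where
  posSemidef : ∀ Q R, Q.IsSymm → R.IsSymm → (sol Q R).PosSemidef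
  trace_le : ∀ Q R, Q.IsSymm → R.IsSymm → trace (sol Q R) ≤ ν
  contracts : ∀ Q R, Q.IsSymm → R.IsSymm →
    ((sol Q R).toBlocks₁₁ - (S.closedLoop (oracle Q R) * (sol Q R).toBlocks₁₁ *
      (S.closedLoop (oracle Q R))ᵀ + S.W)).PosSemidef
  cost_le : ∀ Q R, Q.IsSymm → R.IsSymm → ∀ Q' R', Q'.PosSemidef → R'.PosSemidef →
    frob (Q' + (oracle Q R)ᵀ * R' * oracle Q R) (sol Q R).toBlocks₁₁ ≤ sdpCost Q' R' (sol Q R)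
  minimal : ∀ Q R, Q.IsSymm → R.IsSymm → ∀ Q' R', Q'.IsSymm → R'.IsSymm →
    sdpCost Q R (sol Q R) ≤ sdpCost Q R (sol Q' R')
  minimal_star : ∀ Q R, Q.IsSymm → R.IsSymm → sdpCost Q R (sol Q R) ≤ sdpCost Q R Z

variable {S : LQSystem d k} {ν : ℝ}
  {oracle : Matrix (Fin d) (Fin d) ℝ → Matrix (Fin k) (Fin k) ℝ → Matrix (Fin k) (Fin d) ℝ}
  {K : Matrix (Fin k) (Fin d) ℝ} {X : Matrix (Fin d) (Fin d) ℝ}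

/-- The certificate is the joint covariance of the returned gain in its steady state; the Lyapunov
and cost inequalities are then equalities. -/
theorem LQSystem.IsControlOracle.exists_certificate (h : S.IsControlOracle ν oracle)
    (hK : S.IsSteadyState K X) (hν : trace X + trace (K * X * Kᵀ) ≤ ν) :
    ∃ sol, S.IsCertificate ν oracle sol (gainCov K X) := by
  classical
  choose X' hX' hν' hmin using h.2
  let sol : Matrix (Fin d) (Fin d) ℝ → Matrix (Fin k) (Fin k) ℝ →
      Matrix (Fin d ⊕ Fin k) (Fin d ⊕ Fin k) ℝ := fun Q R =>
    -- Off symmetric pairs the value 0 is arbitrary: every field of the certificate assumes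
    -- symmetry.
    if hs : Q.IsSymm ∧ R.IsSymm then gainCov (oracle Q R) (X' Q R hs.1 hs.2) else 0
  have hsol : ∀ Q R (hQ : Q.IsSymm) (hR : R.IsSymm),
      sol Q R = gainCov (oracle Q R) (X' Q R hQ hR) := fun Q R hQ hR => dif_pos ⟨hQ, hR⟩
  have h11 : ∀ Q R (hQ : Q.IsSymm) (hR : R.IsSymm), (sol Q R).toBlocks₁₁ = X' Q R hQ hR := by
    intro Q R hQ hR
    rw [hsol Q R hQ hR, gainCov, toBlocks_fromBlocks₁₁]
  refine ⟨sol, ?_, ?_, ?_, ?_, ?_, ?_⟩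
  · intro Q R hQ hR
    rw [hsol Q R hQ hR]
    exact gainCov_posSemidef _ (hX' Q R hQ hR).2.1
  · intro Q R hQ hR
    rw [hsol Q R hQ hR, trace_gainCov]
    exact hν' Q R hQ hR
  · intro Q R hQ hR
    rw [h11 Q R hQ hR, ← (hX' Q R hQ hR).2.2, sub_self]
    exact PosSemidef.zero
  · intro Q R hQ hR Q' R' _ _
    rw [h11 Q R hQ hR, hsol Q R hQ hR, sdpCost_gainCov]
  · intro Q R hQ hR Q' R' hQ' hR'
    rw [hsol Q R hQ hR, hsol Q' R' hQ' hR', sdpCost_gainCov, sdpCost_gainCov]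
    exact hmin Q R hQ hR _ _ (hX' Q' R' hQ' hR') (hν' Q' R' hQ' hR')
  · intro Q R hQ hR
    rw [hsol Q R hQ hR, sdpCost_gainCov, sdpCost_gainCov]
    exact hmin Q R hQ hR _ _ hK hν

theorem toBlocks₁₂_eq {Z : Matrix (Fin d ⊕ Fin k) (Fin d ⊕ Fin k) ℝ}
    (hZ : Z.PosSemidef) (hK : K * Z.toBlocks₁₁ = Z.toBlocks₂₁) :
    Z.toBlocks₁₂ = Z.toBlocks₁₁ * Kᵀ := by
  have h1 : Z.toBlocks₁₂ = Z.toBlocks₂₁ᵀ := by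
    ext i j
    exact (congrFun (congrFun (PosSemidef.isSymm hZ) (Sum.inl i)) (Sum.inr j)).symm
  rw [h1, ← hK, transpose_mul, PosSemidef.isSymm (PosSemidef.toBlocks₁₁ hZ)]

/-- The part of the input covariance that is not explained by a linear feedback. -/
theorem residualCov_posSemidef {Z : Matrix (Fin d ⊕ Fin k) (Fin d ⊕ Fin k) ℝ}
    (hZ : Z.PosSemidef) (hK : K * Z.toBlocks₁₁ = Z.toBlocks₂₁) :
    (Z.toBlocks₂₂ - K * Z.toBlocks₁₁ * Kᵀ).PosSemidef := by
  have h12 := toBlocks₁₂_eq hZ hK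
  -- Congruence by the row `(-K, 1)` gives the second moment of the residual `u - K x`.
  have h2 := PosSemidef.conj hZ (fromCols (-K) (1 : Matrix (Fin k) (Fin k) ℝ))
  convert h2 using 1
  conv_rhs => rw [← fromBlocks_toBlocks Z]
  rw [fromCols_mul_fromBlocks, transpose_fromCols, fromCols_mul_fromRows, h12, ← hK]
  simp [← Matrix.mul_assoc]
  abel

/-- The Schur complement decomposition: the input is `K x` plus a residual uncorrelated with the
state. -/
theorem eq_gainCov_add {Z : Matrix (Fin d ⊕ Fin k) (Fin d ⊕ Fin k) ℝ}
    (hZ : Z.PosSemidef) (hK : K * Z.toBlocks₁₁ = Z.toBlocks₂₁) :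
    Z = gainCov K Z.toBlocks₁₁ + fromBlocks 0 0 0 (Z.toBlocks₂₂ - K * Z.toBlocks₁₁ * Kᵀ) := by
  have h12 := toBlocks₁₂_eq hZ hK
  conv_lhs => rw [← fromBlocks_toBlocks Z]
  rw [gainCov, fromBlocks_add, h12, ← hK]
  simp

/-- Playing `K x` drops the residual input. With `D` the residual covariance, this removes `B D Bᵀ ⪰
0` from the next covariance, so the SDP equation becomes a Lyapunov inequality. -/
theorem LQSystem.SDPFeasible.contracts {Z : Matrix (Fin d ⊕ Fin k) (Fin d ⊕ Fin k) ℝ}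
    (hZ : S.SDPFeasible ν Z) (hK : K * Z.toBlocks₁₁ = Z.toBlocks₂₁) :
    (Z.toBlocks₁₁ - (S.closedLoop K * Z.toBlocks₁₁ * (S.closedLoop K)ᵀ + S.W)).PosSemidef := by
  obtain ⟨hP, -, he⟩ := hZ
  set D := Z.toBlocks₂₂ - K * Z.toBlocks₁₁ * Kᵀ with hD
  have h1 : fromCols S.A S.B * Z * (fromCols S.A S.B)ᵀ =
      S.closedLoop K * Z.toBlocks₁₁ * (S.closedLoop K)ᵀ + S.B * D * S.Bᵀ := by
    conv_lhs => rw [eq_gainCov_add hP hK]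
    rw [Matrix.mul_add, Matrix.add_mul, fromCols_mul_gainCov, fromCols_mul_fromBlocks,
      transpose_fromCols, fromCols_mul_fromRows, ← hD]
    simp [LQSystem.closedLoop]
  rw [h1] at he
  have h2 : Z.toBlocks₁₁ - (S.closedLoop K * Z.toBlocks₁₁ * (S.closedLoop K)ᵀ + S.W) =
      S.B * D * S.Bᵀ := by
    rw [sub_eq_iff_eq_add, add_comm, add_right_comm]
    exact he
  rw [h2]
  exact PosSemidef.conj (residualCov_posSemidef hP hK) _

theorem LQSystem.IsSDPOracle.exists_certificate (h : S.IsSDPOracle ν oracle)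
    (hX : X.PosSemidef) (hXe : X = S.closedLoop K * X * (S.closedLoop K)ᵀ + S.W)
    (hν : trace X + trace (K * X * Kᵀ) ≤ ν) :
    ∃ sol, S.IsCertificate ν oracle sol (gainCov K X) := by
  obtain ⟨-, sol, -, hsol⟩ := h
  refine ⟨sol, fun Q R hQ hR => (hsol Q R hQ hR).1.1.1, fun Q R hQ hR => (hsol Q R hQ hR).1.1.2.1,
    fun Q R hQ hR => (hsol Q R hQ hR).1.1.contracts (hsol Q R hQ hR).2, ?_, ?_, ?_⟩
  · intro Q R hQ hR Q' R' _ hR'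
    have hP := (hsol Q R hQ hR).1.1.1
    rw [sdpCost_eq, frob_add_left, frob_conj_left]
    -- Dropping the residual input also cannot increase the cost, as `R'` is semidefinite.
    have := frob_nonneg hR' (residualCov_posSemidef hP (hsol Q R hQ hR).2)
    rw [frob_sub_right] at this
    linarith
  · intro Q R hQ hR Q' R' hQ' hR'
    exact (hsol Q R hQ hR).1.2 _ (hsol Q' R' hQ' hR').1.1
  · intro Q R hQ hR
    -- The comparator's joint covariance is feasible for the SDP; stability of its gain plays no
    -- role here.
    refine (hsol Q R hQ hR).1.2 _ ⟨gainCov_posSemidef K hX, (trace_gainCov K X).trans_le hν, ?_⟩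
    rw [fromCols_mul_gainCov, gainCov, toBlocks_fromBlocks₁₁]
    exact hXe

end Oracle

end OnlineLQ

namespace OnlineLQ

/-! ### Second moments of the noise -/

section Noise

variable {d k : ℕ} {S : LQSystem d k}

instance (S : LQSystem d k) : IsProbabilityMeasure S.noiseLaw := by
  unfold LQSystem.noiseLaw
  infer_instance

theorem memLp_noise (s : ℕ) (i : Fin d) : MemLp (fun w => (w s).ofLp i) 2 S.noiseLaw := by
  have h1 : MemLp (fun x : EuclideanSpace ℝ (Fin d) => x.ofLp i) 2 (multivariateGaussian 0 S.W) :=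
    (EuclideanSpace.proj (𝕜 := ℝ) i).comp_memLp' (IsGaussian.memLp_id _ 2 (by simp))
  exact h1.comp_measurePreserving
    (measurePreserving_eval_infinitePi (fun _ : ℕ => multivariateGaussian 0 S.W) s)

theorem integral_noise (s : ℕ) (i : Fin d) : ∫ w, (w s).ofLp i ∂S.noiseLaw = 0 := by
  have h := (measurePreserving_eval_infinitePi
    (fun _ : ℕ => multivariateGaussian (0 : EuclideanSpace ℝ (Fin d)) S.W) s)
  have h2 : ∫ x : EuclideanSpace ℝ (Fin d), x.ofLp i ∂(multivariateGaussian 0 S.W) = 0 := by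
    have h3 := (EuclideanSpace.proj (𝕜 := ℝ) (ι := Fin d) i).integral_comp_comm
      (IsGaussian.integrable_id (μ := multivariateGaussian (0 : EuclideanSpace ℝ (Fin d)) S.W))
    simpa using h3
  rw [← h2, ← h.map_eq, integral_map h.measurable.aemeasurable]
  · rfl
  · exact Measurable.aestronglyMeasurable (by fun_prop)

theorem integral_noise_mul (hW : S.W.PosSemidef) (s r : ℕ) (i j : Fin d) :
    ∫ w, (w s).ofLp i * (w r).ofLp j ∂S.noiseLaw = if s = r then S.W i j else 0 := by
  split_ifs with h
  · subst h
    have h := (measurePreserving_eval_infinitePi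
      (fun _ : ℕ => multivariateGaussian (0 : EuclideanSpace ℝ (Fin d)) S.W) s)
    have h1 := covariance_eval_multivariateGaussian (μ := 0) hW i j
    have h2 : ∀ i, ∫ x : EuclideanSpace ℝ (Fin d), x.ofLp i ∂(multivariateGaussian 0 S.W) = 0 := by
      intro i
      rw [← integral_noise (S := S) s i, ← h.map_eq, integral_map h.measurable.aemeasurable]
      · rfl
      · exact Measurable.aestronglyMeasurable (by fun_prop)
    simp only [covariance, h2, sub_zero] at h1
    rw [← h1, ← h.map_eq, integral_map h.measurable.aemeasurable]
    · rfl
    · exact Measurable.aestronglyMeasurable (by fun_prop)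
  · have hi : IndepFun (fun w : ℕ → EuclideanSpace ℝ (Fin d) => (w s).ofLp i)
        (fun w => (w r).ofLp j) S.noiseLaw := by
      have h1 := (iIndepFun_infinitePi (Ω := fun _ : ℕ => EuclideanSpace ℝ (Fin d))
        (P := fun _ : ℕ => multivariateGaussian 0 S.W) (X := fun _ x => x)
        (fun _ => measurable_id)).indepFun h
      exact h1.comp (φ := fun x : EuclideanSpace ℝ (Fin d) => x.ofLp i)
        (ψ := fun x : EuclideanSpace ℝ (Fin d) => x.ofLp j) (by fun_prop) (by fun_prop)
    have h2 := hi.integral_mul_eq_mul_integral (memLp_noise s i).1 (memLp_noise r j).1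
    rw [integral_noise, zero_mul] at h2
    exact h2

/-- The value at round `t` of a process driven linearly by the noise. -/
noncomputable def linearState (G : ℕ → Matrix (Fin d) (Fin d) ℝ) (t : ℕ)
    (w : ℕ → EuclideanSpace ℝ (Fin d)) : Fin d → ℝ :=
  ∑ s ∈ Finset.range t, G s *ᵥ (w s).ofLp

/-- The second moment matrix of `linearState G t` when the noise has covariance `W`. -/
def linearCov (W : Matrix (Fin d) (Fin d) ℝ) (G : ℕ → Matrix (Fin d) (Fin d) ℝ) (t : ℕ) :
    Matrix (Fin d) (Fin d) ℝ :=
  ∑ s ∈ Finset.range t, G s * W * (G s)ᵀ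

theorem linearState_apply (G : ℕ → Matrix (Fin d) (Fin d) ℝ) (t : ℕ)
    (w : ℕ → EuclideanSpace ℝ (Fin d)) (i : Fin d) :
    linearState G t w i = ∑ s ∈ Finset.range t, ∑ j, G s i j * (w s).ofLp j := by
  simp [linearState, mulVec, dotProduct]

theorem memLp_linearState (G : ℕ → Matrix (Fin d) (Fin d) ℝ) (t : ℕ) (i : Fin d) :
    MemLp (fun w => linearState G t w i) 2 S.noiseLaw := by
  simp only [linearState_apply]
  exact memLp_finsetSum _ fun s _ => memLp_finsetSum _ fun j _ => (memLp_noise s j).const_mul _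

theorem integral_linearState_mul (hW : S.W.PosSemidef) (G : ℕ → Matrix (Fin d) (Fin d) ℝ) (t : ℕ)
    (i j : Fin d) :
    ∫ w, linearState G t w i * linearState G t w j ∂S.noiseLaw = linearCov S.W G t i j := by
  have hint : ∀ s a r b, Integrable
      (fun w => (G s i a * (w s).ofLp a) * (G r j b * (w r).ofLp b)) S.noiseLaw := by
    intro s a r b
    exact ((memLp_noise s a).const_mul _).integrable_mul ((memLp_noise r b).const_mul _)
  have hval : ∀ s a r b, ∫ w, (G s i a * (w s).ofLp a) * (G r j b * (w r).ofLp b) ∂S.noiseLaw =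
      if s = r then G s i a * G r j b * S.W a b else 0 := by
    intro s a r b
    have : ∀ w : ℕ → EuclideanSpace ℝ (Fin d), (G s i a * (w s).ofLp a) * (G r j b * (w r).ofLp b) =
        (G s i a * G r j b) * ((w s).ofLp a * (w r).ofLp b) := fun w => by ring
    simp only [this]
    rw [integral_const_mul, integral_noise_mul hW]
    split_ifs <;> simp
  simp only [linearState_apply, Finset.sum_mul_sum]
  rw [integral_finsetSum _ fun s _ => integrable_finsetSum _ fun r _ =>
    integrable_finsetSum _ fun a _ => integrable_finsetSum _ fun b _ => hint s a r b,
    linearCov, Matrix.sum_apply]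
  refine Finset.sum_congr rfl fun s hs => ?_
  rw [integral_finsetSum _ fun r _ =>
    integrable_finsetSum _ fun a _ => integrable_finsetSum _ fun b _ => hint s a r b]
  have h1 : ∀ r ∈ Finset.range t, ∫ w : ℕ → EuclideanSpace ℝ (Fin d), ∑ a, ∑ b,
      (G s i a * (w s).ofLp a) * (G r j b * (w r).ofLp b) ∂S.noiseLaw =
      if s = r then ∑ a, ∑ b, G s i a * G r j b * S.W a b else 0 := by
    intro r _
    rw [integral_finsetSum _ fun a _ => integrable_finsetSum _ fun b _ => hint s a r b]
    simp_rw [integral_finsetSum _ fun b _ => hint s _ r b, hval]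
    split_ifs <;> simp
  rw [Finset.sum_congr rfl h1, Finset.sum_ite_eq, if_pos hs]
  simp only [mul_apply, transpose_apply, Finset.sum_mul]
  rw [Finset.sum_comm]
  exact Finset.sum_congr rfl fun b _ => Finset.sum_congr rfl fun a _ => by ring

theorem integrable_quadratic (P : Matrix (Fin d) (Fin d) ℝ) (G : ℕ → Matrix (Fin d) (Fin d) ℝ)
    (t : ℕ) :
    Integrable (fun w => linearState G t w ⬝ᵥ (P *ᵥ linearState G t w)) S.noiseLaw := by
  simp only [frob_mulVec, frob_eq_sum, vecMulVec_apply]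
  exact integrable_finsetSum _ fun i _ => integrable_finsetSum _ fun j _ =>
    ((memLp_linearState G t i).integrable_mul (memLp_linearState G t j)).const_mul _

theorem integral_quadratic (hW : S.W.PosSemidef) (P : Matrix (Fin d) (Fin d) ℝ)
    (G : ℕ → Matrix (Fin d) (Fin d) ℝ) (t : ℕ) :
    ∫ w, linearState G t w ⬝ᵥ (P *ᵥ linearState G t w) ∂S.noiseLaw =
      frob P (linearCov S.W G t) := by
  have hint : ∀ i j, Integrable
      (fun w => P i j * (linearState G t w i * linearState G t w j)) S.noiseLaw := fun i j =>
    ((memLp_linearState G t i).integrable_mul (memLp_linearState G t j)).const_mul _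
  simp only [frob_mulVec, frob_eq_sum, vecMulVec_apply]
  rw [integral_finsetSum _ fun i _ => integrable_finsetSum _ fun j _ => hint i j]
  refine Finset.sum_congr rfl fun i _ => ?_
  rw [integral_finsetSum _ fun j _ => hint i j]
  refine Finset.sum_congr rfl fun j _ => ?_
  rw [integral_const_mul, integral_linearState_mul hW]

/-- Coefficients after one more transition with closed loop matrix `M`. -/
def stepCoeff (M : Matrix (Fin d) (Fin d) ℝ) (G : ℕ → Matrix (Fin d) (Fin d) ℝ) (t : ℕ) :
    ℕ → Matrix (Fin d) (Fin d) ℝ :=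
  fun s => if s = t then 1 else M * G s

theorem linearState_stepCoeff (M : Matrix (Fin d) (Fin d) ℝ) (G : ℕ → Matrix (Fin d) (Fin d) ℝ)
    (t : ℕ) (w : ℕ → EuclideanSpace ℝ (Fin d)) :
    linearState (stepCoeff M G t) (t + 1) w = M *ᵥ linearState G t w + (w t).ofLp := by
  rw [linearState, Finset.sum_range_succ, linearState, mulVec_sum]
  congr 1
  · refine Finset.sum_congr rfl fun s hs => ?_
    rw [stepCoeff, if_neg (Finset.mem_range.mp hs).ne, mulVec_mulVec]
  · simp [stepCoeff]

theorem linearCov_stepCoeff (W M : Matrix (Fin d) (Fin d) ℝ) (G : ℕ → Matrix (Fin d) (Fin d) ℝ)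
    (t : ℕ) :
    linearCov W (stepCoeff M G t) (t + 1) = M * linearCov W G t * Mᵀ + W := by
  rw [linearCov, Finset.sum_range_succ, linearCov, Matrix.mul_sum, Matrix.sum_mul]
  congr 1
  · refine Finset.sum_congr rfl fun s hs => ?_
    rw [stepCoeff, if_neg (Finset.mem_range.mp hs).ne, transpose_mul]
    simp only [Matrix.mul_assoc]
  · simp [stepCoeff]

end Noise

/-! ### The cost of the comparison policy -/

section PolicyCost

variable {d k : ℕ} {S : LQSystem d k}

theorem exists_policyState_eq (S : LQSystem d k) (K : Matrix (Fin k) (Fin d) ℝ) (t : ℕ) :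
    ∃ G, (∀ w, S.policyState K w t = linearState G t w) ∧
      linearCov S.W G t = S.transientCov K t := by
  induction t with
  | zero =>
    exact ⟨0, fun w => by simp [LQSystem.policyState, linearState],
      by simp [linearCov, LQSystem.transientCov]⟩
  | succ t ih =>
    obtain ⟨G, h1, h2⟩ := ih
    refine ⟨stepCoeff (S.closedLoop K) G t, fun w => ?_, ?_⟩
    · rw [linearState_stepCoeff, LQSystem.policyState, LQSystem.next, h1 w, LQSystem.closedLoop,
        add_mulVec, mulVec_mulVec]
    · rw [linearCov_stepCoeff, h2, LQSystem.transientCov_succ]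

theorem policyCost_eq (hW : S.W.PosSemidef) (Q : ℕ → Matrix (Fin d) (Fin d) ℝ)
    (R : ℕ → Matrix (Fin k) (Fin k) ℝ) (K : Matrix (Fin k) (Fin d) ℝ) (T : ℕ) :
    S.policyCost Q R K T =
      ∑ t ∈ Finset.range T, frob (Q t + Kᵀ * R t * K) (S.transientCov K t) := by
  have h : ∀ t, Integrable (fun w =>
      stageCost (Q t) (R t) (S.policyState K w t) (K *ᵥ S.policyState K w t)) S.noiseLaw ∧
      ∫ w, stageCost (Q t) (R t) (S.policyState K w t) (K *ᵥ S.policyState K w t) ∂S.noiseLaw =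
        frob (Q t + Kᵀ * R t * K) (S.transientCov K t) := by
    intro t
    obtain ⟨G, h1, h2⟩ := exists_policyState_eq S K t
    simp only [stageCost_gain, h1, ← h2]
    exact ⟨integrable_quadratic _ G t, integral_quadratic hW _ G t⟩
  rw [LQSystem.policyCost, integral_finsetSum _ fun t _ => (h t).1]
  exact Finset.sum_congr rfl fun t _ => (h t).2

/-- Both covariances satisfy the same affine recursion, so their difference satisfies the
homogeneous one, starting from `X`. -/
theorem sub_transientCov (K : Matrix (Fin k) (Fin d) ℝ) {X : Matrix (Fin d) (Fin d) ℝ}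
    (hX : X = S.closedLoop K * X * (S.closedLoop K)ᵀ + S.W) (t : ℕ) :
    X - S.transientCov K t = S.closedLoop K ^ t * X * (S.closedLoop K ^ t)ᵀ := by
  induction t with
  | zero => simp [LQSystem.transientCov]
  | succ t ih =>
    rw [LQSystem.transientCov_succ, pow_succ', transpose_mul]
    calc X - (S.closedLoop K * S.transientCov K t * (S.closedLoop K)ᵀ + S.W)
        = S.closedLoop K * (X - S.transientCov K t) * (S.closedLoop K)ᵀ := by
          conv_lhs => rw [hX]
          rw [Matrix.mul_sub, Matrix.sub_mul]
          abel
      _ = _ := by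
          rw [ih]
          simp only [Matrix.mul_assoc]

/-- The covariance deficit after `t` rounds is `Mᵗ X (Mᵗ)ᵀ`, which decays geometrically. One `κ²`
comes from the powers of `M`, the other from the gain; summing over `t` gives `1/γ`. -/
theorem sum_sdpCost_le_policyCost {κ γ C ν : ℝ} {K : Matrix (Fin k) (Fin d) ℝ}
    (hK : S.StronglyStable κ γ K) (hd : 0 < d) (hW : S.W.PosSemidef)
    {Q : ℕ → Matrix (Fin d) (Fin d) ℝ} {R : ℕ → Matrix (Fin k) (Fin k) ℝ}
    (hQR : ∀ t, (Q t).PosSemidef ∧ (R t).PosSemidef) (hC : 0 ≤ C)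
    (htr : ∀ t, (Q t).trace ≤ C ∧ (R t).trace ≤ C) {X : Matrix (Fin d) (Fin d) ℝ}
    (hX : X.PosSemidef) (hXe : X = S.closedLoop K * X * (S.closedLoop K)ᵀ + S.W)
    (hν : trace X + trace (K * X * Kᵀ) ≤ ν) (T : ℕ) :
    ∑ t ∈ Finset.range T, sdpCost (Q t) (R t) (gainCov K X) ≤
      S.policyCost Q R K T + 2 * C * κ ^ 4 * ν / γ := by
  open scoped Matrix.Norms.L2Operator in
  have hκ := hK.one_le hd
  have hγ := hK.2.1
  have hν0 : trace X ≤ ν := by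
    linarith [(PosSemidef.conj hX K).trace_nonneg]
  have hν1 : 0 ≤ ν := hX.trace_nonneg.trans hν0
  have h0 : 0 ≤ 1 - γ := by linarith [hK.2.2.1]
  have step : ∀ t, sdpCost (Q t) (R t) (gainCov K X) -
      frob (Q t + Kᵀ * R t * K) (S.transientCov K t) ≤ 2 * C * κ ^ 4 * ν * (1 - γ) ^ t := by
    intro t
    have hD := PosSemidef.conj hX (S.closedLoop K ^ t)
    set D := S.closedLoop K ^ t * X * (S.closedLoop K ^ t)ᵀ with hDdef
    have hDt : trace D ≤ κ ^ 2 * (1 - γ) ^ t * ν :=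
      (hK.trace_pow_conj_le hd t hX).trans (by gcongr)
    have hKD : trace (K * D * Kᵀ) ≤ κ ^ 2 * trace D := (trace_conj_le K hD).trans
      (mul_le_mul_of_nonneg_right (pow_le_pow_left₀ (norm_nonneg _) hK.2.2.2.1 2) hD.trace_nonneg)
    have h3 : (1 : ℝ) ≤ κ ^ 2 := one_le_pow₀ hκ
    rw [sdpCost_gainCov, ← frob_sub_right, sub_transientCov K hXe t, ← hDdef, ← sdpCost_gainCov]
    calc sdpCost (Q t) (R t) (gainCov K D) ≤ C * (trace D + trace (K * D * Kᵀ)) :=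
          sdpCost_le (hQR t).1 (hQR t).2 (gainCov_posSemidef K hD) hC (htr t).1 (htr t).2
            (trace_gainCov K D).le
      _ ≤ C * (κ ^ 2 * trace D + κ ^ 2 * trace D) := by
          gcongr
          nlinarith [hD.trace_nonneg]
      _ ≤ C * (κ ^ 2 * (κ ^ 2 * (1 - γ) ^ t * ν) + κ ^ 2 * (κ ^ 2 * (1 - γ) ^ t * ν)) := by
          gcongr
      _ = _ := by ring
  have hsum : ∑ t ∈ Finset.range T, (sdpCost (Q t) (R t) (gainCov K X) -
      frob (Q t + Kᵀ * R t * K) (S.transientCov K t)) ≤ 2 * C * κ ^ 4 * ν * (1 / γ) := by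
    refine (Finset.sum_le_sum fun t _ => step t).trans ?_
    rw [← Finset.mul_sum]
    exact mul_le_mul_of_nonneg_left (sum_one_sub_pow_le hγ hK.2.2.1 T) (by positivity)
  rw [Finset.sum_sub_distrib, ← policyCost_eq hW] at hsum
  have : 2 * C * κ ^ 4 * ν * (1 / γ) = 2 * C * κ ^ 4 * ν / γ := by ring
  linarith

end PolicyCost

end OnlineLQ

namespace OnlineLQ

/-! ### The Laplace distribution -/

section Laplace

variable {η : ℝ}

theorem laplaceDensity_pos (hη : 0 < η) (x : ℝ) : 0 < laplaceDensity η x := by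
  unfold laplaceDensity
  positivity

theorem laplaceDensity_neg (x : ℝ) : laplaceDensity η (-x) = laplaceDensity η x := by
  simp [laplaceDensity]

theorem laplaceDensity_le (hη : 0 < η) (x : ℝ) : laplaceDensity η x ≤ η / 2 := by
  unfold laplaceDensity
  have : Real.exp (-(η * |x|)) ≤ 1 := Real.exp_le_one_iff.mpr (by
    have := mul_nonneg hη.le (abs_nonneg x); linarith)
  nlinarith

theorem measurable_laplaceDensity : Measurable (laplaceDensity η) := by
  unfold laplaceDensity
  fun_prop

theorem integral_laplace (hη : 0 < η) (g : ℝ → ℝ) :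
    ∫ x, g x ∂laplace η = ∫ x, laplaceDensity η x * g x := by
  rw [laplace, integral_withDensity_eq_integral_toReal_smul
    measurable_laplaceDensity.ennreal_ofReal (by simp)]
  simp only [smul_eq_mul, ENNReal.toReal_ofReal (laplaceDensity_pos hη _).le]

theorem integrable_laplace_iff (hη : 0 < η) (g : ℝ → ℝ) :
    Integrable g (laplace η) ↔ Integrable fun x => laplaceDensity η x * g x := by
  rw [laplace, integrable_withDensity_iff_integrable_smul'
    measurable_laplaceDensity.ennreal_ofReal (by simp)]
  simp only [smul_eq_mul, ENNReal.toReal_ofReal (laplaceDensity_pos hη _).le]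

theorem integral_laplaceDensity (hη : 0 < η) : ∫ x, laplaceDensity η x = 1 := by
  unfold laplaceDensity
  rw [integral_comp_abs (f := fun x => η / 2 * Real.exp (-(η * x))), integral_const_mul]
  have h := Real.integral_rpow_mul_exp_neg_mul_Ioi (a := 1) one_pos hη
  simp only [sub_self, Real.rpow_zero, one_mul, Real.rpow_one, Real.Gamma_one, mul_one] at h
  rw [h]
  field_simp

theorem integrable_laplaceDensity (hη : 0 < η) : Integrable (laplaceDensity η) :=
  integrable_of_integral_eq_one (integral_laplaceDensity hη)

theorem isProbabilityMeasure_laplace (hη : 0 < η) : IsProbabilityMeasure (laplace η) := by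
  refine ⟨?_⟩
  rw [laplace, withDensity_apply _ MeasurableSet.univ, setLIntegral_univ,
    ← ofReal_integral_eq_lintegral_ofReal (integrable_laplaceDensity hη)
      (Filter.Eventually.of_forall fun x => (laplaceDensity_pos hη x).le),
    integral_laplaceDensity hη, ENNReal.ofReal_one]

theorem integral_sq_laplace (hη : 0 < η) : ∫ x, x ^ 2 ∂laplace η = 2 / η ^ 2 := by
  rw [integral_laplace hη]
  have h1 : ∀ x : ℝ, laplaceDensity η x * x ^ 2 =
      (fun y => η / 2 * (y ^ ((3 : ℝ) - 1) * Real.exp (-(η * y)))) |x| := by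
    intro x
    have h3 : ((3 : ℝ) - 1) = ((2 : ℕ) : ℝ) := by norm_num
    simp only [laplaceDensity, h3, Real.rpow_natCast, sq_abs]
    ring
  simp only [h1]
  rw [integral_comp_abs (f := fun y => η / 2 * (y ^ ((3 : ℝ) - 1) * Real.exp (-(η * y)))),
    integral_const_mul, Real.integral_rpow_mul_exp_neg_mul_Ioi (by norm_num) hη]
  have h2 : Real.Gamma 3 = 2 := by
    rw [show (3 : ℝ) = ((2 : ℕ) : ℝ) + 1 by norm_num, Real.Gamma_nat_eq_factorial]
    norm_num
  have h3 : (1 / η) ^ (3 : ℝ) = (1 / η) ^ 3 := by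
    exact_mod_cast Real.rpow_natCast (1 / η) 3
  rw [h2, h3]
  field_simp

theorem integrable_sq_laplace (hη : 0 < η) : Integrable (fun x => x ^ 2) (laplace η) := by
  refine .of_integral_ne_zero ?_
  rw [integral_sq_laplace hη]
  positivity

/-- The change of `|x|` under a shift by `c`. -/
def absShift (c x : ℝ) : ℝ := |x - c| - |x|

theorem abs_absShift_le (c x : ℝ) : |absShift c x| ≤ |c| := by
  have h := abs_abs_sub_abs_le (x - c) x
  rwa [sub_sub_cancel_left, abs_neg] at h

theorem measurable_absShift (c : ℝ) : Measurable (absShift c) := by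
  unfold absShift
  fun_prop

theorem memLp_absShift (hη : 0 < η) (c : ℝ) : MemLp (absShift c) 2 (laplace η) := by
  have := isProbabilityMeasure_laplace hη
  exact MemLp.of_bound (measurable_absShift c).aestronglyMeasurable |c|
    (Filter.Eventually.of_forall fun x => abs_absShift_le c x)

/-- Averaging over `x` and `-x` replaces the shift by half of `|x-c| + |x+c| - 2|x|`. This
expression lies between 0 and `2|c|` and vanishes for `|x| > |c|`, so the mean is quadratic in `c`
although each shift is only `O(|c|)`. -/
theorem integral_absShift (hη : 0 < η) (c : ℝ) :
    0 ≤ ∫ x, absShift c x ∂laplace η ∧ ∫ x, absShift c x ∂laplace η ≤ η * c ^ 2 := by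
  have hp := isProbabilityMeasure_laplace hη
  have hi := (integrable_laplace_iff hη _).mp ((memLp_absShift hη c).integrable (by norm_num))
  have h1 : 2 * ∫ x, absShift c x ∂laplace η =
      ∫ x, laplaceDensity η x * (absShift c x + absShift c (-x)) := by
    have h2 := integral_neg_eq_self (fun x => laplaceDensity η x * absShift c x) volume
    rw [integral_laplace hη, two_mul]
    conv_lhs => rw [← h2]
    conv_lhs =>
      arg 2
      rw [h2]
    rw [← integral_add hi.comp_neg hi]
    refine integral_congr_ae (Filter.Eventually.of_forall fun x => ?_)
    simp only [laplaceDensity_neg]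
    ring
  have h3 : ∀ x, absShift c x + absShift c (-x) = |x - c| + |x + c| - 2 * |x| := by
    intro x
    have : |-x - c| = |x + c| := by rw [← abs_neg]; congr 1; ring
    simp only [absShift, abs_neg, this]
    ring
  constructor
  · have : 0 ≤ ∫ x, laplaceDensity η x * (absShift c x + absShift c (-x)) := by
      refine integral_nonneg fun x => mul_nonneg (laplaceDensity_pos hη x).le ?_
      have := abs_add_le (x - c) (x + c)
      rw [h3, show x - c + (x + c) = 2 * x by ring, abs_mul, abs_two] at *
      linarith
    linarith
  -- The height `η|c|` is the density bound `η/2` times `2|c|`; the support has length `2|c|`.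
  · have h4 : ∫ x, laplaceDensity η x * (absShift c x + absShift c (-x)) ≤
        ∫ x, (Set.Icc (-|c|) |c|).indicator (fun _ => η * |c|) x := by
      refine integral_mono_of_nonneg (Filter.Eventually.of_forall fun x => ?_) ?_
        (Filter.Eventually.of_forall fun x => ?_)
      · have := abs_add_le (x - c) (x + c)
        rw [show x - c + (x + c) = 2 * x by ring, abs_mul, abs_two] at this
        refine mul_nonneg (laplaceDensity_pos hη x).le ?_
        rw [h3]
        linarith
      · exact (integrable_indicator_iff measurableSet_Icc).mpr continuousOn_const.integrableOn_Icc
      · change laplaceDensity η x * (absShift c x + absShift c (-x)) ≤ _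
        rw [h3]
        by_cases hx : x ∈ Set.Icc (-|c|) |c|
        · rw [Set.indicator_of_mem hx]
          have h5 : |x - c| + |x + c| - 2 * |x| ≤ 2 * |c| := by
            have h6 := abs_sub x c
            have h7 := abs_add_le x c
            linarith
          have h8 := laplaceDensity_le hη x
          have h9 := laplaceDensity_pos hη x
          nlinarith [abs_nonneg c]
        · rw [Set.indicator_of_notMem hx]
          have hx' : |c| < |x| := by
            rw [Set.mem_Icc, ← abs_le, not_le] at hx
            exact hx
          have h5 : |x - c| + |x + c| - 2 * |x| = 0 := by
            rcases le_or_gt 0 x with h | h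
            · rw [abs_of_nonneg h] at hx' ⊢
              have := abs_lt.mp hx'
              rw [abs_of_nonneg (by linarith), abs_of_nonneg (by linarith)]
              ring
            · rw [abs_of_neg h] at hx' ⊢
              have := abs_lt.mp hx'
              rw [abs_of_nonpos (by linarith), abs_of_nonpos (by linarith)]
              ring
          rw [h5, mul_zero]
    rw [integral_indicator measurableSet_Icc, setIntegral_const, Measure.real, Real.volume_Icc,
      ENNReal.toReal_ofReal (by linarith [abs_nonneg c]), smul_eq_mul, ← h1] at h4
    have h5 : |c| * |c| = c ^ 2 := by rw [← sq, sq_abs]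
    nlinarith

/-- The mean is at most `η b² ≤ b` and, by independence, the variance is at most `b²`, so the second
moment is at most `2b²`. Only the Euclidean norm of `c` enters; bounding entries one at a time would
give its `ℓ¹` norm and a dimension factor. -/
theorem integral_abs_sum_absShift_le (hη : 0 < η) {ι : Type*} [Fintype ι] (c : ι → ℝ) {b : ℝ}
    (hb : 0 < b) (hηb : η * b ≤ 1) (hc : ∑ i, c i ^ 2 ≤ b ^ 2) :
    Integrable (fun x : ι → ℝ => ∑ i, absShift (c i) (x i)) (Measure.pi fun _ => laplace η) ∧
    ∫ x : ι → ℝ, |∑ i, absShift (c i) (x i)| ∂(Measure.pi fun _ => laplace η) ≤ 3 / 2 * b := by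
  have hp := isProbabilityMeasure_laplace hη
  set P : Measure (ι → ℝ) := Measure.pi fun _ => laplace η with hP
  have hm : ∀ i, MemLp (fun x : ι → ℝ => absShift (c i) (x i)) 2 P := fun i =>
    (memLp_absShift hη (c i)).comp_measurePreserving (measurePreserving_eval _ i)
  have hS : MemLp (fun x : ι → ℝ => ∑ i, absShift (c i) (x i)) 2 P :=
    memLp_finsetSum _ fun i _ => hm i
  have hI := hS.integrable (by norm_num)
  refine ⟨hI, ?_⟩
  have hvar : Var[fun x : ι → ℝ => ∑ i, absShift (c i) (x i); P] ≤ b ^ 2 := by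
    have h1 := variance_sum_pi (μ := fun _ : ι => laplace η) (X := fun i => absShift (c i))
      fun i => memLp_absShift hη (c i)
    have h2 : (∑ i, fun ω : ι → ℝ => absShift (c i) (ω i)) =
        fun x : ι → ℝ => ∑ i, absShift (c i) (x i) := by
      ext x
      simp
    rw [h2] at h1
    rw [h1]
    refine (Finset.sum_le_sum fun i _ => ?_).trans hc
    refine (variance_le_expectation_sq (memLp_absShift hη (c i)).1).trans ?_
    have h3 : ∫ x, (absShift (c i) ^ 2) x ∂laplace η ≤ ∫ _, c i ^ 2 ∂laplace η := by
      refine integral_mono (memLp_absShift hη (c i)).integrable_sq (integrable_const _) fun x => ?_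
      exact sq_le_sq.mpr (abs_absShift_le (c i) x)
    simpa using h3
  have hmean : ∫ x : ι → ℝ, ∑ i, absShift (c i) (x i) ∂P =
      ∑ i, ∫ x, absShift (c i) x ∂laplace η := by
    rw [integral_finsetSum _ fun i _ => (hm i).integrable (by norm_num)]
    refine Finset.sum_congr rfl fun i _ => ?_
    exact integral_comp_eval (μ := fun _ : ι => laplace η) (f := absShift (c i))
      (measurable_absShift _).aestronglyMeasurable
  have hmean0 : 0 ≤ ∫ x : ι → ℝ, ∑ i, absShift (c i) (x i) ∂P := by
    rw [hmean]
    exact Finset.sum_nonneg fun i _ => (integral_absShift hη (c i)).1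
  have hmean1 : ∫ x : ι → ℝ, ∑ i, absShift (c i) (x i) ∂P ≤ b := by
    rw [hmean]
    refine (Finset.sum_le_sum fun i _ => (integral_absShift hη (c i)).2).trans ?_
    rw [← Finset.mul_sum]
    nlinarith
  have hsq : ∫ x : ι → ℝ, (∑ i, absShift (c i) (x i)) ^ 2 ∂P ≤ 2 * b ^ 2 := by
    have h1 := variance_eq_sub hS
    simp only [Pi.pow_apply] at h1
    nlinarith
  have hb' := hb.le
  -- The pointwise bound `|y| ≤ y²/(2b) + b/2` passes from the second moment to the first.
  calc ∫ x : ι → ℝ, |∑ i, absShift (c i) (x i)| ∂P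
      ≤ ∫ x : ι → ℝ, ((1 / (2 * b)) * (∑ i, absShift (c i) (x i)) ^ 2 + b / 2) ∂P := by
        refine integral_mono hI.abs ((hS.integrable_sq.const_mul _).add (integrable_const _))
          fun x => ?_
        set y := ∑ i, absShift (c i) (x i) with hy
        have h1 : (1 / (2 * b)) * y ^ 2 + b / 2 - |y| = (|y| - b) ^ 2 / (2 * b) := by
          rw [← sq_abs y]
          field_simp
          ring
        have h2 : 0 ≤ (|y| - b) ^ 2 / (2 * b) := by positivity
        change |y| ≤ (1 / (2 * b)) * y ^ 2 + b / 2
        linarith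
    _ = (1 / (2 * b)) * ∫ x : ι → ℝ, (∑ i, absShift (c i) (x i)) ^ 2 ∂P + b / 2 := by
        rw [integral_add (hS.integrable_sq.const_mul _) (integrable_const _), integral_const_mul]
        simp
    _ ≤ (1 / (2 * b)) * (2 * b ^ 2) + b / 2 := by gcongr
    _ = 3 / 2 * b := by
        field_simp
        ring

/-- The joint density of independent Laplace variables. -/
noncomputable def vecDensity (η : ℝ) {ι : Type*} [Fintype ι] (q : ι → ℝ) : ℝ :=
  ∏ i, laplaceDensity η (q i)

variable {ι : Type*} [Fintype ι]

theorem vecDensity_pos (hη : 0 < η) (q : ι → ℝ) : 0 < vecDensity η q :=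
  Finset.prod_pos fun _ _ => laplaceDensity_pos hη _

theorem vecDensity_neg (q : ι → ℝ) : vecDensity η (-q) = vecDensity η q := by
  simp [vecDensity, laplaceDensity_neg]

theorem measurable_vecDensity : Measurable (vecDensity η : (ι → ℝ) → ℝ) := by
  unfold vecDensity
  exact Finset.measurable_prod _ fun i _ => measurable_laplaceDensity.comp (measurable_pi_apply i)

theorem vecDensity_sub (hη : 0 < η) (q c : ι → ℝ) :
    vecDensity η (q - c) / vecDensity η q = Real.exp (-(η * ∑ i, absShift (c i) (q i))) := by
  rw [div_eq_iff (vecDensity_pos hη q).ne', vecDensity, vecDensity, Finset.mul_sum,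
    ← Finset.sum_neg_distrib, Real.exp_sum, ← Finset.prod_mul_distrib]
  refine Finset.prod_congr rfl fun i _ => ?_
  rw [laplaceDensity, laplaceDensity, mul_left_comm, ← Real.exp_add, absShift, Pi.sub_apply]
  congr 2
  ring

/-- The two measures are compared on boxes, where the integral of the product density factors. -/
theorem pi_laplace_eq (hη : 0 < η) : (Measure.pi fun _ : ι => laplace η) =
    volume.withDensity fun q => ENNReal.ofReal (vecDensity η q) := by
  have hp := isProbabilityMeasure_laplace hη
  refine Measure.pi_eq fun s hs => ?_
  have hint : ∀ i, Integrable ((s i).indicator (laplaceDensity η)) := fun i =>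
    (integrable_laplaceDensity hη).indicator (hs i)
  have hnn : ∀ i x, 0 ≤ (s i).indicator (laplaceDensity η) x := fun i x =>
    Set.indicator_nonneg (fun y _ => (laplaceDensity_pos hη y).le) x
  have h1 : ∀ i, laplace η (s i) =
      ENNReal.ofReal (∫ x, (s i).indicator (laplaceDensity η) x) := by
    intro i
    rw [laplace, withDensity_apply _ (hs i), ofReal_integral_eq_lintegral_ofReal (hint i)
      (Filter.Eventually.of_forall (hnn i)), ← lintegral_indicator (hs i)]
    refine lintegral_congr fun x => ?_
    by_cases hx : x ∈ s i <;> simp [hx]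
  have h2 : ∀ q : ι → ℝ, (Set.univ.pi s).indicator (fun q => ENNReal.ofReal (vecDensity η q)) q =
      ENNReal.ofReal (∏ i, (s i).indicator (laplaceDensity η) (q i)) := by
    intro q
    by_cases hq : q ∈ Set.univ.pi s
    · rw [Set.indicator_of_mem hq, vecDensity]
      congr 1
      exact Finset.prod_congr rfl fun i _ => (Set.indicator_of_mem (hq i (Set.mem_univ i)) _).symm
    · rw [Set.indicator_of_notMem hq]
      simp only [Set.mem_univ_pi, not_forall] at hq
      obtain ⟨i, hi⟩ := hq
      rw [Finset.prod_eq_zero (Finset.mem_univ i) (Set.indicator_of_notMem hi _),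
        ENNReal.ofReal_zero]
  rw [withDensity_apply _ (MeasurableSet.univ_pi hs),
    ← lintegral_indicator (MeasurableSet.univ_pi hs)]
  simp only [h2, h1]
  rw [← ofReal_integral_eq_lintegral_ofReal, volume_pi,
    integral_fintype_prod_eq_prod (fun i => (s i).indicator (laplaceDensity η)),
    ENNReal.ofReal_prod_of_nonneg fun i _ => integral_nonneg (hnn i)]
  · exact Integrable.fintype_prod hint
  · exact Filter.Eventually.of_forall fun q => Finset.prod_nonneg fun i _ => hnn i _

end Laplace

end OnlineLQ

namespace OnlineLQ

/-! ### The lazy transition preserves the law of the perturbation -/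

section Lazy

/-- The probability of keeping the leader when a perturbation `p` with density `ρ` is to be
shifted by `c`. -/
noncomputable def keepProb {E : Type*} [Sub E] (ρ : E → ℝ) (c p : E) : ℝ :=
  min 1 (ρ (p - c) / ρ p)

/-- The kept mass arrives at `p` from `p + c` with density `min (ρ (p+c)) (ρ p)`. The rejected mass
arrives at `p` from `-p`, and as `ρ` is even its density is `ρ p - min (ρ p) (ρ (p+c))`. The two add
up to `ρ p`. -/
theorem lintegral_lazy {E : Type*} [AddCommGroup E] [MeasurableSpace E] [MeasurableAdd E]
    [MeasurableNeg E] [MeasurableSub E] (vol : Measure E) [vol.IsAddRightInvariant]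
    [vol.IsNegInvariant] {ρ : E → ℝ} (hρ : Measurable ρ) (hpos : ∀ p, 0 < ρ p)
    (heven : ∀ p, ρ (-p) = ρ p) (c : E) {f : E → ENNReal} (hf : Measurable f) :
    ∫⁻ p, (ENNReal.ofReal (keepProb ρ c p) * f (p - c) +
        ENNReal.ofReal (1 - keepProb ρ c p) * f (-p))
      ∂(vol.withDensity fun p => ENNReal.ofReal (ρ p)) =
    ∫⁻ p, f p ∂(vol.withDensity fun p => ENNReal.ofReal (ρ p)) := by
  have hm : Measurable (keepProb ρ c) := by
    unfold keepProb
    exact measurable_const.min ((hρ.comp (measurable_id.sub_const c)).div hρ)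
  have hfc : Measurable fun p => f (p - c) := hf.comp (measurable_id.sub_const c)
  have hfn : Measurable fun p => f (-p) := hf.comp measurable_neg
  rw [lintegral_withDensity_eq_lintegral_mul _ hρ.ennreal_ofReal (by fun_prop),
    lintegral_withDensity_eq_lintegral_mul _ hρ.ennreal_ofReal hf]
  set a : E → ℝ := fun p => min (ρ p) (ρ (p - c)) with ha
  have hame : Measurable a := hρ.min (hρ.comp (measurable_id.sub_const c))
  have h1 : ∀ p, ρ p * keepProb ρ c p = a p := by
    intro p
    rw [keepProb, mul_min_of_nonneg _ _ (hpos p).le, mul_one, mul_div_cancel₀ _ (hpos p).ne']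
  have h2 : ∀ p, (fun p => ENNReal.ofReal (ρ p)) p * (ENNReal.ofReal (keepProb ρ c p) * f (p - c) +
      ENNReal.ofReal (1 - keepProb ρ c p) * f (-p)) =
      ENNReal.ofReal (a p) * f (p - c) + ENNReal.ofReal (ρ p - a p) * f (-p) := by
    intro p
    rw [mul_add, ← mul_assoc, ← mul_assoc, ← ENNReal.ofReal_mul (hpos p).le,
      ← ENNReal.ofReal_mul (hpos p).le, mul_sub, mul_one, h1]
  simp only [Pi.mul_apply]
  simp only [h2]
  rw [lintegral_add_left (by fun_prop)]
  have h3 : ∫⁻ p, ENNReal.ofReal (a p) * f (p - c) ∂vol =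
      ∫⁻ p, ENNReal.ofReal (a (p + c)) * f p ∂vol := by
    rw [← lintegral_add_right_eq_self (fun p => ENNReal.ofReal (a p) * f (p - c)) c]
    simp
  have h4 : ∫⁻ p, ENNReal.ofReal (ρ p - a p) * f (-p) ∂vol =
      ∫⁻ p, ENNReal.ofReal (ρ p - a (p + c)) * f p ∂vol := by
    rw [← lintegral_neg_eq_self (fun p => ENNReal.ofReal (ρ p - a p) * f (-p))]
    refine lintegral_congr fun p => ?_
    have h5 : ρ (-p - c) = ρ (p + c) := by rw [← heven]; congr 1; abel
    simp only [ha, neg_neg, heven, h5, add_sub_cancel_right, min_comm]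
  rw [h3, h4, ← lintegral_add_left (by fun_prop)]
  refine lintegral_congr fun p => ?_
  have h6 : 0 ≤ a (p + c) := le_min (hpos _).le (hpos _).le
  have h7 : a (p + c) ≤ ρ p := by
    simp [ha]
  rw [← add_mul, ← ENNReal.ofReal_add h6 (by linarith), add_sub_cancel]

end Lazy

/-! ### Integrating out a single coin. -/

section Coins

/-- Redrawing one coordinate independently does not change a product law. This isolates the coin of
round `t` from everything determined by the earlier coins. -/
theorem measurePreserving_update {X : Type*} [MeasurableSpace X] (μ : Measure X)
    [IsProbabilityMeasure μ] (t : ℕ) :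
    MeasurePreserving (fun p : (ℕ → X) × X => Function.update p.1 t p.2)
      ((Measure.infinitePi fun _ : ℕ => μ).prod μ) (Measure.infinitePi fun _ : ℕ => μ) := by
  have hmeas : Measurable fun p : (ℕ → X) × X => Function.update p.1 t p.2 := by
    rw [measurable_pi_iff]
    intro i
    by_cases h : i = t
    · subst h
      simpa using measurable_snd
    · simp only [Function.update_of_ne h]
      exact (measurable_pi_apply i).comp measurable_fst
  refine ⟨hmeas, Measure.eq_infinitePi _ fun s u hu => ?_⟩
  have hset : MeasurableSet ((s : Set ℕ).pi u) :=
    MeasurableSet.pi s.countable_toSet fun i _ => hu i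
  rw [Measure.map_apply hmeas hset]
  by_cases ht : t ∈ s
  · have h1 : (fun p : (ℕ → X) × X => Function.update p.1 t p.2) ⁻¹' (s : Set ℕ).pi u =
        ((s.erase t : Finset ℕ) : Set ℕ).pi u ×ˢ u t := by
      ext p
      simp only [Set.mem_preimage, Set.mem_pi, Finset.mem_coe, Set.mem_prod, Finset.mem_erase]
      constructor
      · intro h
        refine ⟨fun i hi => ?_, ?_⟩
        · simpa [Function.update_of_ne hi.1] using h i hi.2
        · simpa using h t ht
      · rintro ⟨h1, h2⟩ i hi
        by_cases hit : i = t
        · subst hit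
          simpa using h2
        · simpa [Function.update_of_ne hit] using h1 i ⟨hit, hi⟩
    rw [h1, Measure.prod_prod, Measure.infinitePi_pi _ fun i _ => hu i,
      Finset.prod_erase_mul _ _ ht]
  · have h1 : (fun p : (ℕ → X) × X => Function.update p.1 t p.2) ⁻¹' (s : Set ℕ).pi u =
        (s : Set ℕ).pi u ×ˢ Set.univ := by
      ext p
      simp only [Set.mem_preimage, Set.mem_pi, Finset.mem_coe, Set.mem_prod, Set.mem_univ, and_true]
      refine forall₂_congr fun i hi => ?_
      rw [Function.update_of_ne (show i ≠ t from fun h => ht (h ▸ hi))]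
    rw [h1, Measure.prod_prod, Measure.infinitePi_pi _ fun i _ => hu i, measure_univ, mul_one]

theorem lintegral_coin {a : ℝ} (h0 : 0 ≤ a) (h1 : a ≤ 1) (x y : ENNReal) :
    ∫⁻ u : unitInterval, (if (u : ℝ) ≤ a then x else y) =
      ENNReal.ofReal a * x + ENNReal.ofReal (1 - a) * y := by
  set b : unitInterval := ⟨a, h0, h1⟩ with hb
  have h2 : (fun u : unitInterval => if (u : ℝ) ≤ a then x else y) = fun u =>
      (Set.Iic b).indicator (fun _ => x) u + (Set.Ioi b).indicator (fun _ => y) u := by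
    funext u
    by_cases hu : (u : ℝ) ≤ a
    · have h3 : u ∈ Set.Iic b := hu
      have h4 : u ∉ Set.Ioi b := fun h => absurd (Set.mem_Iic.mp h3) (not_le.mpr h)
      simp [hu, h3, h4]
    · have h3 : u ∉ Set.Iic b := hu
      have h4 : u ∈ Set.Ioi b := lt_of_not_ge hu
      simp [hu, h3, h4]
  rw [h2, lintegral_add_left (measurable_const.indicator measurableSet_Iic),
    lintegral_indicator_const measurableSet_Iic, lintegral_indicator_const measurableSet_Ioi,
    unitInterval.volume_Iic, unitInterval.volume_Ioi, mul_comm x, mul_comm y]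

end Coins

/-! ### Perturbations as vectors -/

section Pert

variable {d k : ℕ}

/-- Pairs of upper triangles. -/
abbrev PertVec (d k : ℕ) : Type := (UpperIdx d → ℝ) × (UpperIdx k → ℝ)

/-- The upper triangle of a matrix. -/
def upper {n : ℕ} (M : Matrix (Fin n) (Fin n) ℝ) : UpperIdx n → ℝ :=
  fun p => M p.1.1 p.1.2

theorem symOf_upper {n : ℕ} {M : Matrix (Fin n) (Fin n) ℝ} (hM : M.IsSymm) :
    symOf (upper M) = M := by
  ext i j
  simp only [symOf, upper, of_apply]
  split_ifs
  · rfl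
  · exact hM.apply i j

theorem symOf_isSymm {n : ℕ} (q : UpperIdx n → ℝ) : (symOf q).IsSymm := by
  ext i j
  simp only [symOf, transpose_apply, of_apply]
  by_cases h1 : i ≤ j <;> by_cases h2 : j ≤ i
  · obtain rfl := le_antisymm h1 h2
    rfl
  · simp [h1, h2]
  · simp [h1, h2]
  · exact absurd (le_of_not_ge h1) h2

theorem symOf_add {n : ℕ} (q r : UpperIdx n → ℝ) : symOf (q + r) = symOf q + symOf r := by
  ext i j
  simp only [symOf, of_apply, Matrix.add_apply, Pi.add_apply]
  split_ifs <;> rfl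

theorem symOf_sub {n : ℕ} (q r : UpperIdx n → ℝ) : symOf (q - r) = symOf q - symOf r := by
  ext i j
  simp only [symOf, of_apply, Matrix.sub_apply, Pi.sub_apply]
  split_ifs <;> rfl

theorem symOf_neg {n : ℕ} (q : UpperIdx n → ℝ) : symOf (-q) = -symOf q := by
  ext i j
  simp only [symOf, of_apply, Matrix.neg_apply, Pi.neg_apply]
  split_ifs <;> rfl

theorem measurable_symOf {n : ℕ} (i j : Fin n) :
    Measurable fun q : UpperIdx n → ℝ => symOf q i j := by
  by_cases h : i ≤ j <;> simp only [symOf, of_apply, h, dite_true, dite_false] <;> fun_prop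

/-- The density of the initial perturbation. -/
noncomputable def pertVecDensity (η : ℝ) (p : PertVec d k) : ℝ :=
  vecDensity η p.1 * vecDensity η p.2

theorem pertDensity_symOf (η : ℝ) (p : PertVec d k) :
    pertDensity η (symOf p.1) (symOf p.2) = pertVecDensity η p := by
  simp only [pertDensity, pertVecDensity, vecDensity]
  congr 1 <;> exact Finset.prod_congr rfl fun i _ => by simp [symOf, i.2]

/-- The law of the initial perturbation. -/
noncomputable def pertLaw (d k : ℕ) (η : ℝ) : Measure (PertVec d k) :=
  (Measure.pi fun _ : UpperIdx d => laplace η).prod (Measure.pi fun _ : UpperIdx k => laplace η)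

theorem pertVecDensity_pos {η : ℝ} (hη : 0 < η) (p : PertVec d k) : 0 < pertVecDensity η p :=
  mul_pos (vecDensity_pos hη _) (vecDensity_pos hη _)

theorem pertVecDensity_neg (η : ℝ) (p : PertVec d k) :
    pertVecDensity η (-p) = pertVecDensity η p := by
  simp [pertVecDensity, vecDensity_neg]

theorem measurable_pertVecDensity {η : ℝ} :
    Measurable (pertVecDensity η : PertVec d k → ℝ) :=
  (measurable_vecDensity.comp measurable_fst).mul (measurable_vecDensity.comp measurable_snd)

theorem pertLaw_eq {η : ℝ} (hη : 0 < η) :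
    pertLaw d k η = volume.withDensity fun p => ENNReal.ofReal (pertVecDensity η p) := by
  rw [pertLaw, pi_laplace_eq hη, pi_laplace_eq hη,
    prod_withDensity measurable_vecDensity.ennreal_ofReal measurable_vecDensity.ennreal_ofReal]
  simp only [pertVecDensity, ENNReal.ofReal_mul (vecDensity_pos hη _).le]
  rfl

theorem isProbabilityMeasure_pertLaw {η : ℝ} (hη : 0 < η) :
    IsProbabilityMeasure (pertLaw d k η) := by
  have := isProbabilityMeasure_laplace hη
  unfold pertLaw
  infer_instance

theorem measurable_keepProb {η : ℝ} (c : PertVec d k) :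
    Measurable (keepProb (pertVecDensity η) c) := by
  unfold keepProb
  exact measurable_const.min
    ((measurable_pertVecDensity.comp (measurable_id.sub_const c)).div measurable_pertVecDensity)

theorem keepProb_nonneg {η : ℝ} (hη : 0 < η) (c p : PertVec d k) :
    0 ≤ keepProb (pertVecDensity η) c p :=
  le_min zero_le_one (div_nonneg (pertVecDensity_pos hη _).le (pertVecDensity_pos hη _).le)

theorem keepProb_le_one {E : Type*} [Sub E] (ρ : E → ℝ) (c p : E) : keepProb ρ c p ≤ 1 :=
  min_le_left _ _

/-- The density ratio is the exponential of `-η` times the total shift of absolute values, and `1 -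
e⁻ʸ ≤ y`. -/
theorem one_sub_keepProb_le {η : ℝ} (hη : 0 < η) (c p : PertVec d k) :
    1 - keepProb (pertVecDensity η) c p ≤
      η * (|∑ i, absShift (c.1 i) (p.1 i)| + |∑ i, absShift (c.2 i) (p.2 i)|) := by
  set a := ∑ i, absShift (c.1 i) (p.1 i)
  set b := ∑ i, absShift (c.2 i) (p.2 i)
  have h1 : pertVecDensity η (p - c) / pertVecDensity η p = Real.exp (-(η * (a + b))) := by
    rw [pertVecDensity, pertVecDensity, mul_div_mul_comm, Prod.fst_sub, Prod.snd_sub,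
      vecDensity_sub hη, vecDensity_sub hη, ← Real.exp_add]
    congr 1
    ring
  have h2 := Real.add_one_le_exp (-(η * (a + b)))
  have h3 : η * (a + b) ≤ η * (|a| + |b|) :=
    mul_le_mul_of_nonneg_left (add_le_add (le_abs_self a) (le_abs_self b)) hη.le
  have h4 : 0 ≤ η * (|a| + |b|) := by positivity
  rw [keepProb, h1]
  rcases min_choice 1 (Real.exp (-(η * (a + b)))) with h | h <;> rw [h] <;> linarith

/-- The state and input blocks contribute `3ηb/2` each. If `ηb > 1` the bound exceeds 1 and is
trivial for a probability. -/
theorem lintegral_one_sub_keepProb_le {η b : ℝ} (hη : 0 < η) (hb : 0 < b) (c : PertVec d k)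
    (h1 : ∑ i, c.1 i ^ 2 ≤ b ^ 2) (h2 : ∑ i, c.2 i ^ 2 ≤ b ^ 2) :
    ∫⁻ p, ENNReal.ofReal (1 - keepProb (pertVecDensity η) c p) ∂pertLaw d k η ≤
      ENNReal.ofReal (3 * (η * b)) := by
  have hp := isProbabilityMeasure_pertLaw (d := d) (k := k) hη
  have hl := isProbabilityMeasure_laplace hη
  rcases le_or_gt (η * b) 1 with hηb | hηb
  · obtain ⟨i1, l1⟩ := integral_abs_sum_absShift_le hη c.1 hb hηb h1
    obtain ⟨i2, l2⟩ := integral_abs_sum_absShift_le hη c.2 hb hηb h2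
    have j1 : Integrable (fun p : PertVec d k => |∑ i, absShift (c.1 i) (p.1 i)|) (pertLaw d k η) :=
      i1.abs.comp_fst _
    have j2 : Integrable (fun p : PertVec d k => |∑ i, absShift (c.2 i) (p.2 i)|) (pertLaw d k η) :=
      i2.abs.comp_snd _
    refine (lintegral_mono fun p => ENNReal.ofReal_le_ofReal (one_sub_keepProb_le hη c p)).trans ?_
    have j3 : Integrable (fun p : PertVec d k => η * (|∑ i, absShift (c.1 i) (p.1 i)| +
        |∑ i, absShift (c.2 i) (p.2 i)|)) (pertLaw d k η) := (j1.add j2).const_mul η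
    rw [← ofReal_integral_eq_lintegral_ofReal j3
      (Filter.Eventually.of_forall fun p => by
        change 0 ≤ η * (|_| + |_|)
        positivity)]
    refine ENNReal.ofReal_le_ofReal ?_
    rw [integral_const_mul, integral_add j1 j2, pertLaw,
      integral_fun_fst (fun q : UpperIdx d → ℝ => |∑ i, absShift (c.1 i) (q i)|),
      integral_fun_snd (fun q : UpperIdx k → ℝ => |∑ i, absShift (c.2 i) (q i)|)]
    simp only [probReal_univ, one_smul]
    nlinarith
  · calc _ ≤ ∫⁻ _, 1 ∂pertLaw d k η := lintegral_mono fun p => by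
          rw [← ENNReal.ofReal_one]
          exact ENNReal.ofReal_le_ofReal (by linarith [keepProb_nonneg hη c p])
      _ = 1 := by simp
      _ ≤ _ := by
          rw [← ENNReal.ofReal_one]
          exact ENNReal.ofReal_le_ofReal (by linarith)

theorem sum_sq_upper_le {n : ℕ} {M : Matrix (Fin n) (Fin n) ℝ} (hM : M.PosSemidef) {C : ℝ}
    (hC : trace M ≤ C) : ∑ p, upper M p ^ 2 ≤ C ^ 2 := by
  refine le_trans ?_ ((PosSemidef.sum_sq_le hM).trans (pow_le_pow_left₀ hM.trace_nonneg hC 2))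
  rw [← Fintype.sum_prod_type' (fun i j => M i j ^ 2)]
  have h := Finset.sum_le_sum_of_subset_of_nonneg
    (s := Finset.univ.map (Function.Embedding.subtype fun p : Fin n × Fin n => p.1 ≤ p.2))
    (t := Finset.univ) (f := fun p : Fin n × Fin n => M p.1 p.2 ^ 2) (Finset.subset_univ _)
    (fun _ _ _ => sq_nonneg _)
  rw [Finset.sum_map] at h
  exact h

/-- The expected squared Frobenius norm of the perturbation is at most `2 (d² + k²) / η²`. -/
theorem integral_sq_symOf {n : ℕ} {η : ℝ} (hη : 0 < η) :
    Integrable (fun q : UpperIdx n → ℝ => ∑ i, ∑ j, symOf q i j ^ 2)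
      (Measure.pi fun _ => laplace η) ∧
    ∫ q : UpperIdx n → ℝ, ∑ i, ∑ j, symOf q i j ^ 2 ∂(Measure.pi fun _ => laplace η) =
      n ^ 2 * (2 / η ^ 2) := by
  have hl := isProbabilityMeasure_laplace hη
  have h1 : ∀ i j : Fin n, ∃ p : UpperIdx n, ∀ q : UpperIdx n → ℝ, symOf q i j = q p := by
    intro i j
    by_cases h : i ≤ j
    · exact ⟨⟨(i, j), h⟩, fun q => by simp [symOf, h]⟩
    · exact ⟨⟨(j, i), le_of_not_ge h⟩, fun q => by simp [symOf, h]⟩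
  have h2 : ∀ i j : Fin n, Integrable (fun q : UpperIdx n → ℝ => symOf q i j ^ 2)
      (Measure.pi fun _ => laplace η) ∧
      ∫ q : UpperIdx n → ℝ, symOf q i j ^ 2 ∂(Measure.pi fun _ => laplace η) = 2 / η ^ 2 := by
    intro i j
    obtain ⟨p, hp⟩ := h1 i j
    simp only [hp]
    refine ⟨integrable_comp_eval (μ := fun _ : UpperIdx n => laplace η) (f := fun x => x ^ 2)
      (integrable_sq_laplace hη), ?_⟩
    rw [← integral_sq_laplace hη]
    exact integral_comp_eval (μ := fun _ : UpperIdx n => laplace η) (f := fun x => x ^ 2)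
      (integrable_sq_laplace hη).1
  refine ⟨integrable_finsetSum _ fun i _ => integrable_finsetSum _ fun j _ => (h2 i j).1, ?_⟩
  rw [integral_finsetSum _ fun i _ => integrable_finsetSum _ fun j _ => (h2 i j).1]
  simp_rw [integral_finsetSum _ fun j _ => (h2 _ j).1, (h2 _ _).2]
  simp
  ring

/-- The Frobenius norm of a perturbation. -/
noncomputable def pertNorm (p : PertVec d k) : ℝ :=
  √(∑ i, ∑ j, symOf p.1 i j ^ 2 + ∑ i, ∑ j, symOf p.2 i j ^ 2)

theorem integral_pertNorm_le {η : ℝ} (hη : 0 < η) (hd : 0 < d) :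
    Integrable (pertNorm : PertVec d k → ℝ) (pertLaw d k η) ∧
    ∫ p, pertNorm p ∂pertLaw d k η ≤ 3 / 2 * ((d + k : ℕ) : ℝ) / η := by
  have hl := isProbabilityMeasure_laplace hη
  have hp := isProbabilityMeasure_pertLaw (d := d) (k := k) hη
  have j1 : Integrable (fun p : PertVec d k => ∑ i, ∑ j, symOf p.1 i j ^ 2) (pertLaw d k η) :=
    (integral_sq_symOf hη).1.comp_fst _
  have j2 : Integrable (fun p : PertVec d k => ∑ i, ∑ j, symOf p.2 i j ^ 2) (pertLaw d k η) :=
    (integral_sq_symOf hη).1.comp_snd _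
  set n : ℝ := ((d + k : ℕ) : ℝ) with hn
  have hn0 : 0 < n := by
    rw [hn]
    exact_mod_cast Nat.add_pos_left hd k
  -- The inequality `s ≤ ηs²/(2n) + n/(2η)` at the natural scale `s = n/η`. As `E s² ≤ 2n²/η²`, it
  -- yields `n/η + n/(2η)`.
  set b : PertVec d k → ℝ := fun p => η / (2 * n) *
    (∑ i, ∑ j, symOf p.1 i j ^ 2 + ∑ i, ∑ j, symOf p.2 i j ^ 2) + n / (2 * η) with hb
  have j3 : Integrable (fun p : PertVec d k => η / (2 * n) *
      (∑ i, ∑ j, symOf p.1 i j ^ 2 + ∑ i, ∑ j, symOf p.2 i j ^ 2)) (pertLaw d k η) :=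
    (j1.add j2).const_mul _
  have hbi : Integrable b (pertLaw d k η) := j3.add (integrable_const _)
  have hle : ∀ p, pertNorm p ≤ b p := by
    intro p
    have h0 : 0 ≤ ∑ i, ∑ j, symOf p.1 i j ^ 2 + ∑ i, ∑ j, symOf p.2 i j ^ 2 := by positivity
    have h1 := Real.sq_sqrt h0
    change (pertNorm p) ^ 2 = _ at h1
    have h2 : b p - pertNorm p = (η * pertNorm p - n) ^ 2 / (2 * n * η) := by
      rw [hb]
      simp only [← h1]
      field_simp
      ring
    have h3 : 0 ≤ (η * pertNorm p - n) ^ 2 / (2 * n * η) := by positivity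
    linarith
  have hnn : ∀ p : PertVec d k, 0 ≤ pertNorm p := fun p => Real.sqrt_nonneg _
  have hm : Measurable (pertNorm : PertVec d k → ℝ) := by
    unfold pertNorm
    refine Measurable.sqrt (Measurable.add ?_ ?_)
    · exact Finset.measurable_sum _ fun i _ => Finset.measurable_sum _ fun j _ =>
        ((measurable_symOf i j).comp measurable_fst).pow_const 2
    · exact Finset.measurable_sum _ fun i _ => Finset.measurable_sum _ fun j _ =>
        ((measurable_symOf i j).comp measurable_snd).pow_const 2
  have hi : Integrable (pertNorm : PertVec d k → ℝ) (pertLaw d k η) :=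
    hbi.mono' hm.aestronglyMeasurable (Filter.Eventually.of_forall fun p => by
      rw [Real.norm_of_nonneg (hnn p)]
      exact hle p)
  refine ⟨hi, (integral_mono hi hbi hle).trans ?_⟩
  simp only [hb]
  rw [integral_add j3 (integrable_const _), integral_const_mul,
    integral_add j1 j2, pertLaw,
    integral_fun_fst (fun q : UpperIdx d → ℝ => ∑ i, ∑ j, symOf q i j ^ 2),
    integral_fun_snd (fun q : UpperIdx k → ℝ => ∑ i, ∑ j, symOf q i j ^ 2),
    (integral_sq_symOf hη).2, (integral_sq_symOf hη).2]
  simp only [probReal_univ, integral_const, smul_eq_mul, one_mul]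
  have h4 : (d : ℝ) ^ 2 * (2 / η ^ 2) + (k : ℝ) ^ 2 * (2 / η ^ 2) ≤ n ^ 2 * (2 / η ^ 2) := by
    rw [← add_mul]
    refine mul_le_mul_of_nonneg_right ?_ (by positivity)
    rw [hn]
    push_cast
    nlinarith [(Nat.cast_nonneg d : (0 : ℝ) ≤ d), (Nat.cast_nonneg k : (0 : ℝ) ≤ k),
      mul_nonneg (Nat.cast_nonneg d : (0 : ℝ) ≤ d) (Nat.cast_nonneg k : (0 : ℝ) ≤ k)]
  calc _ ≤ η / (2 * n) * (n ^ 2 * (2 / η ^ 2)) + n / (2 * η) := by gcongr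
    _ = _ := by
        field_simp
        ring

end Pert

end OnlineLQ

namespace OnlineLQ

/-! ### The run of Follow the Lazy Leader -/

section Coin

/-- The law of the coins. -/
noncomputable def coinLaw : Measure (ℕ → unitInterval) :=
  Measure.infinitePi fun _ : ℕ => (volume : Measure unitInterval)

instance : IsProbabilityMeasure coinLaw := by
  unfold coinLaw
  infer_instance

end Coin

namespace FLL

variable {d k : ℕ}

/-- The upper triangles of the costs of round `t`. -/
def costVec (F : FLL d k) (t : ℕ) : PertVec d k :=
  (upper (F.Q t), upper (F.R t))

/-- The upper triangles of the sums of the costs before round `t`. -/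
def sumVec (F : FLL d k) (t : ℕ) : PertVec d k :=
  ∑ s ∈ Finset.range t, F.costVec s

theorem sumVec_succ (F : FLL d k) (t : ℕ) : F.sumVec (t + 1) = F.sumVec t + F.costVec t :=
  Finset.sum_range_succ _ _

/-- The probability of keeping the leader at the end of round `t`. -/
noncomputable def keep (F : FLL d k) (t : ℕ) (p : PertVec d k) : ℝ :=
  keepProb (pertVecDensity F.η) (F.costVec t) p

open scoped Classical in
/-- The upper triangles of the perturbations. -/
noncomputable def pertVec (F : FLL d k) (p : PertVec d k) (c : ℕ → unitInterval) :
    ℕ → PertVec d k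
  | 0 => p
  | t + 1 =>
    if (c t : ℝ) ≤ F.keep t (F.pertVec p c t) then F.pertVec p c t - F.costVec t
    else -F.pertVec p c t

/-- The upper triangles of the arguments of the oracle. -/
noncomputable def leaderVec (F : FLL d k) (p : PertVec d k) (c : ℕ → unitInterval) (t : ℕ) :
    PertVec d k :=
  F.sumVec t + F.pertVec p c t

/-- The oracle as a function of upper triangles. -/
noncomputable def vecOracle (F : FLL d k) (z : PertVec d k) : Matrix (Fin k) (Fin d) ℝ :=
  F.oracle (symOf z.1) (symOf z.2)

/-! ### Reduction to upper triangles, and the dynamics of the deviation. -/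

section Structure

variable {F : FLL d k}

theorem symOf_costVec (hQR : ∀ t, (F.Q t).PosSemidef ∧ (F.R t).PosSemidef) (t : ℕ) :
    symOf (F.costVec t).1 = F.Q t ∧ symOf (F.costVec t).2 = F.R t :=
  ⟨symOf_upper (PosSemidef.isSymm (hQR t).1), symOf_upper (PosSemidef.isSymm (hQR t).2)⟩

theorem symOf_sumVec (hQR : ∀ t, (F.Q t).PosSemidef ∧ (F.R t).PosSemidef) (t : ℕ) :
    symOf (F.sumVec t).1 = ∑ s ∈ Finset.range t, F.Q s ∧
      symOf (F.sumVec t).2 = ∑ s ∈ Finset.range t, F.R s := by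
  induction t with
  | zero => constructor <;> ext i j <;> simp [sumVec, symOf]
  | succ t ih =>
    rw [sumVec_succ, Finset.sum_range_succ, Finset.sum_range_succ, Prod.fst_add, Prod.snd_add,
      symOf_add, symOf_add, ih.1, ih.2, (symOf_costVec hQR t).1, (symOf_costVec hQR t).2]
    exact ⟨rfl, rfl⟩

theorem keep_eq (hQR : ∀ t, (F.Q t).PosSemidef ∧ (F.R t).PosSemidef) (t : ℕ) (p : PertVec d k) :
    min 1 (pertDensity F.η (symOf p.1 - F.Q t) (symOf p.2 - F.R t) /
      pertDensity F.η (symOf p.1) (symOf p.2)) = F.keep t p := by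
  rw [← (symOf_costVec hQR t).1, ← (symOf_costVec hQR t).2, ← symOf_sub, ← symOf_sub,
    pertDensity_symOf, ← Prod.fst_sub, ← Prod.snd_sub, pertDensity_symOf]
  rfl

theorem pert_eq (hQR : ∀ t, (F.Q t).PosSemidef ∧ (F.R t).PosSemidef) (ω : Sample d k) (t : ℕ) :
    F.pert ω t =
      (symOf (F.pertVec ω.1 ω.2.1 t).1, symOf (F.pertVec ω.1 ω.2.1 t).2) := by
  induction t with
  | zero => rfl
  | succ t ih =>
    simp only [pert, pertVec, ih, keep_eq hQR]
    split_ifs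
    · simp [symOf_sub, (symOf_costVec hQR t).1, (symOf_costVec hQR t).2]
    · simp [symOf_neg]

theorem switch_iff (hQR : ∀ t, (F.Q t).PosSemidef ∧ (F.R t).PosSemidef) (ω : Sample d k) (t : ℕ) :
    F.Switch t ω ↔ ¬ ((ω.2.1 t : ℝ) ≤ F.keep t (F.pertVec ω.1 ω.2.1 t)) := by
  rw [Switch, pert_eq hQR, keep_eq hQR]

theorem gain_eq (hQR : ∀ t, (F.Q t).PosSemidef ∧ (F.R t).PosSemidef) (ω : Sample d k) (t : ℕ) :
    F.gain ω t = F.vecOracle (F.leaderVec ω.1 ω.2.1 t) := by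
  rw [gain, pert_eq hQR, vecOracle, leaderVec, Prod.fst_add, Prod.snd_add, symOf_add, symOf_add,
    (symOf_sumVec hQR t).1, (symOf_sumVec hQR t).2]

/-- The cost just revealed is added to the sum and subtracted from the perturbation, so the oracle
is asked the same question again. -/
theorem leaderVec_succ_of_keep {p : PertVec d k} {c : ℕ → unitInterval} {t : ℕ}
    (h : (c t : ℝ) ≤ F.keep t (F.pertVec p c t)) :
    F.leaderVec p c (t + 1) = F.leaderVec p c t := by
  rw [leaderVec, leaderVec, sumVec_succ, pertVec, if_pos h]
  abel

/-- The state on the noiseless reset trajectory, or `0` when no reset is in progress. -/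
def resetTarget (F : FLL d k) (s : Memory d) : Fin d → ℝ :=
  if s.age < F.plan.len then F.S.driven F.plan.v s.age s.anchor else 0

theorem resetTarget_age_zero (F : FLL d k) (x : Fin d → ℝ) : F.resetTarget ⟨x, x, 0⟩ = x := by
  rw [resetTarget]
  split_ifs with h
  · rfl
  -- A plan of length 0 already asserts that `x = 0`.
  · have h0 : F.plan.len = 0 := Nat.eq_zero_of_not_pos h
    have := F.plan.drives_to_zero x
    rw [h0] at this
    exact this.symm

/-- The feedback acts on the deviation only, so one closed-loop recursion holds during and after
resets. In the last round of a reset the target reaches 0, which joins the two regimes. -/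
theorem next_sub_resetTarget (F : FLL d k) (K : Matrix (Fin k) (Fin d) ℝ) (s : Memory d)
    (w : EuclideanSpace ℝ (Fin d)) :
    F.S.next s.x (F.control K s) w -
        F.resetTarget ⟨F.S.next s.x (F.control K s) w, s.anchor, s.age + 1⟩ =
      F.S.closedLoop K *ᵥ (s.x - F.resetTarget s) + w.ofLp := by
  by_cases h : s.age < F.plan.len
  · have h1 : F.resetTarget ⟨F.S.next s.x (F.control K s) w, s.anchor, s.age + 1⟩ =
        F.S.driven F.plan.v (s.age + 1) s.anchor := by
      rw [resetTarget]
      split_ifs with h2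
      · rfl
      · have h3 : s.age + 1 = F.plan.len := le_antisymm h (not_lt.mp h2)
        rw [h3, F.plan.drives_to_zero]
    rw [h1, resetTarget, if_pos h, control, if_pos h, LQSystem.next, LQSystem.driven,
      LQSystem.closedLoop, add_mulVec, mulVec_add, ← mulVec_mulVec, mulVec_sub F.S.A]
    abel
  · have h1 : F.resetTarget ⟨F.S.next s.x (F.control K s) w, s.anchor, s.age + 1⟩ = 0 :=
      if_neg fun h2 => h (Nat.lt_of_succ_lt h2)
    rw [h1, resetTarget, if_neg h, control, if_neg h, LQSystem.next, LQSystem.closedLoop,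
      add_mulVec, ← mulVec_mulVec, sub_zero, sub_zero]

end Structure

/-! ### Expected cost of a round, and charging reset rounds to switches. -/

section Deviation

variable {F : FLL d k} {ν : ℝ}
  {sol : Matrix (Fin d) (Fin d) ℝ → Matrix (Fin k) (Fin k) ℝ →
    Matrix (Fin d ⊕ Fin k) (Fin d ⊕ Fin k) ℝ}
  {Z : Matrix (Fin d ⊕ Fin k) (Fin d ⊕ Fin k) ℝ}

/-- For fixed perturbation and coins, the deviation from the reset trajectory is a linear function
of the noise whose covariance is dominated by the certificate of the current gain. -/
theorem exists_deviation (hcert : F.S.IsCertificate ν F.oracle sol Z)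
    (hQR : ∀ t, (F.Q t).PosSemidef ∧ (F.R t).PosSemidef) (p : PertVec d k)
    (c : ℕ → unitInterval) (t : ℕ) :
    ∃ G, (∀ w, (F.mem (p, c, w) t).x - F.resetTarget (F.mem (p, c, w) t) = linearState G t w) ∧
      ((sol (symOf (F.leaderVec p c t).1) (symOf (F.leaderVec p c t).2)).toBlocks₁₁ -
        linearCov F.S.W G t).PosSemidef := by
  induction t with
  | zero =>
    refine ⟨0, fun w => ?_, ?_⟩
    · simp [mem, resetTarget, linearState]
    · simpa [linearCov] using
        PosSemidef.toBlocks₁₁ (hcert.posSemidef _ _ (symOf_isSymm _) (symOf_isSymm _))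
  | succ t ih =>
    obtain ⟨G, hG, hX⟩ := ih
    by_cases hk : (c t : ℝ) ≤ F.keep t (F.pertVec p c t)
    · have hs : ∀ w, ¬ F.Switch t (p, c, w) := fun w => by
        rw [switch_iff hQR, not_not]
        exact hk
      refine ⟨stepCoeff (F.S.closedLoop (F.vecOracle (F.leaderVec p c t))) G t, fun w => ?_, ?_⟩
      · rw [linearState_stepCoeff, ← hG w]
        simp only [mem, if_neg (hs w)]
        rw [next_sub_resetTarget, gain_eq hQR]
      · rw [leaderVec_succ_of_keep hk, linearCov_stepCoeff]
        have h1 := hcert.contracts _ _ (symOf_isSymm (F.leaderVec p c t).1)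
          (symOf_isSymm (F.leaderVec p c t).2)
        rw [← vecOracle] at h1
        have h2 := PosSemidef.conj hX (F.S.closedLoop (F.vecOracle (F.leaderVec p c t)))
        -- With `M` the closed loop and `Y` the current covariance, the sum of `X - (M X Mᵀ + W)`
        -- and `M (X - Y) Mᵀ` is `X - (M Y Mᵀ + W)`. The same `X` serves because the leader was
        -- kept.
        have h3 := h1.add h2
        refine (congrArg Matrix.PosSemidef ?_).mp h3
        rw [Matrix.mul_sub, Matrix.sub_mul]
        abel
    · have hs : ∀ w, F.Switch t (p, c, w) := fun w => (switch_iff hQR _ _).mpr hk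
      -- After a switch the deviation is 0, so any new certificate dominates its covariance.
      refine ⟨0, fun w => ?_, ?_⟩
      · simp only [mem, if_pos (hs w)]
        rw [resetTarget_age_zero]
        simp [linearState]
      · simpa [linearCov] using
          PosSemidef.toBlocks₁₁ (hcert.posSemidef _ _ (symOf_isSymm _) (symOf_isSymm _))

/-- The cost of a round outside resets. -/
noncomputable def regularCost (F : FLL d k) (t : ℕ) (ω : Sample d k) : ℝ :=
  if (F.mem ω t).age < F.plan.len then 0 else F.roundCost t ω

/-- With perturbation and coins fixed the gain is deterministic, and outside resets the state is the
deviation itself. The cost is then a quadratic form in the noise, bounded through `exists_deviation`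
and `cost_le`; in reset rounds the form is still nonnegative. -/
theorem lintegral_regularCost_le (hcert : F.S.IsCertificate ν F.oracle sol Z)
    (hQR : ∀ t, (F.Q t).PosSemidef ∧ (F.R t).PosSemidef) (hW : F.S.W.PosSemidef)
    (p : PertVec d k) (c : ℕ → unitInterval) (t : ℕ) :
    ∫⁻ w, ENNReal.ofReal (F.regularCost t (p, c, w)) ∂F.S.noiseLaw ≤
      ENNReal.ofReal (sdpCost (F.Q t) (F.R t)
        (sol (symOf (F.leaderVec p c t).1) (symOf (F.leaderVec p c t).2))) := by
  obtain ⟨G, hG, hX⟩ := exists_deviation hcert hQR p c t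
  set K := F.vecOracle (F.leaderVec p c t) with hK
  set P := F.Q t + Kᵀ * F.R t * K with hP
  have hPp : P.PosSemidef := (hQR t).1.add (PosSemidef.conj' (hQR t).2 K)
  have hnn : ∀ w, 0 ≤ linearState G t w ⬝ᵥ (P *ᵥ linearState G t w) := fun w => by
    simpa using hPp.dotProduct_mulVec_nonneg (linearState G t w)
  have h1 : ∀ w, F.regularCost t (p, c, w) ≤ linearState G t w ⬝ᵥ (P *ᵥ linearState G t w) := by
    intro w
    rw [regularCost]
    split_ifs with h
    · exact hnn w
    · have h2 := hG w
      rw [resetTarget, if_neg h, sub_zero] at h2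
      rw [roundCost, control, if_neg h, stageCost_gain, gain_eq hQR, h2]
  refine (lintegral_mono fun w => ENNReal.ofReal_le_ofReal (h1 w)).trans ?_
  rw [← ofReal_integral_eq_lintegral_ofReal (integrable_quadratic P G t)
    (Filter.Eventually.of_forall hnn), integral_quadratic hW]
  refine ENNReal.ofReal_le_ofReal ((frob_mono_right hPp hX).trans ?_)
  exact hcert.cost_le _ _ (symOf_isSymm _) (symOf_isSymm _) _ _ (hQR t).1 (hQR t).2

/-- Every round lies outside resets, or in a reset that was triggered by an earlier switch. -/
theorem age_eq (F : FLL d k) (ω : Sample d k) (t : ℕ) :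
    F.plan.len ≤ (F.mem ω t).age ∨
      ∃ s < t, F.Switch s ω ∧ (F.mem ω t).age = t - (s + 1) := by
  induction t with
  | zero => exact Or.inl le_rfl
  | succ t ih =>
    by_cases hs : F.Switch t ω
    · refine Or.inr ⟨t, Nat.lt_succ_self t, hs, ?_⟩
      simp [mem, if_pos hs]
    · have hage : (F.mem ω (t + 1)).age = (F.mem ω t).age + 1 := by
        simp [mem, if_neg hs]
      rcases ih with h | ⟨s, hst, h1, h2⟩
      · left
        omega
      · right
        exact ⟨s, hst.trans (Nat.lt_succ_self t), h1, by omega⟩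

theorem roundCost_nonneg (hQR : ∀ t, (F.Q t).PosSemidef ∧ (F.R t).PosSemidef) (t : ℕ)
    (ω : Sample d k) : 0 ≤ F.roundCost t ω :=
  stageCost_nonneg (hQR t).1 (hQR t).2 _ _

-- A round inside a reset is charged to the switch supplied by `age_eq`; all other terms of the
-- double sum are nonnegative. Exchanging the two sums produces the reset costs.
open scoped Classical in
theorem totalCost_le (hQR : ∀ t, (F.Q t).PosSemidef ∧ (F.R t).PosSemidef) (T : ℕ)
    (ω : Sample d k) :
    F.totalCost T ω ≤ ∑ t ∈ Finset.range T, F.regularCost t ω +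
      ∑ s ∈ Finset.range T, if F.Switch s ω then F.resetCost T s ω else 0 := by
  have hnn := roundCost_nonneg hQR
  have h1 : ∀ t ∈ Finset.range T, F.roundCost t ω ≤ F.regularCost t ω +
      ∑ s ∈ Finset.range T, if F.Switch s ω ∧ s < t ∧ (F.mem ω t).age = t - (s + 1) ∧
        (F.mem ω t).age < F.plan.len then F.roundCost t ω else 0 := by
    intro t ht
    have hsum : ∀ s ∈ Finset.range T, 0 ≤ if F.Switch s ω ∧ s < t ∧
        (F.mem ω t).age = t - (s + 1) ∧ (F.mem ω t).age < F.plan.len then F.roundCost t ω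
        else 0 := by
      intro s _
      split_ifs
      exacts [hnn t ω, le_rfl]
    by_cases h : (F.mem ω t).age < F.plan.len
    · rw [regularCost, if_pos h, zero_add]
      obtain h' | ⟨s, hst, hs, ha⟩ := F.age_eq ω t
      · exact absurd h (not_lt.mpr h')
      · refine le_trans ?_ (Finset.single_le_sum hsum
          (Finset.mem_range.mpr (hst.trans (Finset.mem_range.mp ht))))
        rw [if_pos ⟨hs, hst, ha, h⟩]
    · rw [regularCost, if_neg h]
      exact le_add_of_nonneg_right (Finset.sum_nonneg hsum)
  refine (Finset.sum_le_sum h1).trans ?_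
  rw [Finset.sum_add_distrib, Finset.sum_comm]
  refine add_le_add_right (Finset.sum_le_sum fun s _ => ?_) _
  by_cases hs : F.Switch s ω
  · rw [if_pos hs, resetCost, ← Finset.sum_filter, ← Finset.sum_filter]
    refine le_of_eq (Finset.sum_congr ?_ fun _ _ => rfl)
    ext t
    simp only [Finset.mem_filter, Finset.mem_range, Finset.mem_Ico, hs, true_and, Nat.succ_le_iff]
    tauto
  · simp [hs]

end Deviation

end FLL

end OnlineLQ

namespace OnlineLQ

/-! ### Measurability of the run -/

namespace FLL

variable {d k : ℕ} {F : FLL d k}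

theorem measurable_keep (t : ℕ) : Measurable (F.keep t) :=
  measurable_keepProb _

theorem keep_nonneg (hη : 0 < F.η) (t : ℕ) (p : PertVec d k) : 0 ≤ F.keep t p :=
  keepProb_nonneg hη _ _

theorem keep_le_one (t : ℕ) (p : PertVec d k) : F.keep t p ≤ 1 :=
  keepProb_le_one _ _ _

theorem measurableSet_keep (t : ℕ) :
    MeasurableSet {x : PertVec d k × unitInterval | (x.2 : ℝ) ≤ F.keep t x.1} :=
  measurableSet_le (measurable_subtype_coe.comp measurable_snd)
    ((measurable_keep t).comp measurable_fst)

theorem measurable_pertVec (F : FLL d k) (t : ℕ) :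
    Measurable fun θ : PertVec d k × (ℕ → unitInterval) => F.pertVec θ.1 θ.2 t := by
  induction t with
  | zero => exact measurable_fst
  | succ t ih =>
    simp only [pertVec]
    refine Measurable.ite ?_ (ih.sub_const _) ih.neg
    exact (ih.prodMk ((measurable_pi_apply t).comp measurable_snd)) (measurableSet_keep t)

theorem measurable_pertVec_sample (F : FLL d k) (t : ℕ) :
    Measurable fun ω : Sample d k => F.pertVec ω.1 ω.2.1 t :=
  (measurable_pertVec F t).comp
    (measurable_fst.prodMk (measurable_fst.comp measurable_snd))

theorem measurableSet_switch (hQR : ∀ t, (F.Q t).PosSemidef ∧ (F.R t).PosSemidef) (t : ℕ) :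
    MeasurableSet {ω | F.Switch t ω} := by
  simp only [switch_iff hQR]
  exact (((measurable_pertVec_sample F t).prodMk
    ((measurable_pi_apply t).comp (measurable_fst.comp measurable_snd)))
    (measurableSet_keep t)).compl

theorem measurable_vecOracle (ho : MeasurableOracle F.oracle) (i : Fin k) (j : Fin d) :
    Measurable fun z : PertVec d k => F.vecOracle z i j := by
  have h : Measurable fun z : PertVec d k =>
      ((fun a b => symOf z.1 a b : Fin d → Fin d → ℝ), (fun a b => symOf z.2 a b :
        Fin k → Fin k → ℝ)) := by
    refine Measurable.prodMk ?_ ?_ <;> refine measurable_pi_lambda _ fun a =>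
      measurable_pi_lambda _ fun b => ?_
    · exact (measurable_symOf a b).comp measurable_fst
    · exact (measurable_symOf a b).comp measurable_snd
  exact (ho i j).comp h

theorem measurable_gain (ho : MeasurableOracle F.oracle)
    (hQR : ∀ t, (F.Q t).PosSemidef ∧ (F.R t).PosSemidef) (t : ℕ) (i : Fin k) (j : Fin d) :
    Measurable fun ω : Sample d k => F.gain ω t i j := by
  simp only [gain_eq hQR]
  exact (measurable_vecOracle ho i j).comp ((measurable_pertVec_sample F t).const_add _)

theorem measurable_matrix_mulVec {X : Type*} [MeasurableSpace X] {m n : Type*} [Fintype n]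
    {M : X → Matrix m n ℝ} {v : X → n → ℝ} (hM : ∀ i j, Measurable fun x => M x i j)
    (hv : Measurable v) : Measurable fun x => M x *ᵥ v x := by
  refine measurable_pi_lambda _ fun i => ?_
  simp only [mulVec, dotProduct]
  exact Finset.measurable_sum _ fun j _ => (hM i j).mul ((measurable_pi_apply j).comp hv)

theorem measurable_driven (F : FLL d k) (j : ℕ) : Measurable (F.S.driven F.plan.v j) := by
  induction j with
  | zero => exact measurable_id
  | succ j ih =>
    exact (measurable_matrix_mulVec (M := fun _ => F.S.A) (fun _ _ => measurable_const) ih).add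
      (measurable_matrix_mulVec (M := fun _ => F.S.B) (fun _ _ => measurable_const)
        (F.plan.measurable_v j))

theorem measurable_eval_nat {X Y Z : Type*} [MeasurableSpace X] [MeasurableSpace Y]
    [MeasurableSpace Z] {f : ℕ → Y → Z} (hf : ∀ n, Measurable (f n)) {a : X → ℕ} {y : X → Y}
    (ha : Measurable a) (hy : Measurable y) : Measurable fun x => f (a x) (y x) :=
  (measurable_from_prod_countable_right (f := fun p : ℕ × Y => f p.1 p.2) hf).comp
    (ha.prodMk hy)

theorem measurable_control {X : Type*} [MeasurableSpace X] {K : X → Matrix (Fin k) (Fin d) ℝ}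
    {s : X → Memory d} (hK : ∀ i j, Measurable fun ω => K ω i j)
    (h1 : Measurable fun ω => (s ω).x) (h2 : Measurable fun ω => (s ω).anchor)
    (h3 : Measurable fun ω => (s ω).age) : Measurable fun ω => F.control (K ω) (s ω) := by
  unfold control
  refine Measurable.ite (h3 measurableSet_Iio) (Measurable.add ?_ ?_)
    (measurable_matrix_mulVec hK h1)
  · exact measurable_eval_nat F.plan.measurable_v h3 h2
  · exact measurable_matrix_mulVec hK (h1.sub (measurable_eval_nat (measurable_driven F) h3 h2))

theorem measurable_mem (ho : MeasurableOracle F.oracle)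
    (hQR : ∀ t, (F.Q t).PosSemidef ∧ (F.R t).PosSemidef) (t : ℕ) :
    (Measurable fun ω => (F.mem ω t).x) ∧ (Measurable fun ω => (F.mem ω t).anchor) ∧
      Measurable fun ω => (F.mem ω t).age := by
  induction t with
  | zero => exact ⟨measurable_const, measurable_const, measurable_const⟩
  | succ t ih =>
    obtain ⟨h1, h2, h3⟩ := ih
    have hx : Measurable fun ω : Sample d k =>
        F.S.next (F.mem ω t).x (F.control (F.gain ω t) (F.mem ω t)) (ω.2.2 t) := by
      refine Measurable.add (Measurable.add ?_ ?_) ?_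
      · exact measurable_matrix_mulVec (fun _ _ => measurable_const) h1
      · exact measurable_matrix_mulVec (fun _ _ => measurable_const)
          (measurable_control (measurable_gain ho hQR t) h1 h2 h3)
      · fun_prop
    have hs := measurableSet_switch hQR t
    refine ⟨?_, ?_, ?_⟩
    · refine (congrArg Measurable (funext fun ω => ?_)).mp hx
      simp only [mem]
      split_ifs <;> rfl
    · refine (congrArg Measurable (funext fun ω => ?_)).mp
        (@Measurable.ite _ _ _ _ _ _ _ (Classical.decPred _) hs hx h2)
      simp only [mem]
      split_ifs <;> rfl
    · refine (congrArg Measurable (funext fun ω => ?_)).mp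
        (@Measurable.ite _ _ _ _ _ _ _ (Classical.decPred _) hs (measurable_const (a := 0))
          (h3.add_const 1))
      simp only [mem]
      split_ifs <;> rfl

theorem measurable_dotProduct {X : Type*} [MeasurableSpace X] {n : Type*} [Fintype n]
    {u v : X → n → ℝ} (hu : Measurable u) (hv : Measurable v) :
    Measurable fun x => u x ⬝ᵥ v x := by
  simp only [dotProduct]
  exact Finset.measurable_sum _ fun j _ =>
    ((measurable_pi_apply j).comp hu).mul ((measurable_pi_apply j).comp hv)

theorem measurable_roundCost (ho : MeasurableOracle F.oracle)
    (hQR : ∀ t, (F.Q t).PosSemidef ∧ (F.R t).PosSemidef) (t : ℕ) :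
    Measurable (F.roundCost t) := by
  obtain ⟨h1, h2, h3⟩ := measurable_mem ho hQR t
  have hu := measurable_control (F := F) (measurable_gain ho hQR t) h1 h2 h3
  have h4 := measurable_dotProduct h1
    (measurable_matrix_mulVec (M := fun _ => F.Q t) (fun _ _ => measurable_const) h1)
  have h5 := measurable_dotProduct hu
    (measurable_matrix_mulVec (M := fun _ => F.R t) (fun _ _ => measurable_const) hu)
  unfold roundCost stageCost
  exact h4.add h5

theorem measurable_regularCost (ho : MeasurableOracle F.oracle)
    (hQR : ∀ t, (F.Q t).PosSemidef ∧ (F.R t).PosSemidef) (t : ℕ) :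
    Measurable (F.regularCost t) := by
  unfold regularCost
  exact Measurable.ite ((measurable_mem ho hQR t).2.2 measurableSet_Iio) measurable_const
    (measurable_roundCost ho hQR t)

theorem measurable_resetCost (ho : MeasurableOracle F.oracle)
    (hQR : ∀ t, (F.Q t).PosSemidef ∧ (F.R t).PosSemidef) (T s : ℕ) :
    Measurable (F.resetCost T s) := by
  unfold resetCost
  refine Finset.measurable_fun_sum _ fun t _ => Measurable.ite ?_ (measurable_roundCost ho hQR t)
    measurable_const
  have h := (measurable_mem ho hQR t).2.2
  exact (h (measurableSet_singleton (t - (s + 1)))).inter (h measurableSet_Iio)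

end FLL

/-! ### Stationarity of the perturbations -/

namespace FLL

variable {d k : ℕ} {F : FLL d k}

theorem isNegInvariant_prod {X Y : Type*} [MeasurableSpace X] [MeasurableSpace Y] [Neg X] [Neg Y]
    [MeasurableNeg X] [MeasurableNeg Y] (μ : Measure X) (ν : Measure Y) [SFinite μ] [SFinite ν]
    [μ.IsNegInvariant] [ν.IsNegInvariant] : (μ.prod ν).IsNegInvariant := by
  refine ⟨?_⟩
  have h := Measure.map_prod_map μ ν measurable_neg measurable_neg
  rw [show Measure.map Neg.neg μ = μ from Measure.neg_eq_self μ,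
    show Measure.map Neg.neg ν = ν from Measure.neg_eq_self ν] at h
  exact h.symm

/-- The perturbation of round `t` is determined by the coins of rounds before `t`. -/
theorem pertVec_update (F : FLL d k) (p : PertVec d k) (c : ℕ → unitInterval) (s : ℕ)
    (u : unitInterval) {t : ℕ} (h : t ≤ s) :
    F.pertVec p (Function.update c s u) t = F.pertVec p c t := by
  induction t with
  | zero => rfl
  | succ t ih =>
    simp only [pertVec, ih (Nat.le_of_succ_le h), Function.update_of_ne (Nat.ne_of_lt h)]

/-- The coin of round `t` is independent of the perturbation of round `t`. Stationarity at `t` is a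
hypothesis because the inductive proof of stationarity itself uses this lemma. -/
theorem lintegral_pertVec_coin (hη : 0 < F.η) (t : ℕ)
    (hstat : ∀ f : PertVec d k → ENNReal, Measurable f →
      ∫⁻ θ, f (F.pertVec θ.1 θ.2 t) ∂(pertLaw d k F.η).prod coinLaw = ∫⁻ p, f p ∂pertLaw d k F.η)
    {g : PertVec d k × unitInterval → ENNReal} (hg : Measurable g) :
    ∫⁻ θ, g (F.pertVec θ.1 θ.2 t, θ.2 t) ∂(pertLaw d k F.η).prod coinLaw =
      ∫⁻ p, (∫⁻ u, g (p, u)) ∂pertLaw d k F.η := by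
  have hp := isProbabilityMeasure_pertLaw (d := d) (k := k) hη
  have hm := measurable_pertVec F t
  have hm1 : ∀ p, Measurable fun c => F.pertVec p c t := fun p =>
    hm.comp (measurable_const.prodMk measurable_id)
  rw [← hstat (fun p => ∫⁻ u, g (p, u)) hg.lintegral_prod_right',
    lintegral_prod (fun θ : PertVec d k × (ℕ → unitInterval) => g (F.pertVec θ.1 θ.2 t, θ.2 t))
      (hg.comp (hm.prodMk ((measurable_pi_apply t).comp measurable_snd))).aemeasurable,
    lintegral_prod (fun θ : PertVec d k × (ℕ → unitInterval) => ∫⁻ u, g (F.pertVec θ.1 θ.2 t, u))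
      (hg.lintegral_prod_right'.comp hm).aemeasurable]
  refine lintegral_congr fun p => ?_
  have hG : Measurable fun c : ℕ → unitInterval => g (F.pertVec p c t, c t) :=
    hg.comp ((hm1 p).prodMk (measurable_pi_apply t))
  have h1 := (measurePreserving_update (volume : Measure unitInterval) t).lintegral_comp hG
  simp only [coinLaw]
  rw [← h1]
  simp only [pertVec_update F p _ t _ le_rfl, Function.update_self]
  rw [lintegral_prod]
  exact (hg.comp (((hm1 p).comp measurable_fst).prodMk measurable_snd)).aemeasurable

/-- Averaging over the coin turns one transition into the kernel of `lintegral_lazy`. Only the law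
in each single round is needed; the dependence between rounds never matters. -/
theorem lintegral_pertVec (hη : 0 < F.η) (t : ℕ) {f : PertVec d k → ENNReal} (hf : Measurable f) :
    ∫⁻ θ, f (F.pertVec θ.1 θ.2 t) ∂(pertLaw d k F.η).prod coinLaw = ∫⁻ p, f p ∂pertLaw d k F.η := by
  classical
  have hp := isProbabilityMeasure_pertLaw (d := d) (k := k) hη
  induction t generalizing f with
  | zero =>
    exact (measurePreserving_fst (μ := pertLaw d k F.η) (ν := coinLaw)).lintegral_comp hf
  | succ t ih =>
    set g : PertVec d k × unitInterval → ENNReal := fun x =>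
      if (x.2 : ℝ) ≤ F.keep t x.1 then f (x.1 - F.costVec t) else f (-x.1) with hg
    have hgm : Measurable g := Measurable.ite (measurableSet_keep t)
      (hf.comp (measurable_fst.sub_const _)) (hf.comp measurable_fst.neg)
    have h1 : ∀ θ : PertVec d k × (ℕ → unitInterval), f (F.pertVec θ.1 θ.2 (t + 1)) =
        g (F.pertVec θ.1 θ.2 t, θ.2 t) := by
      intro θ
      simp only [pertVec, hg]
      split_ifs <;> rfl
    simp only [h1]
    rw [lintegral_pertVec_coin hη t (fun f hf => ih hf) hgm]
    simp only [hg, lintegral_coin (keep_nonneg hη t _) (keep_le_one t _)]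
    rw [pertLaw_eq hη]
    have := Measure.prod.instIsAddHaarMeasure (volume : Measure (UpperIdx d → ℝ))
      (volume : Measure (UpperIdx k → ℝ))
    have := isNegInvariant_prod (volume : Measure (UpperIdx d → ℝ))
      (volume : Measure (UpperIdx k → ℝ))
    exact lintegral_lazy ((volume : Measure (UpperIdx d → ℝ)).prod
      (volume : Measure (UpperIdx k → ℝ))) measurable_pertVecDensity (pertVecDensity_pos hη)
      (pertVecDensity_neg F.η) (F.costVec t) hf

theorem law_eq (F : FLL d k) : F.law = (pertLaw d k F.η).prod (coinLaw.prod F.S.noiseLaw) := rfl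

theorem lintegral_law (hη : 0 < F.η) {f : Sample d k → ENNReal} (hf : Measurable f) :
    ∫⁻ ω, f ω ∂F.law = ∫⁻ θ, ∫⁻ w, f (θ.1, θ.2, w) ∂F.S.noiseLaw
      ∂(pertLaw d k F.η).prod coinLaw := by
  have hp := isProbabilityMeasure_pertLaw (d := d) (k := k) hη
  have h1 : Measurable fun x : (PertVec d k × (ℕ → unitInterval)) ×
      (ℕ → EuclideanSpace ℝ (Fin d)) => f (x.1.1, x.1.2, x.2) :=
    hf.comp ((measurable_fst.comp measurable_fst).prodMk
      ((measurable_snd.comp measurable_fst).prodMk measurable_snd))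
  rw [law_eq, lintegral_prod _ hf.aemeasurable,
    lintegral_prod _ h1.lintegral_prod_right'.aemeasurable]
  refine lintegral_congr fun p => ?_
  exact lintegral_prod (fun y => f (p, y))
    (hf.comp (measurable_const.prodMk measurable_id)).aemeasurable

/-- By stationarity a switch is as likely as for a fresh perturbation, and the Frobenius norm of
each cost matrix is at most its trace, hence at most `C`. -/
theorem law_switch_le {C : ℝ} (hη : 0 < F.η) (hC : 0 < C)
    (hQR : ∀ t, (F.Q t).PosSemidef ∧ (F.R t).PosSemidef)
    (htr : ∀ t, (F.Q t).trace ≤ C ∧ (F.R t).trace ≤ C) (t : ℕ) :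
    F.law {ω | F.Switch t ω} ≤ ENNReal.ofReal (3 * (F.η * C)) := by
  classical
  have hs := measurableSet_switch hQR t
  set g : PertVec d k × unitInterval → ENNReal := fun x =>
      if (x.2 : ℝ) ≤ F.keep t x.1 then 0 else 1 with hg
  have hgm : Measurable g := Measurable.ite (measurableSet_keep t) measurable_const measurable_const
  rw [← lintegral_indicator_one hs, lintegral_law hη (measurable_one.indicator hs)]
  have h1 : ∀ θ : PertVec d k × (ℕ → unitInterval),
      ∫⁻ w, {ω | F.Switch t ω}.indicator (1 : Sample d k → ENNReal) (θ.1, θ.2, w) ∂F.S.noiseLaw =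
        g (F.pertVec θ.1 θ.2 t, θ.2 t) := by
    intro θ
    have h2 : ∀ w, {ω | F.Switch t ω}.indicator (1 : Sample d k → ENNReal) (θ.1, θ.2, w) =
        g (F.pertVec θ.1 θ.2 t, θ.2 t) := by
      intro w
      simp only [Set.indicator, Set.mem_ofPred_eq, switch_iff hQR, hg, ite_not, Pi.one_apply]
    simp [h2]
  simp only [h1]
  rw [lintegral_pertVec_coin hη t (fun f hf => lintegral_pertVec hη t hf) hgm]
  simp only [hg, lintegral_coin (keep_nonneg hη t _) (keep_le_one t _), mul_zero, mul_one, zero_add]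
  exact lintegral_one_sub_keepProb_le hη hC (F.costVec t) (sum_sq_upper_le (hQR t).1 (htr t).1)
    (sum_sq_upper_le (hQR t).2 (htr t).2)

end FLL

end OnlineLQ

namespace OnlineLQ

/-! ### The value of the perturbed leader -/

section Value

variable {d k : ℕ}

/-- The linear cost of `Z` for the cost matrices with the given upper triangles. -/
noncomputable def vecCost (z : PertVec d k) (Z : Matrix (Fin d ⊕ Fin k) (Fin d ⊕ Fin k) ℝ) : ℝ :=
  sdpCost (symOf z.1) (symOf z.2) Z

theorem vecCost_add (y z : PertVec d k) (Z : Matrix (Fin d ⊕ Fin k) (Fin d ⊕ Fin k) ℝ) :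
    vecCost (y + z) Z = vecCost y Z + vecCost z Z := by
  rw [vecCost, Prod.fst_add, Prod.snd_add, symOf_add, symOf_add, sdpCost_add]
  rfl

theorem abs_vecCost_le (z : PertVec d k) {Z : Matrix (Fin d ⊕ Fin k) (Fin d ⊕ Fin k) ℝ}
    (hZ : Z.PosSemidef) {ν : ℝ} (hν : trace Z ≤ ν) : |vecCost z Z| ≤ pertNorm z * ν :=
  (abs_sdpCost_le _ _ hZ).trans (mul_le_mul_of_nonneg_left hν (Real.sqrt_nonneg _))

theorem continuous_pertNorm : Continuous (pertNorm : PertVec d k → ℝ) := by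
  have h : ∀ {n : ℕ} (i j : Fin n), Continuous fun q : UpperIdx n → ℝ => symOf q i j := by
    intro n i j
    by_cases h : i ≤ j <;> simp only [symOf, of_apply, h, dite_true, dite_false] <;> fun_prop
  unfold pertNorm
  refine Continuous.sqrt (Continuous.add ?_ ?_)
  · exact continuous_finsetSum _ fun i _ => continuous_finsetSum _ fun j _ =>
      ((h i j).comp continuous_fst).pow 2
  · exact continuous_finsetSum _ fun i _ => continuous_finsetSum _ fun j _ =>
      ((h i j).comp continuous_snd).pow 2

theorem pertNorm_zero : pertNorm (0 : PertVec d k) = 0 := by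
  simp [pertNorm, symOf]

/-- The minimum of the linear cost attained by `sol`. -/
noncomputable def value
    (sol : Matrix (Fin d) (Fin d) ℝ → Matrix (Fin k) (Fin k) ℝ →
      Matrix (Fin d ⊕ Fin k) (Fin d ⊕ Fin k) ℝ) (z : PertVec d k) : ℝ :=
  vecCost z (sol (symOf z.1) (symOf z.2))

variable {S : LQSystem d k} {ν : ℝ}
  {oracle : Matrix (Fin d) (Fin d) ℝ → Matrix (Fin k) (Fin k) ℝ → Matrix (Fin k) (Fin d) ℝ}
  {sol : Matrix (Fin d) (Fin d) ℝ → Matrix (Fin k) (Fin k) ℝ →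
    Matrix (Fin d ⊕ Fin k) (Fin d ⊕ Fin k) ℝ}
  {Z : Matrix (Fin d ⊕ Fin k) (Fin d ⊕ Fin k) ℝ}

/-- The minimizer at `z` is a candidate at `z + y`. Together with the reverse comparison in
`le_value_add`, this encloses the growth of the value between the costs of the two minimizers. -/
theorem value_add_le (hcert : S.IsCertificate ν oracle sol Z) (z y : PertVec d k) :
    value sol (z + y) ≤ value sol z + vecCost y (sol (symOf z.1) (symOf z.2)) := by
  rw [value, value, ← vecCost_add]
  exact hcert.minimal _ _ (symOf_isSymm _) (symOf_isSymm _) _ _ (symOf_isSymm _) (symOf_isSymm _)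

theorem le_value_add (hcert : S.IsCertificate ν oracle sol Z) (z y : PertVec d k) :
    value sol z + vecCost y (sol (symOf (z + y).1) (symOf (z + y).2)) ≤ value sol (z + y) := by
  rw [value, value, vecCost_add]
  refine add_le_add_left ?_ _
  exact hcert.minimal _ _ (symOf_isSymm _) (symOf_isSymm _) _ _ (symOf_isSymm _) (symOf_isSymm _)

theorem abs_vecCost_sol_le (hcert : S.IsCertificate ν oracle sol Z) (y z : PertVec d k) :
    |vecCost y (sol (symOf z.1) (symOf z.2))| ≤ pertNorm y * ν :=
  abs_vecCost_le y (hcert.posSemidef _ _ (symOf_isSymm _) (symOf_isSymm _))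
    (hcert.trace_le _ _ (symOf_isSymm _) (symOf_isSymm _))

/-- The value is `ν`-Lipschitz in `pertNorm`. Continuity gives its measurability, although a
certificate `sol` need not be measurable. -/
theorem continuous_value (hcert : S.IsCertificate ν oracle sol Z) : Continuous (value sol) := by
  rw [continuous_iff_continuousAt]
  intro z
  have h : Filter.Tendsto (fun y => pertNorm (y - z) * ν) (nhds z) (nhds 0) := by
    have hc : Continuous fun y => pertNorm (y - z) * ν :=
      (continuous_pertNorm.comp (continuous_sub_right z)).mul continuous_const
    simpa [pertNorm_zero] using hc.tendsto z
  rw [ContinuousAt, tendsto_iff_dist_tendsto_zero]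
  refine squeeze_zero (fun _ => dist_nonneg) (fun y => ?_) h
  have h1 := value_add_le hcert z (y - z)
  have h2 := le_value_add hcert z (y - z)
  rw [add_sub_cancel] at h1 h2
  have h3 := abs_le.mp (abs_vecCost_sol_le hcert (y - z) z)
  have h4 := abs_le.mp (abs_vecCost_sol_le hcert (y - z) y)
  rw [Real.dist_eq, abs_le]
  constructor <;> linarith

end Value

/-! ### Expected cost of Follow the Lazy Leader -/

namespace FLL

variable {d k : ℕ} {F : FLL d k} {ν C : ℝ}
  {sol : Matrix (Fin d) (Fin d) ℝ → Matrix (Fin k) (Fin k) ℝ →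
    Matrix (Fin d ⊕ Fin k) (Fin d ⊕ Fin k) ℝ}
  {Z : Matrix (Fin d ⊕ Fin k) (Fin d ⊕ Fin k) ℝ}

theorem vecCost_costVec (hQR : ∀ t, (F.Q t).PosSemidef ∧ (F.R t).PosSemidef) (t : ℕ)
    (Z : Matrix (Fin d ⊕ Fin k) (Fin d ⊕ Fin k) ℝ) :
    vecCost (F.costVec t) Z = sdpCost (F.Q t) (F.R t) Z := by
  rw [vecCost, (symOf_costVec hQR t).1, (symOf_costVec hQR t).2]

theorem vecCost_sumVec (hQR : ∀ t, (F.Q t).PosSemidef ∧ (F.R t).PosSemidef) (T : ℕ)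
    (Z : Matrix (Fin d ⊕ Fin k) (Fin d ⊕ Fin k) ℝ) :
    vecCost (F.sumVec T) Z = ∑ t ∈ Finset.range T, sdpCost (F.Q t) (F.R t) Z := by
  induction T with
  | zero => simp [vecCost, sumVec, symOf, sdpCost_eq, frob_eq_sum]
  | succ T ih =>
    rw [sumVec_succ, vecCost_add, ih, vecCost_costVec hQR, Finset.sum_range_succ]

/-- The growth of the value in round `t`. -/
noncomputable def gap (F : FLL d k)
    (sol : Matrix (Fin d) (Fin d) ℝ → Matrix (Fin k) (Fin k) ℝ →
      Matrix (Fin d ⊕ Fin k) (Fin d ⊕ Fin k) ℝ) (t : ℕ) (p : PertVec d k) : ℝ :=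
  value sol (F.sumVec (t + 1) + p) - value sol (F.sumVec t + p)

theorem measurable_gap (hcert : F.S.IsCertificate ν F.oracle sol Z) (t : ℕ) :
    Measurable (F.gap sol t) :=
  ((continuous_value hcert).measurable.comp (measurable_const_add _)).sub
    ((continuous_value hcert).measurable.comp (measurable_const_add _))

theorem sol_cost_bounds (hcert : F.S.IsCertificate ν F.oracle sol Z) (hC : 0 ≤ C)
    (hQR : ∀ t, (F.Q t).PosSemidef ∧ (F.R t).PosSemidef)
    (htr : ∀ t, (F.Q t).trace ≤ C ∧ (F.R t).trace ≤ C) (t : ℕ) (z : PertVec d k) :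
    0 ≤ sdpCost (F.Q t) (F.R t) (sol (symOf z.1) (symOf z.2)) ∧
      sdpCost (F.Q t) (F.R t) (sol (symOf z.1) (symOf z.2)) ≤ C * ν := by
  have hp := hcert.posSemidef _ _ (symOf_isSymm z.1) (symOf_isSymm z.2)
  exact ⟨sdpCost_nonneg (hQR t).1 (hQR t).2 hp, sdpCost_le (hQR t).1 (hQR t).2 hp hC (htr t).1
    (htr t).2 (hcert.trace_le _ _ (symOf_isSymm _) (symOf_isSymm _))⟩

/-- The be-the-leader inequality: the leader that already knows the cost of round `t` pays at most
the growth of the value. -/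
theorem le_gap (hcert : F.S.IsCertificate ν F.oracle sol Z)
    (hQR : ∀ t, (F.Q t).PosSemidef ∧ (F.R t).PosSemidef) (t : ℕ) (p : PertVec d k) :
    sdpCost (F.Q t) (F.R t)
      (sol (symOf (F.sumVec (t + 1) + p).1) (symOf (F.sumVec (t + 1) + p).2)) ≤ F.gap sol t p := by
  have h := le_value_add hcert (F.sumVec t + p) (F.costVec t)
  rw [add_right_comm, ← sumVec_succ, vecCost_costVec hQR] at h
  rw [gap]
  linarith

/-- Serves to bound `gap` by `Cν`, which gives its integrability. -/
theorem gap_le (hcert : F.S.IsCertificate ν F.oracle sol Z)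
    (hQR : ∀ t, (F.Q t).PosSemidef ∧ (F.R t).PosSemidef) (t : ℕ) (p : PertVec d k) :
    F.gap sol t p ≤ sdpCost (F.Q t) (F.R t)
      (sol (symOf (F.sumVec t + p).1) (symOf (F.sumVec t + p).2)) := by
  have h := value_add_le hcert (F.sumVec t + p) (F.costVec t)
  rw [add_right_comm, ← sumVec_succ, vecCost_costVec hQR] at h
  rw [gap]
  linarith

/-- If the leader is kept, the gain in use in round `t` already belongs to the next leader, so
`le_gap` applies; on a switch the crude bound `Cν` is used. -/
theorem lintegral_regularCost_law_le (hcert : F.S.IsCertificate ν F.oracle sol Z)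
    (ho : MeasurableOracle F.oracle) (hη : 0 < F.η) (hC : 0 ≤ C)
    (hQR : ∀ t, (F.Q t).PosSemidef ∧ (F.R t).PosSemidef)
    (htr : ∀ t, (F.Q t).trace ≤ C ∧ (F.R t).trace ≤ C) (hW : F.S.W.PosSemidef) (t : ℕ) :
    ∫⁻ ω, ENNReal.ofReal (F.regularCost t ω) ∂F.law ≤
      ENNReal.ofReal (∫ p, F.gap sol t p ∂pertLaw d k F.η) +
        ENNReal.ofReal (C * ν) * F.law {ω | F.Switch t ω} := by
  have hp := isProbabilityMeasure_pertLaw (d := d) (k := k) hη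
  have hs := measurableSet_switch hQR t
  have hgm := measurable_gap hcert t
  have hg0 : ∀ p, 0 ≤ F.gap sol t p := fun p =>
    (sol_cost_bounds hcert hC hQR htr t _).1.trans (le_gap hcert hQR t p)
  have hgi : Integrable (F.gap sol t) (pertLaw d k F.η) :=
    Integrable.of_bound hgm.aestronglyMeasurable (C * ν) (Filter.Eventually.of_forall fun p => by
      rw [Real.norm_of_nonneg (hg0 p)]
      exact (gap_le hcert hQR t p).trans (sol_cost_bounds hcert hC hQR htr t _).2)
  -- The mean of `gap` is rewritten with the perturbation of round `t + 1`, not `t`: a kept leader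
  -- equals `F.sumVec (t + 1)` plus that perturbation.
  rw [lintegral_law hη (measurable_regularCost ho hQR t).ennreal_ofReal,
    ofReal_integral_eq_lintegral_ofReal hgi (Filter.Eventually.of_forall hg0),
    ← lintegral_pertVec hη (t + 1) hgm.ennreal_ofReal, ← lintegral_indicator_one hs,
    lintegral_law hη (measurable_one.indicator hs), ← lintegral_const_mul', ← lintegral_add_left]
  · refine lintegral_mono fun θ => ?_
    refine (lintegral_regularCost_le hcert hQR hW θ.1 θ.2 t).trans ?_
    by_cases hk : (θ.2 t : ℝ) ≤ F.keep t (F.pertVec θ.1 θ.2 t)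
    · refine le_trans (ENNReal.ofReal_le_ofReal ?_) le_self_add
      rw [← leaderVec_succ_of_keep hk]
      exact le_gap hcert hQR t _
    · have h1 : ∀ w, {ω | F.Switch t ω}.indicator (1 : Sample d k → ENNReal) (θ.1, θ.2, w) = 1 := by
        intro w
        exact Set.indicator_of_mem (s := {ω | F.Switch t ω}) ((switch_iff hQR _ _).mpr hk) _
      simp only [h1, lintegral_const, measure_univ, mul_one]
      exact (ENNReal.ofReal_le_ofReal (sol_cost_bounds hcert hC hQR htr t _).2).trans le_add_self
  · exact (hgm.comp (measurable_pertVec F (t + 1))).ennreal_ofReal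
  · exact ENNReal.ofReal_ne_top

/-- All growths are integrated against one law, so they telescope for each `p`. What remains is the
value at the end, compared with `Z`, minus the value at `p`; each costs at most `ν` times the norm
of `p`. -/
theorem sum_integral_gap_le (hcert : F.S.IsCertificate ν F.oracle sol Z) (hη : 0 < F.η)
    (hd : 0 < d) (hC : 0 ≤ C) (hν : 0 ≤ ν)
    (hQR : ∀ t, (F.Q t).PosSemidef ∧ (F.R t).PosSemidef)
    (htr : ∀ t, (F.Q t).trace ≤ C ∧ (F.R t).trace ≤ C) (hZ : Z.PosSemidef) (hZν : trace Z ≤ ν)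
    (T : ℕ) :
    ∑ t ∈ Finset.range T, ∫ p, F.gap sol t p ∂pertLaw d k F.η ≤
      ∑ t ∈ Finset.range T, sdpCost (F.Q t) (F.R t) Z +
        3 * (ν * ((d + k : ℕ) : ℝ) / F.η) := by
  have hp := isProbabilityMeasure_pertLaw (d := d) (k := k) hη
  have hgi : ∀ t, Integrable (F.gap sol t) (pertLaw d k F.η) := fun t =>
    Integrable.of_bound (measurable_gap hcert t).aestronglyMeasurable (C * ν)
      (Filter.Eventually.of_forall fun p => by
        rw [Real.norm_of_nonneg ((sol_cost_bounds hcert hC hQR htr t _).1.trans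
          (le_gap hcert hQR t p))]
        exact (gap_le hcert hQR t p).trans (sol_cost_bounds hcert hC hQR htr t _).2)
  obtain ⟨hni, hn⟩ := integral_pertNorm_le (k := k) hη hd
  rw [← integral_finsetSum _ fun t _ => hgi t]
  have hle : ∀ p, ∑ t ∈ Finset.range T, F.gap sol t p ≤
      vecCost (F.sumVec T) Z + 2 * ν * pertNorm p := by
    intro p
    simp only [gap]
    rw [Finset.sum_range_sub fun t => value sol (F.sumVec t + p)]
    have h0 : F.sumVec 0 = 0 := rfl
    have h1 : value sol (F.sumVec T + p) ≤ vecCost (F.sumVec T) Z + vecCost p Z := by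
      rw [← vecCost_add]
      exact hcert.minimal_star _ _ (symOf_isSymm _) (symOf_isSymm _)
    have h2 := abs_le.mp (abs_vecCost_le p hZ hZν)
    have h3 := abs_le.mp (abs_vecCost_sol_le hcert p p)
    rw [h0, zero_add]
    change _ - vecCost p _ ≤ _
    linarith
  have hbi : Integrable (fun p => vecCost (F.sumVec T) Z + 2 * ν * pertNorm p)
      (pertLaw d k F.η) := (integrable_const _).add (hni.const_mul _)
  refine (integral_mono (integrable_finsetSum _ fun t _ => hgi t) hbi hle).trans ?_
  rw [integral_add (integrable_const _) (hni.const_mul _), integral_const_mul,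
    ← vecCost_sumVec hQR T Z]
  simp only [integral_const, probReal_univ, one_smul]
  have h4 := mul_le_mul_of_nonneg_left hn (by positivity : 0 ≤ 2 * ν)
  have h5 : 2 * ν * (3 / 2 * ((d + k : ℕ) : ℝ) / F.η) = 3 * (ν * ((d + k : ℕ) : ℝ) / F.η) := by ring
  linarith

theorem integral_totalCost_le {Cr : ℝ} {T : ℕ} (hcert : F.S.IsCertificate ν F.oracle sol Z)
    (ho : MeasurableOracle F.oracle) (hη : 0 < F.η) (hd : 0 < d) (hC : 0 < C) (hν : 0 ≤ ν)
    (hCr : 0 ≤ Cr) (hQR : ∀ t, (F.Q t).PosSemidef ∧ (F.R t).PosSemidef)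
    (htr : ∀ t, (F.Q t).trace ≤ C ∧ (F.R t).trace ≤ C) (hW : F.S.W.PosSemidef)
    (hZ : Z.PosSemidef) (hZν : trace Z ≤ ν) (hreset : F.ResetCostAtMost T Cr) :
    Integrable (F.totalCost T) F.law ∧
    ∫ ω, F.totalCost T ω ∂F.law ≤ ∑ t ∈ Finset.range T, sdpCost (F.Q t) (F.R t) Z +
      3 * (ν * ((d + k : ℕ) : ℝ) / F.η) + 3 * (T * (F.η * C * (Cr + C * ν))) := by
  classical
  have hnn : ∀ ω, 0 ≤ F.totalCost T ω := fun ω =>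
    Finset.sum_nonneg fun t _ => roundCost_nonneg hQR t ω
  have hmeas : Measurable (F.totalCost T) := by
    unfold totalCost
    exact Finset.measurable_fun_sum _ fun t _ => measurable_roundCost ho hQR t
  have hreg : ∀ t ω, 0 ≤ F.regularCost t ω := by
    intro t ω
    rw [regularCost]
    split_ifs
    exacts [le_rfl, roundCost_nonneg hQR t ω]
  have hres : ∀ s ω, 0 ≤ F.resetCost T s ω := by
    intro s ω
    refine Finset.sum_nonneg fun t _ => ?_
    split_ifs
    exacts [roundCost_nonneg hQR t ω, le_rfl]
  have hgap0 : ∀ t, 0 ≤ ∫ p, F.gap sol t p ∂pertLaw d k F.η := fun t =>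
    integral_nonneg fun p =>
      (sol_cost_bounds hcert hC.le hQR htr t _).1.trans (le_gap hcert hQR t p)
  set b : ℝ := ∑ t ∈ Finset.range T, sdpCost (F.Q t) (F.R t) Z +
      3 * (ν * ((d + k : ℕ) : ℝ) / F.η) + 3 * (T * (F.η * C * (Cr + C * ν))) with hb
  have hb0 : 0 ≤ b := by
    have h1 : 0 ≤ ∑ t ∈ Finset.range T, sdpCost (F.Q t) (F.R t) Z :=
      Finset.sum_nonneg fun t _ => sdpCost_nonneg (hQR t).1 (hQR t).2 hZ
    positivity
  have hCν : 0 ≤ C * ν := mul_nonneg hC.le hν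
  have hq : 0 ≤ 3 * (F.η * C) := by positivity
  -- The bound is proved for the Lebesgue integral of the nonnegative cost, so that integrability is
  -- a consequence and not a prerequisite.
  have key : ∫⁻ ω, ENNReal.ofReal (F.totalCost T ω) ∂F.law ≤ ENNReal.ofReal b := by
    have h1 : ∀ ω, ENNReal.ofReal (F.totalCost T ω) ≤
        ∑ t ∈ Finset.range T, ENNReal.ofReal (F.regularCost t ω) +
        ∑ s ∈ Finset.range T, {ω | F.Switch s ω}.indicator
          (fun ω => ENNReal.ofReal (F.resetCost T s ω)) ω := by
      intro ω
      refine (ENNReal.ofReal_le_ofReal (totalCost_le hQR T ω)).trans ?_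
      rw [ENNReal.ofReal_add (Finset.sum_nonneg fun t _ => hreg t ω)
        (Finset.sum_nonneg fun s _ => by split_ifs; exacts [hres s ω, le_rfl]),
        ENNReal.ofReal_sum_of_nonneg fun t _ => hreg t ω,
        ENNReal.ofReal_sum_of_nonneg fun s _ => by split_ifs; exacts [hres s ω, le_rfl]]
      refine add_le_add_right (Finset.sum_le_sum fun s _ => ?_) _
      by_cases hs : F.Switch s ω
      · rw [if_pos hs, Set.indicator_of_mem (s := {ω | F.Switch s ω}) hs]
      · simp [hs]
    refine (lintegral_mono h1).trans ?_
    rw [lintegral_add_left (Finset.measurable_fun_sum _ fun t _ =>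
        (measurable_regularCost ho hQR t).ennreal_ofReal),
      lintegral_finsetSum _ fun t _ => (measurable_regularCost ho hQR t).ennreal_ofReal,
      lintegral_finsetSum _ fun s _ => (measurable_resetCost ho hQR T s).ennreal_ofReal.indicator
        (measurableSet_switch hQR s)]
    have h2 : ∀ t, ∫⁻ ω, ENNReal.ofReal (F.regularCost t ω) ∂F.law ≤
        ENNReal.ofReal (∫ p, F.gap sol t p ∂pertLaw d k F.η + C * ν * (3 * (F.η * C))) := by
      intro t
      rw [ENNReal.ofReal_add (hgap0 t) (mul_nonneg hCν hq), ENNReal.ofReal_mul hCν]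
      refine (lintegral_regularCost_law_le hcert ho hη hC.le hQR htr hW t).trans ?_
      gcongr
      exact law_switch_le hη hC hQR htr t
    have h3 : ∀ s, ∫⁻ ω, {ω | F.Switch s ω}.indicator
        (fun ω => ENNReal.ofReal (F.resetCost T s ω)) ω ∂F.law ≤
        ENNReal.ofReal (Cr * (3 * (F.η * C))) := by
      intro s
      rw [lintegral_indicator (measurableSet_switch hQR s), ENNReal.ofReal_mul hCr]
      refine (hreset s).trans ?_
      gcongr
      exact law_switch_le hη hC hQR htr s
    refine (add_le_add (Finset.sum_le_sum fun t _ => h2 t)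
      (Finset.sum_le_sum fun s _ => h3 s)).trans ?_
    have h4 : ∀ t, 0 ≤ ∫ p, F.gap sol t p ∂pertLaw d k F.η + C * ν * (3 * (F.η * C)) :=
      fun t => add_nonneg (hgap0 t) (mul_nonneg hCν hq)
    have h5 : 0 ≤ Cr * (3 * (F.η * C)) := mul_nonneg hCr hq
    rw [← ENNReal.ofReal_sum_of_nonneg fun t _ => h4 t,
      ← ENNReal.ofReal_sum_of_nonneg fun _ _ => h5,
      ← ENNReal.ofReal_add (Finset.sum_nonneg fun t _ => h4 t) (Finset.sum_nonneg fun _ _ => h5)]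
    refine ENNReal.ofReal_le_ofReal ?_
    have h6 := sum_integral_gap_le hcert hη hd hC.le hν hQR htr hZ hZν T
    rw [Finset.sum_add_distrib, Finset.sum_const, Finset.sum_const, Finset.card_range,
      nsmul_eq_mul, nsmul_eq_mul, hb]
    linarith
  have hint : Integrable (F.totalCost T) F.law := by
    refine ⟨hmeas.aestronglyMeasurable, ?_⟩
    rw [hasFiniteIntegral_iff_ofReal (Filter.Eventually.of_forall hnn)]
    exact key.trans_lt ENNReal.ofReal_lt_top
  refine ⟨hint, ?_⟩
  rw [← ofReal_integral_eq_lintegral_ofReal hint (Filter.Eventually.of_forall hnn)] at key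
  exact (ENNReal.ofReal_le_ofReal_iff hb0).mp key

end FLL

/-! ### Tuning -/

section Tuning

variable {n T : ℕ} {C ν Cr : ℝ}

theorem tunedEta_pos (hn : 0 < n) (hT : 1 ≤ T) (hC : 0 < C) (hν : 0 < ν) (hCr : 0 ≤ Cr) :
    0 < tunedEta n C ν Cr T := by
  unfold tunedEta
  have h1 : (0 : ℝ) < n := by exact_mod_cast hn
  have h2 : (0 : ℝ) < T := by exact_mod_cast hT
  positivity

theorem rpow_three_quarters_sq (n : ℕ) : ((n : ℝ) ^ (3 / 4 : ℝ)) ^ 2 = n * √(n : ℝ) := by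
  rw [← Real.rpow_natCast, ← Real.rpow_mul n.cast_nonneg, Real.sqrt_eq_rpow,
    ← Real.rpow_one_add' n.cast_nonneg (by norm_num)]
  norm_num

/-- As `η²` is proportional to `√n`, this term is of order `n^(1/4)`; it is weakened to the
`n^(3/4)` of the perturbation term. The 4 is the root of the 16 in `η`. -/
theorem switching_cost_le (hn : 0 < n) (hT : 1 ≤ T) (hC : 0 < C) (hν : 0 < ν) (hCr : 0 ≤ Cr) :
    T * (tunedEta n C ν Cr T * C * (Cr + C * ν)) ≤
      4 * ((n : ℝ) ^ (3 / 4 : ℝ) * √(C * ν * (Cr + C * ν) * T)) := by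
  have h1 : (1 : ℝ) ≤ n := by exact_mod_cast hn
  have h2 : (0 : ℝ) < T := by exact_mod_cast hT
  have hη := tunedEta_pos hn hT hC hν hCr
  have hsn : 0 < √(n : ℝ) := Real.sqrt_pos.mpr (by linarith)
  have hn34 := rpow_three_quarters_sq n
  refine le_of_sq_le_sq ?_ (by positivity)
  have hsq : tunedEta n C ν Cr T ^ 2 = 16 * ν * n / (T * C * √n * (Cr + 8 * C * ν)) :=
    Real.sq_sqrt (by positivity)
  have hX : 0 < Cr + 8 * C * ν := by positivity
  have hY : 0 < Cr + C * ν := by positivity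
  rw [mul_pow, mul_pow, mul_pow, hsq, mul_pow, mul_pow, hn34, Real.sq_sqrt (by positivity)]
  have hnn : √(n : ℝ) * √(n : ℝ) = n := Real.mul_self_sqrt (by linarith)
  have e1 : (T : ℝ) ^ 2 * (16 * ν * n / (T * C * √n * (Cr + 8 * C * ν)) * C ^ 2 *
      (Cr + C * ν) ^ 2) = 16 * (T * C * ν * (Cr + C * ν)) * √n *
        ((Cr + C * ν) / (Cr + 8 * C * ν)) := by
    rw [show 16 * ν * (n : ℝ) = 16 * ν * (√n * √n) by rw [hnn]]
    field_simp
  have h3 : (Cr + C * ν) / (Cr + 8 * C * ν) ≤ 1 := by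
    rw [div_le_one hX]
    nlinarith [mul_pos hC hν]
  rw [e1]
  calc 16 * (T * C * ν * (Cr + C * ν)) * √n * ((Cr + C * ν) / (Cr + 8 * C * ν))
      ≤ 16 * (T * C * ν * (Cr + C * ν)) * √n * 1 := by gcongr
    _ ≤ 16 * (T * C * ν * (Cr + C * ν)) * √n * n := by gcongr
    _ = _ := by ring

theorem perturbation_cost_le (hn : 0 < n) (hT : 1 ≤ T) (hC : 0 < C) (hν : 0 < ν) (hCr : 0 ≤ Cr) :
    ν * n / tunedEta n C ν Cr T ≤ (n : ℝ) ^ (3 / 4 : ℝ) * √(C * ν * (Cr + C * ν) * T) := by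
  have h1 : (1 : ℝ) ≤ n := by exact_mod_cast hn
  have h2 : (0 : ℝ) < T := by exact_mod_cast hT
  have hη := tunedEta_pos hn hT hC hν hCr
  have hsn : 0 < √(n : ℝ) := Real.sqrt_pos.mpr (by linarith)
  have hn34 := rpow_three_quarters_sq n
  refine le_of_sq_le_sq ?_ (by positivity)
  have hsq : tunedEta n C ν Cr T ^ 2 = 16 * ν * n / (T * C * √n * (Cr + 8 * C * ν)) :=
    Real.sq_sqrt (by positivity)
  have hX : 0 < Cr + 8 * C * ν := by positivity
  have hY : 0 < Cr + C * ν := by positivity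
  rw [div_pow, mul_pow, hsq, mul_pow, hn34, Real.sq_sqrt (by positivity)]
  have e1 : ν ^ 2 * (n : ℝ) ^ 2 / (16 * ν * n / (T * C * √n * (Cr + 8 * C * ν))) =
      n * √n * (C * ν * T) * ((Cr + 8 * C * ν) / 16) := by
    field_simp
  rw [e1]
  calc n * √n * (C * ν * T) * ((Cr + 8 * C * ν) / 16)
      -- The 16 in `η` absorbs the 8 in `Cr + 8 C ν`.
      ≤ n * √n * (C * ν * T) * (Cr + C * ν) := by
        gcongr
        nlinarith [mul_pos hC hν]
    _ = _ := by ring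

theorem burn_in_cost_le {κ γ : ℝ} (hn : 0 < n) (hC : 0 < C) (hν : 0 < ν)
    (hCr : 0 ≤ Cr) (hγ : 0 < γ) (h : κ ^ 8 / γ ^ 2 ≤ T) :
    C * κ ^ 4 * ν / γ ≤ (n : ℝ) ^ (3 / 4 : ℝ) * √(C * ν * (Cr + C * ν) * T) := by
  have h1 : (1 : ℝ) ≤ n := by exact_mod_cast hn
  have h2 : (1 : ℝ) ≤ (n : ℝ) ^ (3 / 4 : ℝ) := Real.one_le_rpow h1 (by norm_num)
  have h3 : C * κ ^ 4 * ν / γ ≤ √(C * ν * (Cr + C * ν) * T) := by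
    refine Real.le_sqrt_of_sq_le ?_
    calc (C * κ ^ 4 * ν / γ) ^ 2 = C * ν * (C * ν) * (κ ^ 8 / γ ^ 2) := by
          field_simp
      _ ≤ C * ν * (Cr + C * ν) * T := by
          gcongr
          linarith
  nlinarith [Real.sqrt_nonneg (C * ν * (Cr + C * ν) * T)]

end Tuning

end OnlineLQ

theorem mainTheorem2 :
    ∃ c : ℝ, 0 < c ∧
      ∀ (d k : ℕ) (_ : 0 < d) (F : OnlineLQ.FLL d k) (T : ℕ) (C Cr lam κ γ ν : ℝ)
        (_ : 1 ≤ T) (_ : 0 < C) (_ : 0 ≤ Cr) (_ : 0 < lam)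
        (_ : F.S.W.PosSemidef) (_ : F.S.W.trace ≤ lam ^ 2)
        (_ : ∀ t, (F.Q t).PosSemidef ∧ (F.R t).PosSemidef)
        (_ : ∀ t, (F.Q t).trace ≤ C ∧ (F.R t).trace ≤ C)
        (_ : ν = 2 * κ ^ 4 * lam ^ 2 / γ)
        (_ : F.η = OnlineLQ.tunedEta (d + k) C ν Cr T)
        (_ : F.S.IsControlOracle ν F.oracle ∨ F.S.IsSDPOracle ν F.oracle)
        (_ : F.ResetCostAtMost T Cr)
        (Kstar : Matrix (Fin k) (Fin d) ℝ) (_ : F.S.StronglyStable κ γ Kstar),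
        MeasureTheory.Integrable (F.totalCost T) F.law ∧
        (∫ ω, F.totalCost T ω ∂F.law) - F.S.policyCost F.Q F.R Kstar T ≤
          c * (((d + k : ℕ) : ℝ) ^ (3 / 4 : ℝ) * Real.sqrt (C * ν * (Cr + C * ν) * T)
            + C * κ ^ 4 * ν / γ) ∧
        (κ ^ 8 / γ ^ 2 ≤ T →
          (∫ ω, F.totalCost T ω ∂F.law) - F.S.policyCost F.Q F.R Kstar T ≤
            c * (((d + k : ℕ) : ℝ) ^ (3 / 4 : ℝ) * Real.sqrt (C * ν * (Cr + C * ν) * T))) := by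
  -- The perturbation term contributes 3, the switching term `3 · 4`, and the comparator's transient
  -- 2. For long horizons the transient is at most the main term, so the sum 17 suffices in both
  -- claims.
  refine ⟨17, by norm_num, ?_⟩
  intro d k hd F T C Cr lam κ γ ν hT hC hCr hlam hW hWt hQR htr hν hη ho hreset Kstar hK
  have hκ : 0 < κ := hK.1
  have hγ : 0 < γ := hK.2.1
  have hν0 : 0 < ν := by
    rw [hν]
    positivity
  have hn : 0 < d + k := Nat.add_pos_left hd k
  have hη0 : 0 < F.η := hη ▸ OnlineLQ.tunedEta_pos hn hT hC hν0 hCr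
  obtain ⟨X, hX, hXe, hXt⟩ := hK.exists_steadyCov hd hW
  have hXν : X.trace + (Kstar * X * Kstar.transpose).trace ≤ ν :=
    hν ▸ hK.trace_gainCov_le hd hWt hX hXt
  have hmo : OnlineLQ.MeasurableOracle F.oracle := ho.elim (fun h => h.1) fun h => h.1
  -- From here on the two types of oracle are indistinguishable.
  obtain ⟨sol, hcert⟩ : ∃ sol, F.S.IsCertificate ν F.oracle sol (OnlineLQ.gainCov Kstar X) :=
    ho.elim (fun h => h.exists_certificate ⟨hK.stable, hX, hXe⟩ hXν)
      fun h => h.exists_certificate hX hXe hXν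
  obtain ⟨hint, hle⟩ := OnlineLQ.FLL.integral_totalCost_le hcert hmo hη0 hd hC hν0.le hCr hQR htr hW
    (OnlineLQ.gainCov_posSemidef Kstar hX) ((OnlineLQ.trace_gainCov Kstar X).trans_le hXν) hreset
  have h1 := OnlineLQ.sum_sdpCost_le_policyCost hK hd hW hQR hC.le htr hX hXe hXν T
  have h2 := OnlineLQ.switching_cost_le hn hT hC hν0 hCr
  have h3 := OnlineLQ.perturbation_cost_le hn hT hC hν0 hCr
  rw [← hη] at h2 h3
  have h4 : 2 * C * κ ^ 4 * ν / γ = 2 * (C * κ ^ 4 * ν / γ) := by ring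
  have h5 : 0 ≤ C * κ ^ 4 * ν / γ := by positivity
  have h7 : 0 ≤ ((d + k : ℕ) : ℝ) ^ (3 / 4 : ℝ) * √(C * ν * (Cr + C * ν) * T) := by positivity
  refine ⟨hint, ?_, fun h => ?_⟩
  · linarith
  · have h6 := OnlineLQ.burn_in_cost_le (κ := κ) hn hC hν0 hCr hγ h
    linarith
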